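/- Let $\xi$ be a real-valued (unkilled) Lévy process that is non-lattice, let $R:\mathbb R\to(0,\infty)$ be continuous with $\liminf_{x\to-\infty}1/R(x)>0$ and $\liminf_{x\to-\infty}R(x)/R(z+x)>0$ for every $z\in\mathbb R$, and let $\theta>0$. Let $X$ be the time-changed Lévy process: started from $x\in\mathbb R$, $$X_t=x+\xi_{\eta(t)},\qquad \eta(t)=\inf\Big\{s>0:\int_0^s\frac{dr}{R(x+\xi_r)}>t\Big\},\qquad t<\int_0^\infty\frac{dr}{R(x+\xi_r)},$$ and $X_t=+\infty$ for later $t$; let $(p_t)$ be its transition semigroup on $\mathbb R$ (killed at the explosion time). For $z\in\mathbb R$ and a càdlàg path $w:[0,\infty)\to(-\infty,+\infty]$ put $g(z,x)=R(x)/R(z+x)$ for $x\in\mathbb R$, $g(z,+\infty)=1$, and $$\Phi_z(w)_t=z+w_{h_z(t)},\qquad h_z(t)=\inf\Big\{s\ge0:\int_0^s g(z,w_u)\,du>t\Big\},$$ with $\Phi_z(w)_t=+\infty$ for $t\ge\int_0^\infty g(z,w_u)\,du$. An excursion is a càdlàg path $\mathbf e:[0,\infty)\to(-\infty,+\infty]$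 with $\mathbf e_t=+\infty$ for all $t\ge\zeta$, where $\zeta=\zeta(\mathbf e)=\inf\{t>0:\mathbf e_t=+\infty\}\in[0,\infty]$. The space of excursions carries the $\sigma$-algebra generated by the coordinates. A $\sigma$-finite measure $\mathbf n'$ on it is an excursion measure of $X$ if $\zeta>0$ $\mathbf n'$-a.e. and, under $\mathbf n'$, $(\mathbf e_t)_{0<t<\zeta}$ is Markov with semigroup $(p_t)$: for all $s,t>0$, all $\Lambda\in\sigma(\mathbf e_u,u\le s)$ and all Borel $A\subseteq\mathbb R$, $$\mathbf n'(\Lambda,\ \mathbf e_{s+t}\in A,\ s+t<\zeta)=\int_{\Lambda\cap\{s<\zeta\}}p_t(\mathbf e_s,A)\,d\mathbf n'.$$ (In particular the measures $n'_s(A)=\mathbf n'(\mathbf e_s\in A,\ s<\zeta)$, $s>0$, form an entrance law for $(p_t)$.) Its mean occupation measure is $m'(A)=\mathbf n'\big(\int_0^\zeta\mathbf 1_A(\mathbf e_s)\,ds\big)$ for Borel $A\subseteq\mathbb R$. **Proposition 5.3.** Let $\mathbf n'\neq0$ be a $\sigma$-finite excursion measure of $X$ whose mean occupation measure $m'$ is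 $\sigma$-finite. Then $$\Phi_z^*\mathbf n'=e^{-\theta z}\,\mathbf n'\quad\text{for all }z\in\mathbb R$$ (equality of measures on the $\sigma$-algebra generated by the coordinates, $\Phi_z^*\mathbf n'$ being the image of $\mathbf n'$ under $\Phi_z$) if and only if there is a constant $C>0$ such that $$m'(dy)=C\,\frac{e^{\theta y}}{R(y)}\,dy .$$ -/

import Mathlib

open MeasureTheory ProbabilityTheory Filter Topology Set
open scoped NNReal ENNReal

noncomputable section

namespace TimeChangedLevy

/-- Right-continuous with left limits in the state space `E`. At `t = 0` the condition on the
left limit is void. -/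
def IsCadlag {E : Type*} [TopologicalSpace E] (f : ℝ≥0 → E) : Prop :=
  ∀ t, ContinuousWithinAt f (Ici t) t ∧ ∃ l, Tendsto f (𝓝[<] t) (𝓝 l)

/-- Real-valued (hence unkilled) Lévy process issued from `0`. -/
structure IsLevyProcess {Ω : Type*} [MeasurableSpace Ω] (ξ : ℝ≥0 → Ω → ℝ) (P : Measure Ω) :
    Prop where
  measurable : ∀ t, Measurable (ξ t)
  zero : ∀ᵐ ω ∂P, ξ 0 ω = 0
  indep : HasIndepIncrements ξ P
  stationary : ∀ s t, P.map (fun ω => ξ (s + t) ω - ξ s ω) = P.map (ξ t)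
  cadlag : ∀ᵐ ω ∂P, IsCadlag fun t => ξ t ω

/-- The process lives on a lattice `rℤ` with `r > 0`. -/
def IsLattice {Ω : Type*} [MeasurableSpace Ω] (ξ : ℝ≥0 → Ω → ℝ) (P : Measure Ω) : Prop :=
  ∃ r : ℝ, 0 < r ∧ ∀ t, ∀ᵐ ω ∂P, ∃ k : ℤ, ξ t ω = k * r

/-- Lebesgue measure on the time axis `[0, ∞)`. -/
def timeMeasure : Measure ℝ≥0 := (volume : Measure ℝ).comap ((↑) : ℝ≥0 → ℝ)

/-- The clock `s ↦ ∫₀ˢ c(r) dr`. -/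
def clock (c : ℝ≥0 → ℝ≥0∞) (s : ℝ≥0) : ℝ≥0∞ := ∫⁻ r in Iic s, c r ∂timeMeasure

/-- The total amount `∫₀^∞ c(r) dr` on the clock. -/
def totalClock (c : ℝ≥0 → ℝ≥0∞) : ℝ≥0∞ := ∫⁻ r, c r ∂timeMeasure

/-- The right inverse `t ↦ inf {s : ∫₀ˢ c(r) dr > t}` of a clock. It is only used for
`t < totalClock c`, where the set is not empty. -/
def clockInv (c : ℝ≥0 → ℝ≥0∞) (t : ℝ≥0) : ℝ≥0 := sInf {s | (t : ℝ≥0∞) < clock c s}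

/-- The time-changed Lévy process `X` started from `x`: it is `x + ξ_{η(t)}` before the explosion
time `∫₀^∞ dr / R(x + ξ_r)` and `+∞` afterwards. -/
def timeChanged {Ω : Type*} (R : ℝ → ℝ) (ξ : ℝ≥0 → Ω → ℝ) (x : ℝ) (ω : Ω) (t : ℝ≥0) :
    WithTop ℝ :=
  open scoped Classical in
  if (t : ℝ≥0∞) < totalClock (fun r => ENNReal.ofReal (1 / R (x + ξ r ω))) then
    ((x + ξ (clockInv (fun r => ENNReal.ofReal (1 / R (x + ξ r ω))) t) ω : ℝ) : WithTop ℝ)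
  else ⊤

/-- The (sub-Markov) transition function on `ℝ` of the time-changed Lévy process:
the probability that `X`, started from `x`, has not exploded at time `t` and lies in `A`. -/
def transition {Ω : Type*} [MeasurableSpace Ω] (R : ℝ → ℝ) (ξ : ℝ≥0 → Ω → ℝ) (P : Measure Ω)
    (t : ℝ≥0) (x : ℝ) (A : Set ℝ) : ℝ≥0∞ :=
  P {ω | ∃ y ∈ A, timeChanged R ξ x ω t = (y : WithTop ℝ)}

/-- The lifetime `ζ(w) = inf {t > 0 : w t = +∞}`. -/
def lifetime (w : ℝ≥0 → WithTop ℝ) : ℝ≥0∞ :=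
  ⨅ t ∈ {t : ℝ≥0 | 0 < t ∧ w t = ⊤}, (t : ℝ≥0∞)

/-- Excursion functions away from `+∞`: càdlàg functions with values in `(-∞, +∞]` (with its
order topology) that stay at `+∞` from their lifetime on. -/
def IsExcursion (w : ℝ≥0 → WithTop ℝ) : Prop :=
  IsCadlag w ∧ ∀ t : ℝ≥0, lifetime w ≤ t → w t = ⊤

/-- The space of excursions away from `+∞`; as a subtype of a product space it carries the
σ-algebra generated by the coordinate maps. -/
abbrev Excursion : Type := {w : ℝ≥0 → WithTop ℝ // IsExcursion w}

/-- The σ-algebra generated by the coordinates up to time `s`. -/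
abbrev past (s : ℝ≥0) : MeasurableSpace Excursion :=
  ⨆ u ∈ Iic s, MeasurableSpace.comap (fun w : Excursion => w.1 u) inferInstance

/-- `n` is an excursion measure (away from `+∞`) of the time-changed Lévy process: it charges only
excursions of positive lifetime, and under `n` the coordinate process on `(0, ζ)` is Markov with
the transition function of `X`. With `Λ` the whole space this says that the measures
`n_s(A) = n(e_s ∈ A, s < ζ)` form an entrance law. -/
structure IsExcursionMeasure {Ω : Type*} [MeasurableSpace Ω] (R : ℝ → ℝ) (ξ : ℝ≥0 → Ω → ℝ)
    (P : Measure Ω) (n : Measure Excursion) : Prop where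
  lifetime_pos : ∀ᵐ w ∂n, 0 < lifetime w.1
  markov : ∀ s t : ℝ≥0, 0 < s → 0 < t → ∀ Λ : Set Excursion, MeasurableSet[past s] Λ →
    ∀ A : Set ℝ, MeasurableSet A →
      n (Λ ∩ {w | ((s + t : ℝ≥0) : ℝ≥0∞) < lifetime w.1 ∧
          ∃ y ∈ A, w.1 (s + t) = (y : WithTop ℝ)}) =
        ∫⁻ w in Λ ∩ {w | (s : ℝ≥0∞) < lifetime w.1},
          transition R ξ P t ((w.1 s).untopD 0) A ∂n

/-- The rate `g(z, x)`: it is `R(x) / R(z + x)` for real `x`, and `1` for `x = +∞`. -/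
def scalingRate (R : ℝ → ℝ) (z : ℝ) : WithTop ℝ → ℝ≥0∞
  | ⊤ => 1
  | (x : ℝ) => ENNReal.ofReal (R x / R (z + x))

/-- The path transform `Φ_z(w)_t = z + w_{h_z(t)}`, where `h_z` is the right inverse of
`s ↦ ∫₀ˢ g(z, w_u) du`, and `Φ_z(w)_t = +∞` for `t ≥ ∫₀^∞ g(z, w_u) du`. -/
def pathTransform (R : ℝ → ℝ) (z : ℝ) (w : ℝ≥0 → WithTop ℝ) (t : ℝ≥0) : WithTop ℝ :=
  open scoped Classical in
  if (t : ℝ≥0∞) < totalClock (fun u => scalingRate R z (w u)) then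
    (z : WithTop ℝ) + w (clockInv (fun u => scalingRate R z (w u)) t)
  else ⊤

/-- The time `∫₀^ζ 1_A(w_s) ds` that an excursion spends in `A ⊆ ℝ`. -/
def occupationTime (w : Excursion) (A : Set ℝ) : ℝ≥0∞ :=
  timeMeasure {s | (s : ℝ≥0∞) < lifetime w.1 ∧ ∃ y ∈ A, w.1 s = (y : WithTop ℝ)}

theorem occupationSet_eq (w : Excursion) (A : Set ℝ) :
    {s : ℝ≥0 | (s : ℝ≥0∞) < lifetime w.1 ∧ ∃ y ∈ A, w.1 s = (y : WithTop ℝ)} =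
      {s : ℝ≥0 | w.1 s ∈ ((↑) : ℝ → WithTop ℝ) '' A} := by
  ext s
  constructor
  · rintro ⟨-, y, hy, h⟩
    exact ⟨y, hy, h.symm⟩
  · rintro ⟨y, hy, h⟩
    refine ⟨?_, y, hy, h.symm⟩
    by_contra hs
    have := w.2.2 s (not_lt.1 hs)
    rw [this] at h
    exact WithTop.coe_ne_top h

theorem measurableSet_coe_image {A : Set ℝ} (hA : MeasurableSet A) :
    MeasurableSet (((↑) : ℝ → WithTop ℝ) '' A) :=
  WithTop.isOpenEmbedding_some.measurableEmbedding.measurableSet_image.2 hA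

/-- The coordinate process is jointly measurable in the path and in time. -/
theorem measurable_eval : Measurable fun p : Excursion × ℝ≥0 => p.1.1 p.2 := by
  have key : ∀ n : ℕ, Measurable fun p : Excursion × ℝ≥0 =>
      p.1.1 (((⌊p.2 * ((n : ℝ≥0) + 1)⌋₊ : ℝ≥0) + 1) / ((n : ℝ≥0) + 1)) := by
    intro n
    have h1 : Measurable fun p : Excursion × ℕ =>
        p.1.1 (((p.2 : ℝ≥0) + 1) / ((n : ℝ≥0) + 1)) :=
      measurable_from_prod_countable_left fun k =>
        (measurable_pi_apply (((k : ℝ≥0) + 1) / ((n : ℝ≥0) + 1))).comp measurable_subtype_coe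
    have h2 : Measurable fun p : Excursion × ℝ≥0 =>
        ((p.1, ⌊p.2 * ((n : ℝ≥0) + 1)⌋₊) : Excursion × ℕ) :=
      measurable_fst.prodMk (Nat.measurable_floor.comp (by fun_prop))
    exact h1.comp h2
  refine measurable_of_tendsto_metrizable key (tendsto_pi_nhds.2 fun p => ?_)
  have hc := (p.1.2.1 p.2).1
  have hlow : ∀ n : ℕ,
      p.2 ≤ ((⌊p.2 * ((n : ℝ≥0) + 1)⌋₊ : ℝ≥0) + 1) / ((n : ℝ≥0) + 1) := by
    intro n
    rw [le_div_iff₀ (by positivity)]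
    exact (Nat.lt_floor_add_one _).le
  have hup : ∀ n : ℕ,
      ((⌊p.2 * ((n : ℝ≥0) + 1)⌋₊ : ℝ≥0) + 1) / ((n : ℝ≥0) + 1) ≤ p.2 + 1 / ((n : ℝ≥0) + 1) := by
    intro n
    rw [add_div]
    gcongr
    rw [div_le_iff₀ (by positivity)]
    exact Nat.floor_le (by positivity)
  have hlim : Tendsto (fun n : ℕ => p.2 + 1 / ((n : ℝ≥0) + 1)) atTop (𝓝 p.2) := by
    simpa using tendsto_const_nhds.add (tendsto_one_div_add_atTop_nhds_zero_nat (𝕜 := ℝ≥0))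
  exact hc.tendsto.comp (tendsto_nhdsWithin_iff.2
    ⟨tendsto_of_tendsto_of_tendsto_of_le_of_le tendsto_const_nhds hlim hlow hup,
      Eventually.of_forall hlow⟩)

instance : SigmaFinite timeMeasure := by
  have h : MeasurableEmbedding ((↑) : ℝ≥0 → ℝ) := .subtype_coe measurableSet_Ici
  have : IsFiniteMeasureOnCompacts timeMeasure :=
    IsFiniteMeasureOnCompacts.comap' _ NNReal.continuous_coe h
  infer_instance

theorem measurable_occupationTime {A : Set ℝ} (hA : MeasurableSet A) :
    Measurable fun w : Excursion => occupationTime w A := by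
  have := measurable_measure_prodMk_left (ν := timeMeasure)
    (measurable_eval (measurableSet_coe_image hA))
  simp only [occupationTime, occupationSet_eq]
  exact this

theorem occupationTime_iUnion (w : Excursion) {A : ℕ → Set ℝ} (hA : ∀ i, MeasurableSet (A i))
    (hd : Pairwise (Function.onFun Disjoint A)) :
    occupationTime w (⋃ i, A i) = ∑' i, occupationTime w (A i) := by
  simp only [occupationTime, occupationSet_eq, image_iUnion]
  have he : {s : ℝ≥0 | w.1 s ∈ ⋃ i, ((↑) : ℝ → WithTop ℝ) '' A i} =
      ⋃ i, {s : ℝ≥0 | w.1 s ∈ ((↑) : ℝ → WithTop ℝ) '' A i} := by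
    ext s
    simp only [mem_iUnion, mem_ofPred_eq]
  rw [he, measure_iUnion]
  · intro i j hij
    refine Disjoint.preimage w.1 ?_
    exact (disjoint_image_iff WithTop.coe_injective).2 (hd hij)
  · intro i
    exact (measurable_eval.comp measurable_prodMk_left) (measurableSet_coe_image (hA i))

/-- The mean occupation measure `m(A) = n(∫₀^ζ 1_A(e_s) ds)`, `A ⊆ ℝ` Borel. -/
def meanOccupation (n : Measure Excursion) : Measure ℝ :=
  Measure.ofMeasurable (fun A _ => ∫⁻ w, occupationTime w A ∂n)
    (by simp [occupationTime])
    (by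
      intro A hA hd
      simp only [occupationTime_iUnion _ hA hd]
      exact lintegral_tsum fun i => (measurable_occupationTime (hA i)).aemeasurable)

theorem meanOccupation_apply (n : Measure Excursion) {A : Set ℝ} (hA : MeasurableSet A) :
    meanOccupation n A = ∫⁻ w, occupationTime w A ∂n :=
  Measure.ofMeasurable_apply A hA

end TimeChangedLevy

end

noncomputable section

namespace TimeChangedLevy

/-! ### Lebesgue measure on the time axis -/

/-! Write `m` for the mean occupation measure of `n` and `P_x` for the law of `X` started from `x`.
Three facts turn the statement about path measures into one about `m`.

Occupation determines the shifted paths. The Markov property at a fixed time `s > 0`, integrated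
over `s`, gives `n(∫₀^ζ F(e_{s+·}) ds) = ∫ E_x[F] m(dx)` for every measurable `F ≥ 0` on paths
(`HasPathMarkov.shiftMeasure_eq`).

`Φ_z` acts simply on this formula. Since `g(z,y) / R(y) = 1 / R(z+y)`, composing time changes shows
that `Φ_z` carries `P_x` to `P_{z+x}` (`pathTransformRC_levyTimeChange`). The substitution in time
contributes the factor `g(z, e_s)`, so for the image of `n` under `Φ_z` the same quantity is `∫
g(z,x) E_{z+x}[F] m(dx)` (`HasPathMarkov.lintegral_shiftMeasure_pathTransformRC`).

The shifted paths determine the measure. Kac's identity writes `1 - exp(-∫V)` as the time integral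
of `V(w_{s+·})` times the exponential of minus the part of `∫V` after `s`. It therefore fixes all
mixed moments of the variables `exp(-∫_t^∞ f(w_r) dr)` under the finite measure with density `1 -
exp(-∫f)`, and `f(w_t)` is recovered as a one-sided derivative of `t ↦ -∫_t^∞ f(w_r) dr`
(`eq_of_shiftMeasure_eq`).

Scale invariance of `n` thus amounts to `∫ g(z,x) φ(z+x) m(dx) = e^{-θz} ∫ φ dm` for all `z` and
`φ`. This says that `e^{-θy} R(y) m(dy)` is invariant under translations; being σ-finite and
nonzero, it is a positive multiple of Lebesgue measure.

One point is delicate. For an excursion that comes down from `+∞`, the clock of rate `g(z,·)` may be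
infinite at every positive time; then `Φ_z(e)` is identically `+∞` and the substitution in time
fails. Invariance of `n` excludes this, because almost every transformed path must be finite
somewhere. Starting from `m` instead, such an explosion would bound the time integral of `g(z, v₀)
f(Φ_z(v)_t)` over the shifts `v` of `e` from below by some `L > 0` independent of `t`, whereas the
`n`-integral of that quantity is `e^{-θz} n(∫ f(e_{s+t}) ds)`, which tends to `0` as `t → ∞`.
Fatou's lemma gives the contradiction (`ae_exists_clock_ne_top_of_lintegral_eq`). -/

theorem measurableEmbedding_coe_nnreal : MeasurableEmbedding ((↑) : ℝ≥0 → ℝ) :=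
  .subtype_coe measurableSet_Ici

theorem timeMeasure_eq_volume_image (s : Set ℝ≥0) :
    timeMeasure s = volume (((↑) : ℝ≥0 → ℝ) '' s) :=
  measurableEmbedding_coe_nnreal.comap_apply _ _

theorem map_coe_timeMeasure :
    timeMeasure.map ((↑) : ℝ≥0 → ℝ) = volume.restrict (Ici 0) := by
  rw [timeMeasure, measurableEmbedding_coe_nnreal.map_comap, NNReal.range_coe]

theorem timeMeasure_Iio (a : ℝ≥0) : timeMeasure (Iio a) = a := by
  have h : Iio a = ((↑) : ℝ≥0 → ℝ) ⁻¹' (Iio (a : ℝ)) := by ext; simp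
  rw [h, ← measurableEmbedding_coe_nnreal.map_apply, map_coe_timeMeasure,
    Measure.restrict_apply measurableSet_Iio, inter_comm, Ici_inter_Iio, Real.volume_Ico]
  simp

instance : NullSingletonClass timeMeasure where
  measure_singleton x := by
    rw [timeMeasure_eq_volume_image]
    simp

theorem timeMeasure_coe_lt (x : ℝ≥0∞) : timeMeasure {t : ℝ≥0 | (t : ℝ≥0∞) < x} = x := by
  induction x using ENNReal.recTopCoe with
  | coe a =>
    simp only [ENNReal.coe_lt_coe]
    exact timeMeasure_Iio a
  | top =>
    refine ENNReal.eq_top_of_forall_nnreal_le fun r => ?_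
    rw [← timeMeasure_Iio r]
    exact measure_mono fun t _ => ENNReal.coe_lt_top

theorem map_add_left_timeMeasure (s : ℝ≥0) :
    timeMeasure.map (fun t => s + t) = timeMeasure.restrict (Ici s) := by
  have hm : Measurable fun t : ℝ≥0 => s + t := measurable_const_add s
  have : (timeMeasure.map (fun t => s + t)).map ((↑) : ℝ≥0 → ℝ) =
      (timeMeasure.restrict (Ici s)).map ((↑) : ℝ≥0 → ℝ) := by
    rw [Measure.map_map measurableEmbedding_coe_nnreal.measurable hm]
    have h1 : ((↑) : ℝ≥0 → ℝ) ∘ (fun t => s + t) = (fun x : ℝ => (s : ℝ) + x) ∘ (↑) := by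
      ext t; simp
    rw [h1, ← Measure.map_map (measurable_const_add _) measurableEmbedding_coe_nnreal.measurable,
      map_coe_timeMeasure]
    have h2 : Ici s = ((↑) : ℝ≥0 → ℝ) ⁻¹' (Ici (s : ℝ)) := by ext; simp
    rw [h2, ← measurableEmbedding_coe_nnreal.restrict_map, map_coe_timeMeasure,
      Measure.restrict_restrict measurableSet_Ici]
    have h3 : Ici (0 : ℝ) = (fun x : ℝ => (s : ℝ) + x) ⁻¹' (Ici (s : ℝ)) := by ext; simp
    rw [h3, ← (measurableEmbedding_addLeft (s : ℝ)).restrict_map, map_add_left_eq_self]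
    congr 1
    ext x
    simp only [mem_Ici, mem_inter_iff, mem_preimage, le_add_iff_nonneg_right]
    exact ⟨fun h => ⟨h, s.2.trans h⟩, fun h => h.1⟩
  have inj := congrArg (Measure.comap ((↑) : ℝ≥0 → ℝ)) this
  rwa [measurableEmbedding_coe_nnreal.comap_map, measurableEmbedding_coe_nnreal.comap_map] at inj

theorem measurableEmbedding_add_left_nnreal (s : ℝ≥0) :
    MeasurableEmbedding fun t : ℝ≥0 => s + t := by
  refine (Topology.IsClosedEmbedding.measurableEmbedding ?_)
  refine Isometry.isClosedEmbedding ?_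
  intro x y
  rw [edist_dist, edist_dist, NNReal.dist_eq, NNReal.dist_eq]
  simp

theorem lintegral_Ici_timeMeasure (s : ℝ≥0) (f : ℝ≥0 → ℝ≥0∞) :
    ∫⁻ r in Ici s, f r ∂timeMeasure = ∫⁻ r, f (s + r) ∂timeMeasure := by
  rw [← map_add_left_timeMeasure, (measurableEmbedding_add_left_nnreal s).lintegral_map]

/-! ### Clocks -/

theorem clock_mono (c : ℝ≥0 → ℝ≥0∞) : Monotone (clock c) := fun _ _ h =>
  lintegral_mono_set (Iic_subset_Iic.2 h)

theorem clock_eq_Iio (c : ℝ≥0 → ℝ≥0∞) (s : ℝ≥0) :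
    clock c s = ∫⁻ r in Iio s, c r ∂timeMeasure :=
  (setLIntegral_congr Iio_ae_eq_Iic).symm

@[simp]
theorem clock_zero (c : ℝ≥0 → ℝ≥0∞) : clock c 0 = 0 := by
  rw [clock_eq_Iio]
  simp

theorem clock_le_totalClock (c : ℝ≥0 → ℝ≥0∞) (s : ℝ≥0) : clock c s ≤ totalClock c :=
  setLIntegral_le_lintegral _ _

theorem clock_add (c : ℝ≥0 → ℝ≥0∞) (s t : ℝ≥0) :
    clock c (s + t) = clock c s + clock (fun r => c (s + r)) t := by
  have h : Iio (s + t) = Iio s ∪ Ico s (s + t) := (Iio_union_Ico_eq_Iio (by simp)).symm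
  rw [clock_eq_Iio, h, lintegral_union measurableSet_Ico
    (by rw [Set.disjoint_left]; exact fun x hx hy => (hy.1.trans_lt hx).false), ← clock_eq_Iio]
  congr 1
  rw [clock_eq_Iio, ← lintegral_indicator measurableSet_Iio]
  have h2 : Ico s (s + t) = Ici s ∩ Iio (s + t) := rfl
  rw [h2, inter_comm, ← Measure.restrict_restrict measurableSet_Iio,
    ← lintegral_indicator measurableSet_Iio, lintegral_Ici_timeMeasure]
  refine lintegral_congr fun r => ?_
  simp [indicator]

theorem totalClock_add (c : ℝ≥0 → ℝ≥0∞) (s : ℝ≥0) :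
    totalClock c = clock c s + totalClock (fun r => c (s + r)) := by
  rw [totalClock, ← lintegral_add_compl _ (measurableSet_Iio (a := s)), ← clock_eq_Iio,
    compl_Iio, lintegral_Ici_timeMeasure]
  rfl

/-- Left-continuity of the clock by monotone convergence; it holds also where the clock is infinite.
-/
theorem exists_lt_clock {c : ℝ≥0 → ℝ≥0∞} {x : ℝ≥0∞} {a : ℝ≥0} (h : x < clock c a) :
    ∃ s < a, x < clock c s := by
  have ha : 0 < a := by
    rcases eq_zero_or_pos a with rfl | h'
    · simp at h
    · exact h'
  obtain ⟨u, hu, hua, hlim⟩ := exists_seq_strictMono_tendsto' ha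
  have hun : Iio a = ⋃ n, Iio (u n) := by
    ext x
    simp only [mem_Iio, mem_iUnion]
    exact ⟨fun hx => (hlim.eventually_const_lt hx).exists, fun ⟨n, hn⟩ => hn.trans (hua n).2⟩
  rw [clock_eq_Iio, hun, setLIntegral_iUnion_of_directed _
    (Monotone.directed_le fun i j hij => Iio_subset_Iio (hu.monotone hij))] at h
  obtain ⟨n, hn⟩ := lt_iSup_iff.1 h
  exact ⟨u n, (hua n).2, by rwa [clock_eq_Iio]⟩

theorem exists_lt_clock_of_lt_totalClock {c : ℝ≥0 → ℝ≥0∞} {x : ℝ≥0∞} (h : x < totalClock c) :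
    ∃ s, x < clock c s := by
  have hun : (univ : Set ℝ≥0) = ⋃ n : ℕ, Iic (n : ℝ≥0) := by
    ext x
    simpa using exists_nat_ge x
  rw [totalClock, ← setLIntegral_univ, hun, setLIntegral_iUnion_of_directed _
    (Monotone.directed_le fun i j hij => Iic_subset_Iic.2 (Nat.cast_le.2 hij))] at h
  obtain ⟨n, hn⟩ := lt_iSup_iff.1 h
  exact ⟨n, hn⟩

/-- The adjunction between a clock and its inverse, a consequence of left-continuity. Measurability,
right-continuity and all identities for inverse clocks are read off from it. -/
theorem clockInv_lt_iff {c : ℝ≥0 → ℝ≥0∞} {t : ℝ≥0} (ht : (t : ℝ≥0∞) < totalClock c) {a : ℝ≥0} :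
    clockInv c t < a ↔ (t : ℝ≥0∞) < clock c a := by
  have hne : {s | (t : ℝ≥0∞) < clock c s}.Nonempty := exists_lt_clock_of_lt_totalClock ht
  rw [clockInv, csInf_lt_iff (OrderBot.bddBelow _) hne]
  constructor
  · rintro ⟨s, hs, hsa⟩
    exact lt_of_lt_of_le hs (clock_mono c hsa.le)
  · intro h
    obtain ⟨s, hs, h'⟩ := exists_lt_clock h
    exact ⟨s, h', hs⟩

theorem clockInv_eq_zero_of_le {c : ℝ≥0 → ℝ≥0∞} {t : ℝ≥0} (ht : totalClock c ≤ t) :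
    clockInv c t = 0 := by
  have : {s | (t : ℝ≥0∞) < clock c s} = ∅ := by
    ext s
    simpa using (clock_le_totalClock c s).trans ht
  rw [clockInv, this, NNReal.sInf_empty]

theorem clock_clockInv_le {c : ℝ≥0 → ℝ≥0∞} {t : ℝ≥0} (ht : (t : ℝ≥0∞) < totalClock c) :
    clock c (clockInv c t) ≤ t :=
  not_lt.1 fun h => lt_irrefl _ ((clockInv_lt_iff ht).2 h)

/-- The clock is right-continuous where it is finite. -/
theorem exists_clock_lt {c : ℝ≥0 → ℝ≥0∞} {a b : ℝ≥0} (hab : a < b) (hb : clock c b ≠ ∞)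
    {x : ℝ≥0∞} (hx : clock c a < x) : ∃ s, a < s ∧ s ≤ b ∧ clock c s < x := by
  obtain ⟨u, hu, hua, hlim⟩ := exists_seq_strictAnti_tendsto' hab
  have hI : Iic a = ⋂ n, Iic (u n) := by
    ext y
    simp only [mem_Iic, mem_iInter]
    exact ⟨fun h n => h.trans (hua n).1.le, fun h => ge_of_tendsto' hlim h⟩
  have hfin : ∃ i, (timeMeasure.withDensity c) (Iic (u i)) ≠ ∞ := by
    refine ⟨0, ?_⟩
    rw [withDensity_apply _ measurableSet_Iic]
    exact ne_top_of_le_ne_top hb (clock_mono c (hua 0).2.le)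
  have ht := tendsto_measure_iInter_atTop (μ := timeMeasure.withDensity c)
    (s := fun n => Iic (u n)) (fun n => measurableSet_Iic.nullMeasurableSet)
    (fun i j hij => Iic_subset_Iic.2 (hu.antitone hij)) hfin
  rw [← hI] at ht
  simp only [Function.comp_def, withDensity_apply _ measurableSet_Iic] at ht
  obtain ⟨n, hn⟩ := (ht.eventually_lt_const hx).exists
  exact ⟨u n, (hua n).1, (hua n).2.le, hn⟩

/-- Equality needs the clock to be finite slightly beyond the inverse time, since a clock may jump
to `∞`; only `≤` is automatic. -/
theorem clock_clockInv {c : ℝ≥0 → ℝ≥0∞} {t : ℝ≥0} (ht : (t : ℝ≥0∞) < totalClock c) {b : ℝ≥0}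
    (hb : clockInv c t < b) (hfin : clock c b ≠ ∞) : clock c (clockInv c t) = t := by
  refine le_antisymm (clock_clockInv_le ht) (not_lt.1 fun h => ?_)
  obtain ⟨s, hs, -, hst⟩ := exists_clock_lt hb hfin h
  exact lt_asymm hst ((clockInv_lt_iff ht).1 hs)

theorem clockInv_mono {c : ℝ≥0 → ℝ≥0∞} {t t' : ℝ≥0} (h : t ≤ t')
    (ht' : (t' : ℝ≥0∞) < totalClock c) : clockInv c t ≤ clockInv c t' := by
  refine le_of_forall_gt fun a ha => ?_
  have ht : (t : ℝ≥0∞) < totalClock c := lt_of_le_of_lt (by exact_mod_cast h) ht'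
  exact (clockInv_lt_iff ht).2 (lt_of_le_of_lt (by exact_mod_cast h) ((clockInv_lt_iff ht').1 ha))

theorem measurable_clockInv (c : ℝ≥0 → ℝ≥0∞) : Measurable (clockInv c) := by
  refine measurable_of_Iio fun a => ?_
  have : clockInv c ⁻¹' Iio a = {t : ℝ≥0 | (t : ℝ≥0∞) < totalClock c ∧ (t : ℝ≥0∞) < clock c a} ∪
      {t : ℝ≥0 | totalClock c ≤ t ∧ 0 < a} := by
    ext t
    rcases lt_or_ge (t : ℝ≥0∞) (totalClock c) with h | h
    · simp [clockInv_lt_iff h, h, h.not_ge]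
    · simp [clockInv_eq_zero_of_le h, h, h.not_gt]
  rw [this]
  measurability

theorem measurableSet_coe_lt (x : ℝ≥0∞) : MeasurableSet {t : ℝ≥0 | (t : ℝ≥0∞) < x} :=
  measurableSet_lt measurable_coe_nnreal_ennreal measurable_const

/-- The image of Lebesgue measure under the inverse clock has density `c` where the clock is
finite. -/
theorem map_clockInv_restrict (c : ℝ≥0 → ℝ≥0∞) {b : ℝ≥0} (hb : clock c b ≠ ∞) :
    ((timeMeasure.restrict {t | (t : ℝ≥0∞) < totalClock c}).map (clockInv c)).restrict (Iio b) =
      (timeMeasure.withDensity c).restrict (Iio b) := by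
  -- By `clockInv_lt_iff` the times `t` with `clockInv c t < a` form the interval `t < clock c a`,
  -- of length `clock c a`. Finiteness at `b` enters only afterwards, for uniqueness on the π-system
  -- of rays.
  have key : ∀ a ≤ b, ((timeMeasure.restrict {t | (t : ℝ≥0∞) < totalClock c}).map (clockInv c))
      (Iio a) = (timeMeasure.withDensity c) (Iio a) := by
    intro a _
    rw [Measure.map_apply (measurable_clockInv c) measurableSet_Iio,
      Measure.restrict_apply (measurable_clockInv c measurableSet_Iio),
      withDensity_apply _ measurableSet_Iio, ← clock_eq_Iio, ← timeMeasure_coe_lt (clock c a)]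
    congr 1
    ext t
    simp only [mem_inter_iff, mem_preimage, mem_Iio, mem_ofPred_eq]
    constructor
    · rintro ⟨h1, h2⟩
      exact (clockInv_lt_iff h2).1 h1
    · intro h
      have h2 := h.trans_le (clock_le_totalClock c a)
      exact ⟨(clockInv_lt_iff h2).2 h, h2⟩
  have hfin : (timeMeasure.withDensity c) (Iio b) ≠ ∞ := by
    rwa [withDensity_apply _ measurableSet_Iio, ← clock_eq_Iio]
  have : IsFiniteMeasure ((timeMeasure.withDensity c).restrict (Iio b)) :=
    ⟨by simpa using hfin.lt_top⟩
  have : IsFiniteMeasure (((timeMeasure.restrict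
      {t | (t : ℝ≥0∞) < totalClock c}).map (clockInv c)).restrict (Iio b)) :=
    ⟨by simpa [key b le_rfl] using hfin.lt_top⟩
  refine ext_of_generate_finite (range Iio) (BorelSpace.measurable_eq.trans
    (borel_eq_generateFrom_Iio ℝ≥0)) isPiSystem_Iio ?_ (by simp [key b le_rfl])
  rintro _ ⟨a, rfl⟩
  rw [Measure.restrict_apply measurableSet_Iio, Measure.restrict_apply measurableSet_Iio,
    Iio_inter_Iio]
  exact key _ (min_le_right _ _)

/-- Change of variables for an inverse clock, for a function supported where the clock is
finite. -/
theorem lintegral_clockInv {c : ℝ≥0 → ℝ≥0∞} (hc : Measurable c) {ψ : ℝ≥0 → ℝ≥0∞}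
    (hψ : Measurable ψ) (hsupp : ∀ s, ψ s ≠ 0 → ∃ b, s < b ∧ clock c b ≠ ∞) :
    ∫⁻ t in {t : ℝ≥0 | (t : ℝ≥0∞) < totalClock c}, ψ (clockInv c t) ∂timeMeasure =
      ∫⁻ s, ψ s * c s ∂timeMeasure := by
  set μ := (timeMeasure.restrict {t | (t : ℝ≥0∞) < totalClock c}).map (clockInv c)
  have hμ : ∫⁻ t in {t : ℝ≥0 | (t : ℝ≥0∞) < totalClock c}, ψ (clockInv c t) ∂timeMeasure =
      ∫⁻ s, ψ s ∂μ := (lintegral_map hψ (measurable_clockInv c)).symm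
  have hν : ∫⁻ s, ψ s * c s ∂timeMeasure = ∫⁻ s, ψ s ∂(timeMeasure.withDensity c) := by
    rw [lintegral_withDensity_eq_lintegral_mul _ hc hψ]
    simp [mul_comm]
  set I : Set ℝ≥0 := {b | clock c b ≠ ∞}
  -- Lindelöf: countably many rays below times of finite clock cover all of them, so the local
  -- equalities glue.
  obtain ⟨T, hTI, hTc, hTU⟩ := TopologicalSpace.isOpen_biUnion_countable I (fun b => Iio b)
    (fun b _ => isOpen_Iio)
  have hrestr : μ.restrict (⋃ b ∈ T, Iio b) =
      (timeMeasure.withDensity c).restrict (⋃ b ∈ T, Iio b) :=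
    (Measure.restrict_biUnion_congr hTc).2 fun b hb => map_clockInv_restrict c (hTI hb)
  have hO : MeasurableSet (⋃ b ∈ T, Iio b) := (isOpen_biUnion fun b _ => isOpen_Iio).measurableSet
  have hind : (⋃ b ∈ T, Iio b).indicator ψ = ψ := by
    refine indicator_eq_self.2 fun s hs => ?_
    rw [hTU]
    obtain ⟨b, hsb, hb⟩ := hsupp s hs
    exact mem_biUnion (show b ∈ I from hb) hsb
  rw [hμ, hν, ← hind, lintegral_indicator hO, lintegral_indicator hO, hrestr]

/-! ### Right-continuous paths -/

/-- The space of right-continuous paths, with the σ-algebra generated by the coordinates. -/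
abbrev RCPath (E : Type*) [TopologicalSpace E] : Type _ :=
  {w : ℝ≥0 → E // ∀ t, ContinuousWithinAt w (Ici t) t}

namespace RCPath

variable {E F α : Type*} [TopologicalSpace E] [TopologicalSpace F]

theorem continuousWithinAt_comp (w : RCPath E) {h : ℝ≥0 → ℝ≥0} {t : ℝ≥0}
    (hc : ContinuousWithinAt h (Ici t) t) (hm : ∀ᶠ s in 𝓝[≥] t, h t ≤ h s) :
    ContinuousWithinAt (fun s => w.1 (h s)) (Ici t) t :=
  (w.2 (h t)).tendsto.comp (tendsto_nhdsWithin_iff.2 ⟨hc, hm⟩)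

/-- The path after time `s`. -/
def shift (s : ℝ≥0) (w : RCPath E) : RCPath E :=
  ⟨fun t => w.1 (s + t), fun t => w.continuousWithinAt_comp
    (by fun_prop) (eventually_mem_nhdsWithin.mono fun r hr => by
      have : t ≤ r := hr
      gcongr)⟩

/-- The path stopped at time `q`. -/
def stopAt (q : ℝ≥0) (w : RCPath E) : RCPath E :=
  ⟨fun t => w.1 (min t q), fun t => w.continuousWithinAt_comp
    (by fun_prop) (eventually_mem_nhdsWithin.mono fun r hr => by
      have : t ≤ r := hr
      gcongr)⟩

/-- The image of a path under a continuous map. -/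
def mapC (f : E → F) (hf : Continuous f) (w : RCPath E) : RCPath F :=
  ⟨fun t => f (w.1 t), fun t => hf.continuousAt.comp_continuousWithinAt (w.2 t)⟩

@[simp] theorem shift_apply (s t : ℝ≥0) (w : RCPath E) : (shift s w).1 t = w.1 (s + t) := rfl

@[simp] theorem stopAt_apply (q t : ℝ≥0) (w : RCPath E) : (stopAt q w).1 t = w.1 (min t q) := rfl

@[simp] theorem mapC_apply (f : E → F) (hf : Continuous f) (w : RCPath E) (t : ℝ≥0) :
    (mapC f hf w).1 t = f (w.1 t) := rfl

@[simp] theorem shift_zero (w : RCPath E) : shift 0 w = w := by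
  ext t
  simp

theorem shift_shift (s t : ℝ≥0) (w : RCPath E) : shift s (shift t w) = shift (t + s) w := by
  ext r : 2
  simp [add_assoc]

theorem measurable_eval_const [MeasurableSpace E] (t : ℝ≥0) : Measurable fun w : RCPath E => w.1 t :=
  (measurable_pi_apply t).comp measurable_subtype_coe

variable [MeasurableSpace E] [BorelSpace E] [TopologicalSpace.PseudoMetrizableSpace E]
  [MeasurableSpace α]

/-- By right-continuity the value at a time is the limit of the values at grid points just to its
right, and each grid is countable. -/
theorem measurable_eval : Measurable fun p : RCPath E × ℝ≥0 => p.1.1 p.2 := by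
  have key : ∀ n : ℕ, Measurable fun p : RCPath E × ℝ≥0 =>
      p.1.1 (((⌊p.2 * ((n : ℝ≥0) + 1)⌋₊ : ℝ≥0) + 1) / ((n : ℝ≥0) + 1)) := by
    intro n
    have h1 : Measurable fun p : RCPath E × ℕ =>
        p.1.1 (((p.2 : ℝ≥0) + 1) / ((n : ℝ≥0) + 1)) :=
      measurable_from_prod_countable_left fun k =>
        measurable_eval_const (((k : ℝ≥0) + 1) / ((n : ℝ≥0) + 1))
    have h2 : Measurable fun p : RCPath E × ℝ≥0 =>
        ((p.1, ⌊p.2 * ((n : ℝ≥0) + 1)⌋₊) : RCPath E × ℕ) :=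
      measurable_fst.prodMk (Nat.measurable_floor.comp (by fun_prop))
    exact h1.comp h2
  refine measurable_of_tendsto_metrizable key (tendsto_pi_nhds.2 fun p => ?_)
  have hlow : ∀ n : ℕ,
      p.2 ≤ ((⌊p.2 * ((n : ℝ≥0) + 1)⌋₊ : ℝ≥0) + 1) / ((n : ℝ≥0) + 1) := by
    intro n
    rw [le_div_iff₀ (by positivity)]
    exact (Nat.lt_floor_add_one _).le
  have hup : ∀ n : ℕ,
      ((⌊p.2 * ((n : ℝ≥0) + 1)⌋₊ : ℝ≥0) + 1) / ((n : ℝ≥0) + 1) ≤ p.2 + 1 / ((n : ℝ≥0) + 1) := by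
    intro n
    rw [add_div]
    gcongr
    rw [div_le_iff₀ (by positivity)]
    exact Nat.floor_le (by positivity)
  have hlim : Tendsto (fun n : ℕ => p.2 + 1 / ((n : ℝ≥0) + 1)) atTop (𝓝 p.2) := by
    simpa using tendsto_const_nhds.add (tendsto_one_div_add_atTop_nhds_zero_nat (𝕜 := ℝ≥0))
  exact (p.1.2 p.2).tendsto.comp (tendsto_nhdsWithin_iff.2
    ⟨tendsto_of_tendsto_of_tendsto_of_le_of_le tendsto_const_nhds hlim hlow hup,
      Eventually.of_forall hlow⟩)

theorem measurable_apply {Z : α → RCPath E} (hZ : Measurable Z) {τ : α → ℝ≥0}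
    (hτ : Measurable τ) : Measurable fun a => (Z a).1 (τ a) :=
  measurable_eval.comp (hZ.prodMk hτ)

theorem measurable_path (w : RCPath E) : Measurable w.1 :=
  measurable_apply measurable_const measurable_id

theorem measurable_shift {Z : α → RCPath E} (hZ : Measurable Z) {τ : α → ℝ≥0}
    (hτ : Measurable τ) : Measurable fun a => shift (τ a) (Z a) :=
  (measurable_pi_lambda _ fun t => measurable_apply hZ (hτ.add_const t)).subtype_mk

/-- The clock of rate `c` along the path `w`. -/
def pathClock (c : E → ℝ≥0∞) (w : RCPath E) (s : ℝ≥0) : ℝ≥0∞ := clock (fun u => c (w.1 u)) s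

/-- The inverse clock. -/
def pathClockInv (c : E → ℝ≥0∞) (w : RCPath E) (t : ℝ≥0) : ℝ≥0 :=
  clockInv (fun u => c (w.1 u)) t

/-- The total clock. -/
def pathTotal (c : E → ℝ≥0∞) (w : RCPath E) : ℝ≥0∞ := totalClock (fun u => c (w.1 u))

theorem measurable_pathTotal {c : E → ℝ≥0∞} (hc : Measurable c) : Measurable (pathTotal c) :=
  Measurable.lintegral_prod_right' (f := fun p : RCPath E × ℝ≥0 => c (p.1.1 p.2))
    (hc.comp measurable_eval)

theorem measurable_pathClock {c : E → ℝ≥0∞} (hc : Measurable c) :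
    Measurable fun p : RCPath E × ℝ≥0 => pathClock c p.1 p.2 := by
  have : (fun p : RCPath E × ℝ≥0 => pathClock c p.1 p.2) = fun p : RCPath E × ℝ≥0 =>
      ∫⁻ r, ({q : (RCPath E × ℝ≥0) × ℝ≥0 | q.2 ≤ q.1.2}.indicator
        (fun q => c (q.1.1.1 q.2)) (p, r)) ∂timeMeasure := by
    ext p
    rw [pathClock, clock, ← lintegral_indicator measurableSet_Iic]
    rfl
  rw [this]
  refine Measurable.lintegral_prod_right' (Measurable.indicator ?_ ?_)
  · exact hc.comp (measurable_apply (measurable_fst.comp measurable_fst) measurable_snd)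
  · exact measurableSet_le measurable_snd (measurable_snd.comp measurable_fst)

/-- The second set of the decomposition accounts for the value `0` that the inverse clock takes, as
the infimum of the empty set, once the clock has run out. -/
theorem measurable_pathClockInv {c : E → ℝ≥0∞} (hc : Measurable c) :
    Measurable fun p : RCPath E × ℝ≥0 => pathClockInv c p.1 p.2 := by
  refine measurable_of_Iio fun a => ?_
  have : (fun p : RCPath E × ℝ≥0 => pathClockInv c p.1 p.2) ⁻¹' Iio a =
      {p | (p.2 : ℝ≥0∞) < pathTotal c p.1 ∧ (p.2 : ℝ≥0∞) < pathClock c p.1 a} ∪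
      {p | pathTotal c p.1 ≤ p.2 ∧ 0 < a} := by
    ext ⟨w, t⟩
    rcases lt_or_ge (t : ℝ≥0∞) (pathTotal c w) with h | h
    · have := clockInv_lt_iff (a := a) h
      simp only [mem_preimage, mem_Iio, mem_union, mem_ofPred_eq, h, h.not_ge]
      simpa [pathClockInv, pathClock] using this
    · have := clockInv_eq_zero_of_le h
      simp only [mem_preimage, mem_Iio, mem_union, mem_ofPred_eq, h, h.not_gt]
      simp [pathClockInv, this]
  rw [this]
  have h1 : Measurable fun p : RCPath E × ℝ≥0 => (p.2 : ℝ≥0∞) :=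
    measurable_coe_nnreal_ennreal.comp measurable_snd
  have h2 : Measurable fun p : RCPath E × ℝ≥0 => pathTotal c p.1 :=
    (measurable_pathTotal hc).comp measurable_fst
  have h3 : Measurable fun p : RCPath E × ℝ≥0 => pathClock c p.1 a :=
    (measurable_pathClock hc).comp (measurable_fst.prodMk measurable_const)
  exact ((measurableSet_lt h1 h2).inter (measurableSet_lt h1 h3)).union
    ((measurableSet_le h2 h1).inter (MeasurableSet.const _))

end RCPath

/-! ### Time changes of paths with values in `(-∞, +∞]` -/

open RCPath

/-- By `clockInv_lt_iff` the condition `clockInv c s < a` is the open condition `s < clock c a`;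
this is the upper half of continuity, and monotonicity is the lower half. -/
theorem continuousWithinAt_clockInv {c : ℝ≥0 → ℝ≥0∞} {t : ℝ≥0} (ht : (t : ℝ≥0∞) < totalClock c) :
    ContinuousWithinAt (clockInv c) (Ici t) t ∧ ∀ᶠ s in 𝓝[≥] t, clockInv c t ≤ clockInv c s := by
  have hev : ∀ x : ℝ≥0∞, (t : ℝ≥0∞) < x → ∀ᶠ s : ℝ≥0 in 𝓝[≥] t, (s : ℝ≥0∞) < x := fun x hx =>
    mem_nhdsWithin_of_mem_nhds
      ((ENNReal.continuous_coe.tendsto t).eventually_lt_const hx)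
  have hmono : ∀ᶠ s in 𝓝[≥] t, clockInv c t ≤ clockInv c s := by
    filter_upwards [hev _ ht, self_mem_nhdsWithin] with s hs hts
    exact clockInv_mono hts hs
  refine ⟨?_, hmono⟩
  refine tendsto_order.2 ⟨fun a ha => ?_, fun a ha => ?_⟩
  · exact hmono.mono fun s hs => ha.trans_le hs
  · filter_upwards [hev _ ht, hev _ ((clockInv_lt_iff ht).1 ha)] with s hs hsa
    exact (clockInv_lt_iff hs).2 hsa

/-- The time change of the path `w` by the inverse of the clock of rate `c`, sent to `+∞` when the
clock runs out. -/
def timeChange (c : WithTop ℝ → ℝ≥0∞) (w : RCPath (WithTop ℝ)) : RCPath (WithTop ℝ) :=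
  ⟨fun t => open scoped Classical in
    if (t : ℝ≥0∞) < pathTotal c w then w.1 (pathClockInv c w t) else ⊤, by
    intro t
    by_cases ht : (t : ℝ≥0∞) < pathTotal c w
    · have h := continuousWithinAt_clockInv ht
      refine (w.continuousWithinAt_comp h.1 h.2).congr_of_eventuallyEq ?_ (by simp [ht]; rfl)
      filter_upwards [mem_nhdsWithin_of_mem_nhds
        ((ENNReal.continuous_coe.tendsto t).eventually_lt_const ht)] with s hs
      simp only [hs, if_true]
      rfl
    · refine (continuousWithinAt_const (b := ⊤)).congr (fun s hs => ?_) (by simp [ht])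
      have : ¬ (s : ℝ≥0∞) < pathTotal c w := fun h =>
        ht (lt_of_le_of_lt (by exact_mod_cast hs) h)
      simp [this]⟩

theorem timeChange_of_lt {c : WithTop ℝ → ℝ≥0∞} {w : RCPath (WithTop ℝ)} {t : ℝ≥0}
    (ht : (t : ℝ≥0∞) < pathTotal c w) : (timeChange c w).1 t = w.1 (pathClockInv c w t) :=
  if_pos ht

theorem timeChange_of_not_lt {c : WithTop ℝ → ℝ≥0∞} {w : RCPath (WithTop ℝ)} {t : ℝ≥0}
    (ht : ¬ (t : ℝ≥0∞) < pathTotal c w) : (timeChange c w).1 t = ⊤ :=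
  if_neg ht

theorem measurable_timeChange {c : WithTop ℝ → ℝ≥0∞} (hc : Measurable c) :
    Measurable (timeChange c) := by
  classical
  refine (measurable_pi_lambda _ fun t => ?_).subtype_mk
  refine Measurable.ite ?_ ?_ measurable_const
  · exact measurableSet_lt measurable_const (measurable_pathTotal hc)
  · exact measurable_apply measurable_id
      ((measurable_pathClockInv hc).comp (measurable_id.prodMk measurable_const))

/-- The clock of rate `c` is finite as long as the path is. -/
def GoodClock (c : WithTop ℝ → ℝ≥0∞) (w : RCPath (WithTop ℝ)) : Prop :=
  ∀ u, w.1 u ≠ ⊤ → pathClock c w u ≠ ∞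

theorem exists_gt_ne_top (w : RCPath (WithTop ℝ)) {u : ℝ≥0} (hu : w.1 u ≠ ⊤) :
    ∃ b, u < b ∧ ∀ v ∈ Ico u b, w.1 v ≠ ⊤ := by
  have h : ∀ᶠ v in 𝓝[≥] u, w.1 v ≠ ⊤ := (w.2 u).eventually_ne hu
  obtain ⟨b, hb, hsub⟩ := (mem_nhdsGE_iff_exists_Ico_subset).1 h
  exact ⟨b, hb, hsub⟩

/-- By right-continuity a finite path stays finite a little longer; this supplies the margin that
`clock_clockInv` asks for. -/
theorem GoodClock.exists_gt {c : WithTop ℝ → ℝ≥0∞} {w : RCPath (WithTop ℝ)} (h : GoodClock c w)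
    {u : ℝ≥0} (hu : w.1 u ≠ ⊤) : ∃ b, u < b ∧ pathClock c w b ≠ ∞ := by
  obtain ⟨b, hb, hsub⟩ := exists_gt_ne_top w hu
  obtain ⟨v, hv⟩ := exists_between hb
  exact ⟨v, hv.1, h v (hsub v ⟨hv.1.le, hv.2⟩)⟩

theorem lintegral_timeChange_aux {c : WithTop ℝ → ℝ≥0∞} (hc : Measurable c)
    {w : RCPath (WithTop ℝ)} (hw : GoodClock c w) {ψ : ℝ≥0 → ℝ≥0∞} (hψ : Measurable ψ)
    (h0 : ∀ s, w.1 s = ⊤ → ψ s = 0) :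
    ∫⁻ t in {t : ℝ≥0 | (t : ℝ≥0∞) < pathTotal c w}, ψ (pathClockInv c w t) ∂timeMeasure =
      ∫⁻ s, ψ s * c (w.1 s) ∂timeMeasure :=
  lintegral_clockInv (hc.comp (measurable_path w)) hψ fun s hs =>
    hw.exists_gt fun h => hs (h0 s h)

theorem pathClock_shift (c : WithTop ℝ → ℝ≥0∞) (w : RCPath (WithTop ℝ)) (s t : ℝ≥0) :
    pathClock c w (s + t) = pathClock c w s + pathClock c (shift s w) t :=
  clock_add _ _ _

theorem pathTotal_shift (c : WithTop ℝ → ℝ≥0∞) (w : RCPath (WithTop ℝ)) (s : ℝ≥0) :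
    pathTotal c w = pathClock c w s + pathTotal c (shift s w) :=
  totalClock_add _ _

theorem GoodClock.clock_clockInv {c : WithTop ℝ → ℝ≥0∞} {w : RCPath (WithTop ℝ)}
    (hw : GoodClock c w) {t : ℝ≥0} (ht : (t : ℝ≥0∞) < pathTotal c w)
    (htop : w.1 (pathClockInv c w t) ≠ ⊤) : pathClock c w (pathClockInv c w t) = t := by
  obtain ⟨b, hb, hfin⟩ := hw.exists_gt htop
  exact TimeChangedLevy.clock_clockInv ht hb hfin

/-- The part of a time-changed path after time `t` is the time change of a shifted path. -/
theorem GoodClock.shift_timeChange {c : WithTop ℝ → ℝ≥0∞} {w : RCPath (WithTop ℝ)}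
    (hw : GoodClock c w) {t : ℝ≥0} (ht : (t : ℝ≥0∞) < pathTotal c w)
    (htop : w.1 (pathClockInv c w t) ≠ ⊤) :
    shift t (timeChange c w) = timeChange c (shift (pathClockInv c w t) w) := by
  set h := pathClockInv c w t with hh
  have hch : pathClock c w h = t := hw.clock_clockInv ht htop
  have htot : pathTotal c w = t + pathTotal c (shift h w) := by rw [← hch]; exact pathTotal_shift _ _ _
  ext r : 2
  have hiff : ((t + r : ℝ≥0) : ℝ≥0∞) < pathTotal c w ↔ (r : ℝ≥0∞) < pathTotal c (shift h w) := by
    rw [htot, ENNReal.coe_add, ENNReal.add_lt_add_iff_left ENNReal.coe_ne_top]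
  by_cases hr : (r : ℝ≥0∞) < pathTotal c (shift h w)
  · rw [shift_apply, timeChange_of_lt (hiff.2 hr), timeChange_of_lt hr, shift_apply]
    have hge : h ≤ pathClockInv c w (t + r) := clockInv_mono (by simp) (hiff.2 hr)
    obtain ⟨d, hd⟩ := exists_add_of_le hge
    suffices hdr : d = pathClockInv c (shift h w) r by rw [hd, hdr]
    -- Two times agree when they have the same strict upper bounds, and these are described by the
    -- clocks through `clockInv_lt_iff`.
    refine eq_of_forall_gt_iff fun a => ?_
    rw [← add_lt_add_iff_left h, ← hd, pathClockInv, clockInv_lt_iff (hiff.2 hr), pathClockInv,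
      clockInv_lt_iff hr]
    change _ < pathClock c w (h + a) ↔ _ < pathClock c (shift h w) a
    rw [pathClock_shift, hch, ENNReal.coe_add, ENNReal.add_lt_add_iff_left ENNReal.coe_ne_top]
  · rw [shift_apply, timeChange_of_not_lt (mt hiff.1 hr), timeChange_of_not_lt hr]

/-- Change of variables for time integrals along a time-changed path. -/
theorem GoodClock.lintegral_timeChange {c : WithTop ℝ → ℝ≥0∞} (hc : Measurable c)
    {w : RCPath (WithTop ℝ)} (hw : GoodClock c w) {F : RCPath (WithTop ℝ) → ℝ≥0∞}
    (hF : Measurable F) :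
    ∫⁻ t in {t | (timeChange c w).1 t ≠ ⊤}, F (shift t (timeChange c w)) ∂timeMeasure =
      ∫⁻ s in {s | w.1 s ≠ ⊤}, c (w.1 s) * F (timeChange c (shift s w)) ∂timeMeasure := by
  have hms : MeasurableSet {s | w.1 s ≠ ⊤} :=
    (measurable_path w) (measurableSet_singleton _).compl
  have hmt : MeasurableSet {s | (timeChange c w).1 s ≠ ⊤} :=
    (measurable_path _) (measurableSet_singleton _).compl
  have hψ : Measurable fun s => F (timeChange c (shift s w)) :=
    hF.comp ((measurable_timeChange hc).comp (measurable_shift measurable_const measurable_id))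
  -- Cutting off to `w s ≠ ⊤` makes `GoodClock` sufficient: the clock has to be finite just beyond
  -- the contributing times only.
  have := lintegral_timeChange_aux hc hw (hψ.indicator hms) (fun s hs => by simp [hs])
  rw [← lintegral_indicator hms, ← lintegral_indicator hmt]
  rw [← lintegral_indicator (measurableSet_coe_lt _)] at this
  convert this using 2 with t s
  · ext t
    by_cases ht : (t : ℝ≥0∞) < pathTotal c w
    · by_cases htop : w.1 (pathClockInv c w t) = ⊤
      · simp [indicator, ht, htop, timeChange_of_lt ht]
      · simp [indicator, ht, htop, timeChange_of_lt ht, hw.shift_timeChange ht htop]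
    · simp [indicator, ht, timeChange_of_not_lt ht]
  · ext s
    by_cases hs : w.1 s = ⊤ <;> simp [indicator, hs, mul_comm]

/-! ### Composition of time changes -/

section Composition

variable {c g : WithTop ℝ → ℝ≥0∞} {w : RCPath (WithTop ℝ)}

theorem clock_clockInv_of_finite {c : ℝ≥0 → ℝ≥0∞} (hfin : ∀ s, clock c s ≠ ∞) {t : ℝ≥0}
    (ht : (t : ℝ≥0∞) < totalClock c) : clock c (clockInv c t) = t :=
  clock_clockInv ht (lt_add_one _) (hfin _)

theorem clock_strictMono {c : ℝ≥0 → ℝ≥0∞} (hc : Measurable c) (hpos : ∀ s, c s ≠ 0)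
    (hfin : ∀ s, clock c s ≠ ∞) : StrictMono (clock c) := by
  intro a b hab
  obtain ⟨d, rfl⟩ := exists_add_of_le hab.le
  rw [clock_add]
  refine ENNReal.lt_add_right (hfin a) ?_
  have hd : 0 < d := by simpa using hab
  rw [clock_eq_Iio, ← pos_iff_ne_zero]
  refine (setLIntegral_pos_iff (by fun_prop)).2 ?_
  have : Function.support (fun r => c (a + r)) = univ := by
    ext r; simp [hpos]
  rw [this, univ_inter, timeMeasure_Iio]
  exact_mod_cast hd

/-- The chain rule for clocks: substitute the inverse `c`-clock in the time integral of `g` along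
the changed path. -/
theorem pathClock_timeChange (hc : Measurable c) (hg : Measurable g)
    (hfin : ∀ s, pathClock c w s ≠ ∞) {t : ℝ≥0} (ht : (t : ℝ≥0∞) < pathTotal c w) :
    pathClock g (timeChange c w) t = pathClock (g * c) w (pathClockInv c w t) := by
  have hcm := hc.comp (measurable_path w)
  have hgm := hg.comp (measurable_path w)
  have := lintegral_clockInv hcm (ψ := (Iic (pathClockInv c w t)).indicator fun s => g (w.1 s))
    (hgm.indicator measurableSet_Iic) fun s _ => ⟨s + 1, lt_add_one _, hfin _⟩
  rw [pathClock, pathClock, clock, clock, ← lintegral_indicator measurableSet_Iic,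
    ← lintegral_indicator measurableSet_Iic]
  rw [← lintegral_indicator (measurableSet_coe_lt _)] at this
  convert this using 2
  · ext r
    by_cases hr : (r : ℝ≥0∞) < pathTotal c w
    · have hr' : (r : ℝ≥0∞) < totalClock ((fun s => c s) ∘ w.1) := hr
      have hiff : r ≤ t ↔ pathClockInv c w r ≤ pathClockInv c w t := by
        refine ⟨fun h => clockInv_mono h ht, fun h => ?_⟩
        have := clock_mono (fun u => c (w.1 u)) h
        rw [pathClockInv, pathClockInv, clock_clockInv_of_finite hfin hr,
          clock_clockInv_of_finite hfin ht] at this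
        exact_mod_cast this
      by_cases hrt : r ≤ t
      · have h2 := hiff.1 hrt
        rw [indicator_of_mem (by exact hrt), indicator_of_mem (by exact hr'),
          indicator_of_mem (by exact h2), timeChange_of_lt hr]
        rfl
      · have h2 := mt hiff.2 hrt
        rw [indicator_of_notMem (by exact hrt), indicator_of_mem (by exact hr'),
          indicator_of_notMem (by exact h2)]
    · have hrt : ¬ r ≤ t := fun h => hr (lt_of_le_of_lt (by exact_mod_cast h) ht)
      rw [indicator_of_notMem (by exact hrt), indicator_of_notMem (by exact hr)]
  · ext s
    by_cases hs : s ≤ pathClockInv c w t <;> simp [indicator, hs]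

theorem goodClock_timeChange (hc : Measurable c) (hg : Measurable g)
    (hfin : ∀ s, pathClock c w s ≠ ∞) (hfin' : ∀ s, pathClock (g * c) w s ≠ ∞) :
    GoodClock g (timeChange c w) := by
  intro t ht
  by_cases h : (t : ℝ≥0∞) < pathTotal c w
  · rw [pathClock_timeChange hc hg hfin h]
    exact hfin' _
  · exact absurd (timeChange_of_not_lt h) ht

/-- A strictly increasing finite `c`-clock and its inverse undo each other, so by the chain rule
`pathClock_timeChange` the two successive inverses compose to the inverse of the clock of rate `g *
c`. -/
theorem timeChange_timeChange (hc : Measurable c) (hg : Measurable g)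
    (hpos : ∀ s, c (w.1 s) ≠ 0) (hfin : ∀ s, pathClock c w s ≠ ∞) :
    timeChange g (timeChange c w) = timeChange (g * c) w := by
  have hmono : StrictMono (pathClock c w) :=
    clock_strictMono (hc.comp (measurable_path w)) hpos hfin
  have hlt : ∀ s, pathClock c w s < pathTotal c w := fun s =>
    (hmono (lt_add_one s)).trans_le (clock_le_totalClock _ _)
  have hclock := fun {t : ℝ≥0} (ht : (t : ℝ≥0∞) < pathTotal c w) =>
    pathClock_timeChange (g := g) hc hg hfin ht
  have hAh : ∀ {t : ℝ≥0}, (t : ℝ≥0∞) < pathTotal c w →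
      pathClock c w (pathClockInv c w t) = t := fun ht => clock_clockInv_of_finite hfin ht
  have hhA : ∀ s, pathClockInv c w (pathClock c w s).toNNReal = s := by
    intro s
    refine hmono.injective ?_
    have : ((pathClock c w s).toNNReal : ℝ≥0∞) = pathClock c w s := ENNReal.coe_toNNReal (hfin s)
    rw [hAh (by rw [this]; exact hlt s), this]
  ext t : 2
  by_cases ht : (t : ℝ≥0∞) < pathTotal (g * c) w
  -- The second inverse clock at `t` has to be the `c`-clock `u` at `k`, because undoing the first
  -- time change at `u` must lead to `k`.
  · set k := pathClockInv (g * c) w t with hk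
    set u := (pathClock c w k).toNNReal with hu
    have hcu : (u : ℝ≥0∞) = pathClock c w k := ENNReal.coe_toNNReal (hfin k)
    have hutot : (u : ℝ≥0∞) < pathTotal c w := by rw [hcu]; exact hlt k
    have hiff : ∀ a : ℝ≥0, (a : ℝ≥0∞) < pathTotal c w →
        ((t : ℝ≥0∞) < pathClock g (timeChange c w) a ↔ u < a) := by
      intro a ha
      rw [hclock ha]
      have h1 : k < pathClockInv c w a ↔ (t : ℝ≥0∞) < pathClock (g * c) w (pathClockInv c w a) :=
        clockInv_lt_iff ht
      rw [← h1, ← hmono.lt_iff_lt, hAh ha, ← hcu, ENNReal.coe_lt_coe]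
    obtain ⟨a₀, hua, ha₀⟩ : ∃ a : ℝ≥0, u < a ∧ (a : ℝ≥0∞) < pathTotal c w := by
      obtain ⟨a, h1, h2⟩ := ENNReal.lt_iff_exists_nnreal_btwn.1 hutot
      exact ⟨a, by exact_mod_cast h1, h2⟩
    have httot : (t : ℝ≥0∞) < pathTotal g (timeChange c w) :=
      ((hiff a₀ ha₀).2 hua).trans_le (clock_le_totalClock _ _)
    have hinv : pathClockInv g (timeChange c w) t = u := by
      refine eq_of_forall_gt_iff fun a => ?_
      have h1 : pathClockInv g (timeChange c w) t < a ↔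
          (t : ℝ≥0∞) < pathClock g (timeChange c w) a := clockInv_lt_iff httot
      rw [h1]
      by_cases ha : (a : ℝ≥0∞) < pathTotal c w
      · exact hiff a ha
      -- Beyond the total of the `c`-clock `hiff` is not available; there both sides hold by
      -- comparison with `a₀`.
      · have h2 : a₀ < a := by
          by_contra h
          exact ha (lt_of_le_of_lt (by exact_mod_cast not_lt.1 h) ha₀)
        exact ⟨fun _ => hua.trans h2, fun _ =>
          ((hiff a₀ ha₀).2 hua).trans_le (clock_mono _ h2.le)⟩
    rw [timeChange_of_lt httot, timeChange_of_lt ht, hinv, timeChange_of_lt hutot, hhA k]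
  · rw [timeChange_of_not_lt ht]
    by_cases ht' : (t : ℝ≥0∞) < pathTotal g (timeChange c w)
    · rw [timeChange_of_lt ht']
      by_cases hu : (pathClockInv g (timeChange c w) t : ℝ≥0∞) < pathTotal c w
      · exfalso
        obtain ⟨a, h1, h2⟩ := ENNReal.lt_iff_exists_nnreal_btwn.1 hu
        have h3 : (t : ℝ≥0∞) < pathClock g (timeChange c w) a :=
          (clockInv_lt_iff ht').1 (by exact_mod_cast h1)
        rw [hclock h2] at h3
        exact ht (h3.trans_le (clock_le_totalClock _ _))
      · exact timeChange_of_not_lt hu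
    · exact timeChange_of_not_lt ht'

end Composition

/-! ### The path transform -/

theorem continuous_add_left_withTop (z : ℝ) : Continuous fun y : WithTop ℝ => (z : WithTop ℝ) + y := by
  have : (fun y : WithTop ℝ => (z : WithTop ℝ) + y) =
      (OrderIso.addLeft z).withTopCongr := by
    ext y
    cases y <;> rfl
  rw [this]
  exact OrderIso.continuous _

/-- Translation of a path with values in `(-∞, +∞]`. -/
def translate (z : ℝ) (w : RCPath (WithTop ℝ)) : RCPath (WithTop ℝ) :=
  mapC (fun y => (z : WithTop ℝ) + y) (continuous_add_left_withTop z) w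

/-- The rate `1 / R`. -/
def invRate (R : ℝ → ℝ) (y : WithTop ℝ) : ℝ≥0∞ := ENNReal.ofReal (1 / R (y.untopD 0))

/-- The path transform `Φ_z` on right-continuous paths. -/
def pathTransformRC (R : ℝ → ℝ) (z : ℝ) (w : RCPath (WithTop ℝ)) : RCPath (WithTop ℝ) :=
  translate z (timeChange (scalingRate R z) w)

theorem pathTransformRC_val (R : ℝ → ℝ) (z : ℝ) (w : RCPath (WithTop ℝ)) :
    (pathTransformRC R z w).1 = pathTransform R z w.1 := by
  ext1 t
  rw [pathTransformRC, translate, mapC_apply, pathTransform]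
  by_cases h : (t : ℝ≥0∞) < pathTotal (scalingRate R z) w
  · have h' : (t : ℝ≥0∞) < totalClock fun u => scalingRate R z (w.1 u) := h
    rw [timeChange_of_lt h, if_pos h']
    rfl
  · have h' : ¬ (t : ℝ≥0∞) < totalClock fun u => scalingRate R z (w.1 u) := h
    rw [timeChange_of_not_lt h, if_neg h']
    simp

theorem measurable_untopD : Measurable fun y : WithTop ℝ => y.untopD 0 := by
  refine measurable_of_isOpen fun U hU => ?_
  have : (fun y : WithTop ℝ => y.untopD 0) ⁻¹' U = ((↑) : ℝ → WithTop ℝ) '' U ∪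
      ({y | y = ⊤} ∩ {_y | (0 : ℝ) ∈ U}) := by
    ext y
    cases y <;> simp
  rw [this]
  exact (measurableSet_coe_image hU.measurableSet).union
    ((measurableSet_singleton _).inter (MeasurableSet.const _))

theorem measurable_invRate {R : ℝ → ℝ} (hR : Measurable R) : Measurable (invRate R) :=
  ((hR.comp measurable_untopD).const_div 1).ennreal_ofReal

theorem scalingRate_eq (R : ℝ → ℝ) (z : ℝ) : scalingRate R z =
    fun y => open scoped Classical in if y = ⊤ then 1 else
      ENNReal.ofReal (R (y.untopD 0) / R (z + y.untopD 0)) := by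
  ext y
  cases y <;> simp [scalingRate]

theorem measurable_scalingRate {R : ℝ → ℝ} (hR : Measurable R) (z : ℝ) :
    Measurable (scalingRate R z) := by
  classical
  rw [scalingRate_eq]
  refine Measurable.ite (measurableSet_singleton _) measurable_const ?_
  have := measurable_untopD
  fun_prop

theorem measurable_translate (z : ℝ) : Measurable (translate z) :=
  (measurable_pi_lambda _ fun t =>
    (continuous_add_left_withTop z).measurable.comp (measurable_eval_const t)).subtype_mk

theorem measurable_pathTransformRC {R : ℝ → ℝ} (hR : Measurable R) (z : ℝ) :
    Measurable (pathTransformRC R z) :=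
  (measurable_translate z).comp (measurable_timeChange (measurable_scalingRate hR z))

theorem translate_apply_eq_top {z : ℝ} {w : RCPath (WithTop ℝ)} {t : ℝ≥0} :
    (translate z w).1 t = ⊤ ↔ w.1 t = ⊤ := by
  simp [translate]

theorem shift_translate (s : ℝ≥0) (z : ℝ) (w : RCPath (WithTop ℝ)) :
    shift s (translate z w) = translate z (shift s w) := rfl

theorem timeChange_translate (c : WithTop ℝ → ℝ≥0∞) (z : ℝ) (w : RCPath (WithTop ℝ)) :
    timeChange c (translate z w) = translate z (timeChange (fun y => c (z + y)) w) := by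
  ext t : 2
  by_cases h : (t : ℝ≥0∞) < pathTotal c (translate z w)
  · have h' : (t : ℝ≥0∞) < pathTotal (fun y => c (z + y)) w := h
    rw [timeChange_of_lt h]
    change (z : WithTop ℝ) + w.1 _ = (z : WithTop ℝ) + _
    rw [timeChange_of_lt h']
    rfl
  · have h' : ¬ (t : ℝ≥0∞) < pathTotal (fun y => c (z + y)) w := h
    rw [timeChange_of_not_lt h]
    change _ = (z : WithTop ℝ) + _
    rw [timeChange_of_not_lt h']
    simp

/-- Change of variables for time integrals along a transformed path. -/
theorem GoodClock.lintegral_pathTransformRC {R : ℝ → ℝ} (hR : Measurable R) {z : ℝ}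
    {w : RCPath (WithTop ℝ)} (hw : GoodClock (scalingRate R z) w)
    {F : RCPath (WithTop ℝ) → ℝ≥0∞} (hF : Measurable F) :
    ∫⁻ t in {t | (pathTransformRC R z w).1 t ≠ ⊤}, F (shift t (pathTransformRC R z w))
        ∂timeMeasure =
      ∫⁻ s in {s | w.1 s ≠ ⊤}, scalingRate R z (w.1 s) * F (pathTransformRC R z (shift s w))
        ∂timeMeasure := by
  have := hw.lintegral_timeChange (measurable_scalingRate hR z)
    (hF.comp (measurable_translate z))
  simp only [pathTransformRC, shift_translate, ne_eq, translate_apply_eq_top]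
  exact this

/-! ### Finite-dimensional laws -/

/-- Two finite measures agree if a family of real functions that generates the σ-algebra has the
same finite-dimensional laws under both. -/
theorem ext_of_forall_lintegral_finset {α ι : Type*} [mα : MeasurableSpace α] {μ ν : Measure α}
    [IsFiniteMeasure μ] [IsFiniteMeasure ν] {f : ι → α → ℝ}
    (hgen : mα = MeasurableSpace.comap (fun a i => f i a) MeasurableSpace.pi)
    (h : ∀ (I : Finset ι) (φ : BoundedContinuousFunction (I → ℝ) ℝ≥0),
      ∫⁻ a, φ (fun i => f i a) ∂μ = ∫⁻ a, φ (fun i => f i a) ∂ν) : μ = ν := by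
  have hf : Measurable fun a i => f i a := by
    rw [hgen]
    exact comap_measurable _
  have hI : ∀ I : Finset ι, Measurable fun a (i : I) => f i a := fun I =>
    measurable_pi_lambda _ fun i => (measurable_pi_apply _).comp hf
  have hfd : ∀ I : Finset ι, μ.map (fun a (i : I) => f i a) = ν.map (fun a (i : I) => f i a) := by
    intro I
    have := Measure.isFiniteMeasure_map μ (fun a (i : I) => f i a)
    have := Measure.isFiniteMeasure_map ν (fun a (i : I) => f i a)
    refine ext_of_forall_lintegral_eq_of_IsFiniteMeasure fun φ => ?_
    have hφ : Measurable fun x => (φ x : ℝ≥0∞) :=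
      measurable_coe_nnreal_ennreal.comp φ.continuous.measurable
    rw [lintegral_map hφ (hI I), lintegral_map hφ (hI I)]
    exact h I φ
  have hmap : μ.map (fun a i => f i a) = ν.map (fun a i => f i a) := by
    have := Measure.isFiniteMeasure_map μ (fun a i => f i a)
    have := Measure.isFiniteMeasure_map ν (fun a i => f i a)
    have : ∀ I : Finset ι, IsFiniteMeasure (μ.map (fun a (i : I) => f i a)) := fun I =>
      Measure.isFiniteMeasure_map μ _
    -- Both laws are projective limits of the same family of finite measures, and such a limit is
    -- unique.
    refine IsProjectiveLimit.unique (P := fun I => μ.map (fun a (i : I) => f i a)) ?_ ?_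
    · intro I
      rw [Measure.map_map (Finset.measurable_restrict I) hf]
      rfl
    · intro I
      rw [Measure.map_map (Finset.measurable_restrict I) hf]
      exact (hfd I).symm
  ext s hs
  rw [hgen] at hs
  obtain ⟨t, ht, rfl⟩ := hs
  rw [← Measure.map_apply hf ht, hmap, Measure.map_apply hf ht]

/-! ### Càdlàg paths are locally bounded -/

/-- The one-sided limits bound the path near each time, and compactness of `[0, s]` makes the bound
uniform. -/
theorem IsCadlag.bddOn {f : ℝ≥0 → ℝ} (hf : IsCadlag f) (s : ℝ≥0) :
    ∃ K : ℝ, ∀ u ≤ s, |f u| ≤ K := by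
  have : ∃ K : ℝ, ∀ u ∈ Iic s, |f u| ≤ K := by
    have hcomp : IsCompact (Iic s) := by
      have : Iic s = Icc 0 s := by ext; simp
      rw [this]
      exact isCompact_Icc
    refine hcomp.induction_on (p := fun A => ∃ K : ℝ, ∀ u ∈ A, |f u| ≤ K) ⟨0, by simp⟩ ?_ ?_ ?_
    · rintro A B hAB ⟨K, hK⟩
      exact ⟨K, fun u hu => hK u (hAB hu)⟩
    · rintro A B ⟨K, hK⟩ ⟨K', hK'⟩
      refine ⟨max K K', fun u hu => ?_⟩
      rcases hu with hu | hu
      · exact (hK u hu).trans (le_max_left _ _)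
      · exact (hK' u hu).trans (le_max_right _ _)
    · intro t _
      obtain ⟨hr, l, hl⟩ := hf t
      have h1 : ∀ᶠ u in 𝓝[≥] t, |f u| < |f t| + 1 :=
        (hr.tendsto.abs).eventually_lt_const (lt_add_one _)
      have h2 : ∀ᶠ u in 𝓝[<] t, |f u| < |l| + 1 :=
        hl.abs.eventually_lt_const (lt_add_one _)
      refine ⟨{u | |f u| ≤ max (|f t| + 1) (|l| + 1)}, ?_, max (|f t| + 1) (|l| + 1), fun u hu => hu⟩
      refine mem_nhdsWithin_of_mem_nhds ?_
      rw [← nhdsLT_sup_nhdsGE t]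
      exact ⟨h2.mono fun u hu => hu.le.trans (le_max_right _ _),
        h1.mono fun u hu => hu.le.trans (le_max_left _ _)⟩
  exact this

/-! ### Lévy processes as random paths -/

/-- The increments of the path after time `q`. -/
def incr (q : ℝ≥0) (w : RCPath ℝ) : RCPath ℝ :=
  mapC (fun y => y - w.1 q) (by fun_prop) (shift q w)

@[simp] theorem incr_apply (q t : ℝ≥0) (w : RCPath ℝ) : (incr q w).1 t = w.1 (q + t) - w.1 q := rfl

theorem measurable_incr {α : Type*} [MeasurableSpace α] {Z : α → RCPath ℝ} (hZ : Measurable Z)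
    {τ : α → ℝ≥0} (hτ : Measurable τ) : Measurable fun a => incr (τ a) (Z a) :=
  (measurable_pi_lambda _ fun t => (measurable_apply hZ (hτ.add_const t)).sub
    (measurable_apply hZ hτ)).subtype_mk

theorem measurable_stopAt (q : ℝ≥0) : Measurable (stopAt (E := ℝ) q) :=
  (measurable_pi_lambda _ fun t => measurable_eval_const (min t q)).subtype_mk

/-- A random path with stationary independent increments, everywhere issued from `0` and
locally bounded. -/
structure IsLevyPath {Ω : Type*} [MeasurableSpace Ω] (Y : Ω → RCPath ℝ) (P : Measure Ω) : Prop where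
  measurable : Measurable Y
  zero : ∀ ω, (Y ω).1 0 = 0
  bdd : ∀ ω s, ∃ K : ℝ, ∀ u ≤ s, |(Y ω).1 u| ≤ K
  indep : ∀ q, IndepFun (fun ω => stopAt q (Y ω)) (fun ω => incr q (Y ω)) P
  stationary : ∀ q, P.map (fun ω => incr q (Y ω)) = P.map Y

/-- Independence of increments is available along monotone sequences of times, so finite sets of
times are listed as such sequences, starting at `0`. -/
theorem exists_enumeration (K : Finset ℝ≥0) :
    ∃ τ : ℕ → ℝ≥0, Monotone τ ∧ τ 0 = 0 ∧ ∀ u ∈ K, ∃ k, τ k = u := by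
  classical
  set K' := insert 0 K
  have hcard : 0 < K'.card := Finset.card_pos.2 ⟨0, by simp [K']⟩
  set e := K'.orderEmbOfFin rfl
  -- The truncation `min k _` freezes the sequence at the largest time.
  set τ : ℕ → ℝ≥0 := fun k => e ⟨min k (K'.card - 1), by omega⟩ with hτ
  have hmono : Monotone τ := fun i j hij => e.monotone (by
    simp only [Fin.mk_le_mk]
    omega)
  have hsurj : ∀ u ∈ K', ∃ k, τ k = u := by
    intro u hu
    have : u ∈ Set.range e := by
      rw [Finset.range_orderEmbOfFin]
      exact hu
    obtain ⟨i, rfl⟩ := this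
    refine ⟨i, ?_⟩
    simp only [hτ]
    congr 1
    ext
    have := i.2
    simp only
    omega
  refine ⟨τ, hmono, ?_, fun u hu => hsurj u (by simp [K', hu])⟩
  obtain ⟨k, hk⟩ := hsurj 0 (by simp [K'])
  exact le_antisymm ((hmono (Nat.zero_le k)).trans hk.le) bot_le

/-! ### A modification of the Lévy process that is well behaved everywhere -/

section Construction

variable {Ω : Type*} [MeasurableSpace Ω] {P : Measure Ω}

/-- Putting the zero path on a measurable null set makes regularity and the starting point hold for
every `ω`, so that later path identities need no exceptional sets. -/
theorem IsLevyProcess.exists_modification {ξ : ℝ≥0 → Ω → ℝ} (hξ : IsLevyProcess ξ P) :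
    ∃ Y : Ω → RCPath ℝ, Measurable Y ∧ (∀ᵐ ω ∂P, ∀ t, (Y ω).1 t = ξ t ω) ∧
      (∀ ω, (Y ω).1 0 = 0) ∧ ∀ ω s, ∃ K : ℝ, ∀ u ≤ s, |(Y ω).1 u| ≤ K := by
  classical
  have hae : ∀ᵐ ω ∂P, ξ 0 ω = 0 ∧ IsCadlag fun t => ξ t ω := hξ.zero.and hξ.cadlag
  obtain ⟨N, hN, hNm, hN0⟩ := exists_measurable_superset_of_null hae
  have hgood : ∀ ω, ω ∉ N → ξ 0 ω = 0 ∧ IsCadlag fun t => ξ t ω := fun ω hω => by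
    by_contra h
    exact hω (hN h)
  set Y : Ω → RCPath ℝ := fun ω => if h : ω ∈ N then ⟨fun _ => 0, fun _ => continuousWithinAt_const⟩
    else ⟨fun t => ξ t ω, fun t => ((hgood ω h).2 t).1⟩ with hY
  have hYval : ∀ ω t, (Y ω).1 t = if ω ∈ N then 0 else ξ t ω := by
    intro ω t
    by_cases h : ω ∈ N <;> simp [hY, h]
  refine ⟨Y, ?_, ?_, ?_, ?_⟩
  · have h1 : ∀ t, Measurable fun ω => (Y ω).1 t := by
      intro t
      simp only [hYval]
      exact Measurable.ite hNm measurable_const (hξ.measurable t)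
    exact (measurable_pi_lambda (fun ω => (Y ω).1) h1).subtype_mk (h := fun ω => (Y ω).2)
  · filter_upwards [measure_eq_zero_iff_ae_notMem.1 hN0] with ω hω t
    simp [hYval, hω]
  · intro ω
    by_cases h : ω ∈ N <;> simp [hYval, h, (hgood ω _).1]
  · intro ω s
    by_cases h : ω ∈ N
    · exact ⟨0, fun u _ => by simp [hYval, h]⟩
    · obtain ⟨K, hK⟩ := (hgood ω h).2.bddOn s
      exact ⟨K, fun u hu => by simpa [hYval, h] using hK u hu⟩

variable {ξ : ℝ≥0 → Ω → ℝ} {Y : Ω → RCPath ℝ}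

theorem IsLevyProcess.iIndepFun_modification (hξ : IsLevyProcess ξ P)
    (hae : ∀ᵐ ω ∂P, ∀ t, (Y ω).1 t = ξ t ω) {τ : ℕ → ℝ≥0} (hτ : Monotone τ) :
    iIndepFun (fun i ω => (Y ω).1 (τ (i + 1)) - (Y ω).1 (τ i)) P := by
  refine (hξ.indep.nat hτ).congr fun i => ?_
  filter_upwards [hae] with ω hω
  simp [hω]

theorem IsLevyProcess.map_sub_modification (hξ : IsLevyProcess ξ P)
    (hae : ∀ᵐ ω ∂P, ∀ t, (Y ω).1 t = ξ t ω) (s t : ℝ≥0) :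
    P.map (fun ω => (Y ω).1 (s + t) - (Y ω).1 s) = P.map (fun ω => ξ t ω) := by
  rw [← hξ.stationary s t]
  refine Measure.map_congr ?_
  filter_upwards [hae] with ω hω
  simp [hω]

theorem eval_eq_sum {w : RCPath ℝ} (h0 : w.1 0 = 0) {τ : ℕ → ℝ≥0} (hτ0 : τ 0 = 0) (k : ℕ) :
    w.1 (τ k) = ∑ i ∈ Finset.range k, (w.1 (τ (i + 1)) - w.1 (τ i)) := by
  rw [Finset.sum_range_sub (fun i => w.1 (τ i)), hτ0, h0, sub_zero]

variable [IsProbabilityMeasure P]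

/-- Along a common partition containing `q = τ m`, the stopped path is built from the increments
with index below `m` and the later path from those with index at least `m`. These are disjoint
blocks of one independent family. -/
theorem IsLevyProcess.indep_modification (hξ : IsLevyProcess ξ P) (hYm : Measurable Y)
    (hae : ∀ᵐ ω ∂P, ∀ t, (Y ω).1 t = ξ t ω) (h0 : ∀ ω, (Y ω).1 0 = 0) (q : ℝ≥0) :
    IndepFun (fun ω => stopAt q (Y ω)) (fun ω => incr q (Y ω)) P := by
  classical
  have hev : ∀ t, Measurable fun ω => (Y ω).1 t := fun t => (measurable_eval_const t).comp hYm
  have hproc : IndepFun (fun ω t => (stopAt q (Y ω)).1 t) (fun ω t => (incr q (Y ω)).1 t) P := by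
    refine IndepFun.process_indepFun_process (fun t => hev _) (fun t => (hev _).sub (hev _))
      fun I J => ?_
    obtain ⟨τ, hτ, hτ0, hsurj⟩ := exists_enumeration
      (insert q (I.image (fun t => min t q) ∪ J.image (fun t => q + t)))
    obtain ⟨m, hm⟩ := hsurj q (by simp)
    have hI : ∀ t ∈ I, ∃ k ≤ m, τ k = min t q := by
      intro t ht
      obtain ⟨k, hk⟩ := hsurj (min t q) (by
        simp only [Finset.mem_insert, Finset.mem_union, Finset.mem_image]
        exact Or.inr (Or.inl ⟨t, ht, rfl⟩))
      rcases le_total k m with h | h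
      · exact ⟨k, h, hk⟩
      -- The enumeration may repeat a time. An index above `m` whose time is at most `q = τ m` must
      -- carry the time `q`, so `m` serves as well.
      · refine ⟨m, le_rfl, le_antisymm ?_ ?_⟩
        · rw [← hk]; exact hτ h
        · rw [hm]; exact min_le_right _ _
    have hJ : ∀ t ∈ J, ∃ k, m ≤ k ∧ τ k = q + t := by
      intro t ht
      obtain ⟨k, hk⟩ := hsurj (q + t) (by
        simp only [Finset.mem_insert, Finset.mem_union, Finset.mem_image]
        exact Or.inr (Or.inr ⟨t, ht, rfl⟩))
      rcases le_total m k with h | h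
      · exact ⟨k, h, hk⟩
      · refine ⟨m, le_rfl, le_antisymm ?_ ?_⟩
        · rw [hm]; simp
        · rw [← hk]; exact hτ h
    choose! kI hkI hτI using hI
    choose! kJ hkJ hτJ using hJ
    set N := J.sup kJ
    have hind := (hξ.iIndepFun_modification hae hτ).indepFun_finset (Finset.range m)
      (Finset.Ico m N) (by
        rw [Finset.disjoint_left]
        intro i hi hi'
        simp at hi hi'
        omega) fun i => (hev _).sub (hev _)
    set Δ : ℕ → Ω → ℝ := fun i ω => (Y ω).1 (τ (i + 1)) - (Y ω).1 (τ i)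
    have h1 : (fun ω (t : I) => (stopAt q (Y ω)).1 t) =
        (fun (x : Finset.range m → ℝ) (t : I) =>
          ∑ i : Finset.range m, if (i : ℕ) < kI t then x i else 0) ∘
        fun ω (i : Finset.range m) => Δ i ω := by
      ext ω t
      simp only [stopAt_apply, Function.comp]
      rw [Finset.sum_coe_sort (Finset.range m) (fun i => if i < kI t then Δ i ω else 0),
        ← Finset.sum_filter, ← hτI t t.2, eval_eq_sum (h0 ω) hτ0]
      refine Finset.sum_congr ?_ fun _ _ => rfl
      ext i
      have := hkI t t.2
      simp
      omega
    have h2 : (fun ω (t : J) => (incr q (Y ω)).1 t) =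
        (fun (x : Finset.Ico m N → ℝ) (t : J) =>
          ∑ i : Finset.Ico m N, if (i : ℕ) < kJ t then x i else 0) ∘
        fun ω (i : Finset.Ico m N) => Δ i ω := by
      ext ω t
      simp only [incr_apply, Function.comp]
      rw [Finset.sum_coe_sort (Finset.Ico m N) (fun i => if i < kJ t then Δ i ω else 0),
        ← Finset.sum_filter, ← hτJ t t.2, ← hm, eval_eq_sum (h0 ω) hτ0, eval_eq_sum (h0 ω) hτ0,
        ← Finset.sum_Ico_eq_sub _ (hkJ t t.2)]
      refine Finset.sum_congr ?_ fun _ _ => rfl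
      ext i
      have : kJ t ≤ N := Finset.le_sup (f := kJ) t.2
      simp
      omega
    rw [h1, h2]
    refine hind.comp ?_ ?_
    · refine measurable_pi_lambda _ fun t => Finset.measurable_fun_sum _ fun i _ => ?_
      exact Measurable.ite (MeasurableSet.const _) (measurable_pi_apply i) measurable_const
    · refine measurable_pi_lambda _ fun t => Finset.measurable_fun_sum _ fun i _ => ?_
      exact Measurable.ite (MeasurableSet.const _) (measurable_pi_apply i) measurable_const
  rw [IndepFun_iff_Indep] at hproc ⊢
  simp only [Subtype.instMeasurableSpace, MeasurableSpace.comap_comp]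
  exact hproc

/-- The increments along `τ` and along `q + τ` have the same product law, and the finite-dimensional
values of either path are the same partial sums `Ψ` of its increments. -/
theorem IsLevyProcess.stationary_modification (hξ : IsLevyProcess ξ P) (hYm : Measurable Y)
    (hae : ∀ᵐ ω ∂P, ∀ t, (Y ω).1 t = ξ t ω) (h0 : ∀ ω, (Y ω).1 0 = 0) (q : ℝ≥0) :
    P.map (fun ω => incr q (Y ω)) = P.map Y := by
  classical
  have hev : ∀ t, Measurable fun ω => (Y ω).1 t := fun t => (measurable_eval_const t).comp hYm
  have hincr : Measurable fun ω => incr q (Y ω) := measurable_incr hYm measurable_const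
  have := Measure.isProbabilityMeasure_map (μ := P) hYm.aemeasurable
  have := Measure.isProbabilityMeasure_map (μ := P) hincr.aemeasurable
  refine ext_of_forall_lintegral_finset (f := fun t w => w.1 t) rfl fun I φ => ?_
  have hφ : Measurable fun w : RCPath ℝ => (φ (fun i : I => w.1 i) : ℝ≥0∞) :=
    measurable_coe_nnreal_ennreal.comp (φ.continuous.measurable.comp
      (measurable_pi_lambda _ fun i => measurable_eval_const _))
  rw [lintegral_map hφ hincr, lintegral_map hφ hYm]
  obtain ⟨τ, hτ, hτ0, hsurj⟩ := exists_enumeration I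
  choose! k hk using hsurj
  set N := I.sup k
  have hτq : Monotone fun i => q + τ i := fun i j hij => add_le_add le_rfl (hτ hij)
  set X : Ω → Fin N → ℝ := fun ω i => (Y ω).1 (τ (i + 1)) - (Y ω).1 (τ i)
  set X' : Ω → Fin N → ℝ := fun ω i => (Y ω).1 (q + τ (i + 1)) - (Y ω).1 (q + τ i)
  have hlaw : P.map X' = P.map X := by
    have e1 := ((hξ.iIndepFun_modification hae hτ).precomp (g := fun i : Fin N => (i : ℕ))
      Fin.val_injective)
    have e2 := ((hξ.iIndepFun_modification hae hτq).precomp (g := fun i : Fin N => (i : ℕ))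
      Fin.val_injective)
    have l1 := (iIndepFun_iff_map_fun_eq_pi_map (fun i => ((hev _).sub (hev _)).aemeasurable)).1 e1
    have l2 := (iIndepFun_iff_map_fun_eq_pi_map (fun i => ((hev _).sub (hev _)).aemeasurable)).1 e2
    refine l2.trans (Eq.trans ?_ l1.symm)
    congr 1
    ext1 i
    obtain ⟨d, hd⟩ := exists_add_of_le (hτ (Nat.le_add_right (i : ℕ) 1))
    have a1 := hξ.map_sub_modification hae (τ i) d
    have a2 := hξ.map_sub_modification hae (q + τ i) d
    rw [← a1] at a2
    change P.map (fun ω => (Y ω).1 (q + τ (i + 1)) - (Y ω).1 (q + τ i)) =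
      P.map (fun ω => (Y ω).1 (τ (i + 1)) - (Y ω).1 (τ i))
    rw [hd, ← add_assoc]
    exact a2
  have hXm : Measurable X := measurable_pi_lambda _ fun i => (hev _).sub (hev _)
  have hXm' : Measurable X' := measurable_pi_lambda _ fun i => (hev _).sub (hev _)
  set Ψ : (Fin N → ℝ) → (I → ℝ) := fun x t => ∑ i : Fin N, if (i : ℕ) < k t then x i else 0
  have hΨ : Measurable Ψ := measurable_pi_lambda _ fun t => Finset.measurable_fun_sum _ fun i _ =>
    Measurable.ite (MeasurableSet.const _) (measurable_pi_apply i) measurable_const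
  have hsum : ∀ (v : RCPath ℝ), v.1 0 = 0 → ∀ t : I, v.1 t =
      ∑ i : Fin N, if (i : ℕ) < k t then v.1 (τ (i + 1)) - v.1 (τ i) else 0 := by
    intro v hv t
    rw [Fin.sum_univ_eq_sum_range (fun i => if i < k t then v.1 (τ (i + 1)) - v.1 (τ i) else 0) N,
      ← Finset.sum_filter]
    conv_lhs => rw [← hk t t.2, eval_eq_sum hv hτ0]
    refine Finset.sum_congr ?_ fun _ _ => rfl
    ext i
    have : k t ≤ N := Finset.le_sup (f := k) t.2
    simp
    omega
  have h1 : ∀ ω, (fun i : I => (Y ω).1 i) = Ψ (X ω) := fun ω => funext fun t => hsum _ (h0 ω) t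
  have h2 : ∀ ω, (fun i : I => (incr q (Y ω)).1 i) = Ψ (X' ω) := fun ω => funext fun t => by
    rw [hsum (incr q (Y ω)) (by simp) t]
    simp [Ψ, X']
  have hφΨ : Measurable fun x => (φ (Ψ x) : ℝ≥0∞) :=
    measurable_coe_nnreal_ennreal.comp (φ.continuous.measurable.comp hΨ)
  simp only [h1, h2]
  rw [← lintegral_map hφΨ hXm', ← lintegral_map hφΨ hXm, hlaw]

theorem IsLevyProcess.exists_isLevyPath (hξ : IsLevyProcess ξ P) :
    ∃ Y : Ω → RCPath ℝ, IsLevyPath Y P ∧ ∀ᵐ ω ∂P, ∀ t, (Y ω).1 t = ξ t ω := by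
  obtain ⟨Y, hYm, hae, h0, hb⟩ := hξ.exists_modification
  exact ⟨Y, ⟨hYm, h0, hb, hξ.indep_modification hYm hae h0, hξ.stationary_modification hYm hae h0⟩,
    hae⟩

end Construction

/-! ### The strong Markov property at an inverse clock -/

section StrongMarkov

variable {Ω : Type*} [MeasurableSpace Ω] {P : Measure Ω} [IsProbabilityMeasure P]
  {Y : Ω → RCPath ℝ}

/-- The clock up to `q` sees only the path stopped at `q`; this makes the inverse clock a stopping
time. -/
theorem pathClock_stopAt (c : ℝ → ℝ≥0∞) (v : RCPath ℝ) {s q : ℝ≥0} (h : s ≤ q) :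
    pathClock c (stopAt q v) s = pathClock c v s := by
  refine setLIntegral_congr_fun measurableSet_Iic fun r hr => ?_
  have : r ≤ q := le_trans hr h
  simp [this]

/-- The simple Markov property at the fixed time `q`, on an event of the past: the pair of stopped
path and later increments has a product law. -/
theorem IsLevyPath.lintegral_stopAt_incr (hY : IsLevyPath Y P) (q : ℝ≥0) {S : Set (RCPath ℝ)}
    (hS : MeasurableSet S) {ψ : ℝ × RCPath ℝ → ℝ≥0∞} (hψ : Measurable ψ) :
    ∫⁻ ω in {ω | stopAt q (Y ω) ∈ S}, ψ ((Y ω).1 q, incr q (Y ω)) ∂P =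
      ∫⁻ ω in {ω | stopAt q (Y ω) ∈ S}, ∫⁻ ω', ψ ((Y ω).1 q, Y ω') ∂P ∂P := by
  have hst : Measurable fun ω => stopAt q (Y ω) := (measurable_stopAt q).comp hY.measurable
  have hin : Measurable fun ω => incr q (Y ω) := measurable_incr hY.measurable measurable_const
  have hlaw := (hY.indep q).map_prod_eq_prod_map_map hst.aemeasurable hin.aemeasurable
  rw [hY.stationary q] at hlaw
  have hSm : MeasurableSet {ω | stopAt q (Y ω) ∈ S} := hst hS
  have h1 : Measurable fun p : RCPath ℝ × RCPath ℝ => S.indicator 1 p.1 * ψ (p.1.1 q, p.2) :=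
    ((measurable_one.indicator hS).comp measurable_fst).mul
      (hψ.comp (((measurable_eval_const q).comp measurable_fst).prodMk measurable_snd))
  have := Measure.isProbabilityMeasure_map (μ := P) hY.measurable.aemeasurable
  have h2 : ∫⁻ p, S.indicator 1 p.1 * ψ (p.1.1 q, p.2)
      ∂(P.map fun ω => (stopAt q (Y ω), incr q (Y ω))) =
      ∫⁻ ω in {ω | stopAt q (Y ω) ∈ S}, ψ ((Y ω).1 q, incr q (Y ω)) ∂P := by
    rw [lintegral_map h1 (hst.prodMk hin), ← lintegral_indicator hSm]
    refine lintegral_congr fun ω => ?_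
    by_cases h : stopAt q (Y ω) ∈ S <;> simp [h, indicator]
  rw [← h2, hlaw, lintegral_prod _ h1.aemeasurable, lintegral_map ?_ hst,
    ← lintegral_indicator hSm]
  · refine lintegral_congr fun ω => ?_
    have h3 : Measurable fun y => S.indicator 1 (stopAt q (Y ω)) * ψ ((stopAt q (Y ω)).1 q, y) :=
      h1.comp measurable_prodMk_left
    rw [lintegral_map h3 hY.measurable]
    by_cases h : stopAt q (Y ω) ∈ S <;> simp [h, indicator]
  · exact h1.lintegral_prod_right'

/-- A discretisation from above of a random time. -/
def gridTime (n : ℕ) (h : ℝ≥0) : ℝ≥0 := ((⌊h * ((n : ℝ≥0) + 1)⌋₊ : ℝ≥0) + 1) / ((n : ℝ≥0) + 1)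

theorem measurable_gridTime (n : ℕ) : Measurable (gridTime n) := by
  have h : Measurable fun h : ℝ≥0 => ⌊h * ((n : ℝ≥0) + 1)⌋₊ :=
    Nat.measurable_floor.comp (by fun_prop)
  have h' : Measurable fun k : ℕ => (((k : ℝ≥0) + 1) / ((n : ℝ≥0) + 1)) := measurable_of_countable _
  exact h'.comp h

theorem le_gridTime (n : ℕ) (h : ℝ≥0) : h ≤ gridTime n h := by
  rw [gridTime, le_div_iff₀ (by positivity)]
  exact (Nat.lt_floor_add_one _).le

theorem tendsto_gridTime (h : ℝ≥0) : Tendsto (fun n => gridTime n h) atTop (𝓝 h) := by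
  have hup : ∀ n : ℕ, gridTime n h ≤ h + 1 / ((n : ℝ≥0) + 1) := by
    intro n
    rw [gridTime, add_div]
    gcongr
    rw [div_le_iff₀ (by positivity)]
    exact Nat.floor_le (by positivity)
  have hlim : Tendsto (fun n : ℕ => h + 1 / ((n : ℝ≥0) + 1)) atTop (𝓝 h) := by
    simpa using tendsto_const_nhds.add (tendsto_one_div_add_atTop_nhds_zero_nat (𝕜 := ℝ≥0))
  exact tendsto_of_tendsto_of_tendsto_of_le_of_le tendsto_const_nhds hlim
    (fun n => le_gridTime n h) hup

theorem tendsto_eval_gridTime (w : RCPath ℝ) (h s : ℝ≥0) :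
    Tendsto (fun n => w.1 (gridTime n h + s)) atTop (𝓝 (w.1 (h + s))) :=
  (w.2 (h + s)).tendsto.comp (tendsto_nhdsWithin_iff.2 ⟨(tendsto_gridTime h).add_const s,
    Eventually.of_forall fun n => add_le_add (le_gridTime n h) le_rfl⟩)

/-- The strong Markov property for discretised inverse clocks. On `D k` the grid time is the
constant `q k`, and `D k` is an event of the path stopped at `q k`, so the simple Markov property
applies piece by piece. -/
theorem IsLevyPath.lintegral_gridTime (hY : IsLevyPath Y P) {c : ℝ → ℝ≥0∞} (hc : Measurable c)
    (t : ℝ≥0) (n : ℕ) {ψ : ℝ × RCPath ℝ → ℝ≥0∞} (hψ : Measurable ψ) :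
    ∫⁻ ω in {ω | (t : ℝ≥0∞) < pathTotal c (Y ω)},
        ψ ((Y ω).1 (gridTime n (pathClockInv c (Y ω) t)),
          incr (gridTime n (pathClockInv c (Y ω) t)) (Y ω)) ∂P =
      ∫⁻ ω in {ω | (t : ℝ≥0∞) < pathTotal c (Y ω)},
        ∫⁻ ω', ψ ((Y ω).1 (gridTime n (pathClockInv c (Y ω) t)), Y ω') ∂P ∂P := by
  set q : ℕ → ℝ≥0 := fun k => ((k : ℝ≥0) + 1) / ((n : ℝ≥0) + 1)
  set S : ℕ → Set (RCPath ℝ) := fun k =>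
    {v | pathClock c v ((k : ℝ≥0) / ((n : ℝ≥0) + 1)) ≤ t ∧ (t : ℝ≥0∞) < pathClock c v (q k)}
  have hcl : ∀ s, Measurable fun v : RCPath ℝ => pathClock c v s := fun s =>
    (measurable_pathClock hc).comp (measurable_id.prodMk measurable_const)
  have hS : ∀ k, MeasurableSet (S k) := fun k =>
    (measurableSet_le (hcl _) measurable_const).inter (measurableSet_lt measurable_const (hcl _))
  set D : ℕ → Set Ω := fun k => {ω | stopAt (q k) (Y ω) ∈ S k}
  have hmem : ∀ k ω, ω ∈ D k ↔ (t : ℝ≥0∞) < pathTotal c (Y ω) ∧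
      ⌊pathClockInv c (Y ω) t * ((n : ℝ≥0) + 1)⌋₊ = k := by
    intro k ω
    have h1 : ω ∈ D k ↔ pathClock c (Y ω) ((k : ℝ≥0) / ((n : ℝ≥0) + 1)) ≤ t ∧
        (t : ℝ≥0∞) < pathClock c (Y ω) (q k) := by
      simp only [D, S, mem_ofPred_eq]
      rw [pathClock_stopAt c _ le_rfl, pathClock_stopAt c]
      simp only [q]
      gcongr
      simp
    rw [h1]
    have key : (t : ℝ≥0∞) < pathTotal c (Y ω) → ∀ a, (pathClockInv c (Y ω) t < a ↔
        (t : ℝ≥0∞) < pathClock c (Y ω) a) := fun ht a => clockInv_lt_iff ht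
    constructor
    · rintro ⟨h2, h3⟩
      have ht := h3.trans_le (clock_le_totalClock _ _)
      refine ⟨ht, ?_⟩
      rw [← key ht] at h3
      rw [← not_lt, ← key ht, not_lt] at h2
      rw [Nat.floor_eq_iff (by positivity)]
      rw [div_le_iff₀ (by positivity)] at h2
      rw [lt_div_iff₀ (by positivity)] at h3
      exact ⟨h2, h3⟩
    · rintro ⟨ht, hk⟩
      rw [Nat.floor_eq_iff (by positivity)] at hk
      rw [← key ht, ← not_lt, ← key ht, not_lt, div_le_iff₀ (by positivity),
        lt_div_iff₀ (by positivity)]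
      exact hk
  have hD : ∀ k, MeasurableSet (D k) := fun k =>
    ((measurable_stopAt (q k)).comp hY.measurable) (hS k)
  have hE : {ω | (t : ℝ≥0∞) < pathTotal c (Y ω)} = ⋃ k, D k := by
    ext ω
    simp [hmem]
  have hdisj : Pairwise (Function.onFun Disjoint D) := by
    intro i j hij
    rw [Function.onFun, Set.disjoint_left]
    intro ω hi hj
    exact hij (((hmem i ω).1 hi).2.symm.trans ((hmem j ω).1 hj).2)
  have hgrid : ∀ k, ∀ ω ∈ D k, gridTime n (pathClockInv c (Y ω) t) = q k := by
    intro k ω hω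
    rw [gridTime, ((hmem k ω).1 hω).2]
  rw [hE, lintegral_iUnion hD hdisj, lintegral_iUnion hD hdisj]
  congr 1
  ext k
  refine (setLIntegral_congr_fun (hD k) fun ω hω => ?_).trans
    ((hY.lintegral_stopAt_incr (q k) (hS k) hψ).trans
      (setLIntegral_congr_fun (hD k) fun ω hω => ?_).symm)
  · simp only [hgrid k ω hω]
  · simp only [hgrid k ω hω]

/-- Strong Markov property of a Lévy path at an inverse clock. -/
theorem IsLevyPath.strongMarkov (hY : IsLevyPath Y P) {c : ℝ → ℝ≥0∞} (hc : Measurable c)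
    (t : ℝ≥0) :
    (P.restrict {ω | (t : ℝ≥0∞) < pathTotal c (Y ω)}).map
        (fun ω => ((Y ω).1 (pathClockInv c (Y ω) t), incr (pathClockInv c (Y ω) t) (Y ω))) =
      ((P.restrict {ω | (t : ℝ≥0∞) < pathTotal c (Y ω)}).map
        (fun ω => (Y ω).1 (pathClockInv c (Y ω) t))).prod (P.map Y) := by
  set E := {ω | (t : ℝ≥0∞) < pathTotal c (Y ω)}
  have hinv : Measurable fun ω => pathClockInv c (Y ω) t :=
    (measurable_pathClockInv hc).comp (hY.measurable.prodMk measurable_const)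
  have h1 : Measurable fun ω => (Y ω).1 (pathClockInv c (Y ω) t) :=
    measurable_apply hY.measurable hinv
  have h2 : Measurable fun ω => incr (pathClockInv c (Y ω) t) (Y ω) :=
    measurable_incr hY.measurable hinv
  have := Measure.isProbabilityMeasure_map (μ := P) hY.measurable.aemeasurable
  have := Measure.isFiniteMeasure_map (P.restrict E) fun ω => (Y ω).1 (pathClockInv c (Y ω) t)
  have := Measure.isFiniteMeasure_map (P.restrict E) fun ω =>
    ((Y ω).1 (pathClockInv c (Y ω) t), incr (pathClockInv c (Y ω) t) (Y ω))
  -- The coordinate `none` is the position at the random time, and `some s` is the later increment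
  -- over `s`. Together they generate the product σ-algebra.
  set f : Option ℝ≥0 → ℝ × RCPath ℝ → ℝ := fun i p => i.elim p.1 fun s => p.2.1 s
  have hfm : ∀ i, Measurable (f i) := by
    rintro (_ | s)
    · exact measurable_fst
    · exact (measurable_eval_const s).comp measurable_snd
  refine ext_of_forall_lintegral_finset (f := f) ?_ fun I φ => ?_
  · refine le_antisymm ?_ (measurable_pi_lambda _ hfm).comap_le
    have hcm : Measurable[MeasurableSpace.comap (fun a i => f i a) MeasurableSpace.pi]
        fun a i => f i a := comap_measurable _
    have hfi : ∀ i, Measurable[MeasurableSpace.comap (fun a i => f i a) MeasurableSpace.pi]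
        (f i) := fun i => (measurable_pi_apply i).comp hcm
    refine sup_le (hfi none).comap_le ?_
    have h3 : Measurable[MeasurableSpace.comap (fun a i => f i a) MeasurableSpace.pi]
        fun p : ℝ × RCPath ℝ => p.2 := by
      have : Measurable[MeasurableSpace.comap (fun a i => f i a) MeasurableSpace.pi]
        fun p : ℝ × RCPath ℝ => p.2.1 := @measurable_pi_lambda _ _ _ (_) _ _ fun s => hfi (some s)
      exact this.subtype_mk
    exact h3.comap_le
  · set G : ℝ × RCPath ℝ → ℝ≥0∞ := fun p => φ fun i : I => f i p
    have hG : Measurable G := measurable_coe_nnreal_ennreal.comp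
      (φ.continuous.measurable.comp (measurable_pi_lambda _ fun i => hfm i))
    obtain ⟨M, hM⟩ : ∃ M : ℝ≥0, ∀ p, G p ≤ M := by
      obtain ⟨M, hM⟩ := φ.isBounded_range.bddAbove
      exact ⟨M, fun p => ENNReal.coe_le_coe.2 (hM ⟨_, rfl⟩)⟩
    have hGc : ∀ (p : ℕ → ℝ × RCPath ℝ) (p₀ : ℝ × RCPath ℝ),
        (∀ i, Tendsto (fun n => f i (p n)) atTop (𝓝 (f i p₀))) →
        Tendsto (fun n => G (p n)) atTop (𝓝 (G p₀)) := by
      intro p p₀ hp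
      refine (ENNReal.continuous_coe.tendsto _).comp
        ((φ.continuous.tendsto _).comp (tendsto_pi_nhds.2 fun i => hp i))
    rw [lintegral_map hG (h1.prodMk h2), lintegral_prod _ hG.aemeasurable,
      lintegral_map hG.lintegral_prod_right' h1]
    have hmapY : ∀ y : ℝ, ∫⁻ v, G (y, v) ∂P.map Y = ∫⁻ ω', G (y, Y ω') ∂P := fun y =>
      lintegral_map (hG.comp measurable_prodMk_left) hY.measurable
    simp only [hmapY]
    have hgridm : ∀ n, Measurable fun ω => gridTime n (pathClockInv c (Y ω) t) := fun n =>
      (measurable_gridTime n).comp hinv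
    have hinner : ∀ ω, Tendsto (fun n => ∫⁻ ω', G ((Y ω).1 (gridTime n (pathClockInv c (Y ω) t)),
        Y ω') ∂P) atTop (𝓝 (∫⁻ ω', G ((Y ω).1 (pathClockInv c (Y ω) t), Y ω') ∂P)) := by
      intro ω
      refine tendsto_lintegral_of_dominated_convergence (fun _ => (M : ℝ≥0∞))
        (fun n => hG.comp (measurable_const.prodMk hY.measurable))
        (fun n => Eventually.of_forall fun ω' => hM _) (by simp)
        (Eventually.of_forall fun ω' => hGc _ _ ?_)
      rintro (_ | s)
      · have h0 := tendsto_eval_gridTime (Y ω) (pathClockInv c (Y ω) t) 0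
        simp only [add_zero] at h0
        exact h0
      · exact tendsto_const_nhds
    -- The two sides agree at the grid times, which decrease to the inverse clock; right-continuity
    -- and domination by the bound `M` pass to the limit.
    refine tendsto_nhds_unique (f := fun n => ∫⁻ ω in E,
        G ((Y ω).1 (gridTime n (pathClockInv c (Y ω) t)),
          incr (gridTime n (pathClockInv c (Y ω) t)) (Y ω)) ∂P) (l := atTop) ?_ ?_
    · refine tendsto_lintegral_of_dominated_convergence (fun _ => (M : ℝ≥0∞))
        (fun n => hG.comp ((measurable_apply hY.measurable (hgridm n)).prodMk
          (measurable_incr hY.measurable (hgridm n))))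
        (fun n => Eventually.of_forall fun ω' => hM _)
        (by simpa using ENNReal.mul_ne_top ENNReal.coe_ne_top (measure_ne_top _ _))
        (Eventually.of_forall fun ω => hGc _ _ ?_)
      have h0 := tendsto_eval_gridTime (Y ω) (pathClockInv c (Y ω) t) 0
      simp only [add_zero] at h0
      rintro (_ | s)
      · exact h0
      · exact (tendsto_eval_gridTime (Y ω) (pathClockInv c (Y ω) t) s).sub h0
    · simp only [hY.lintegral_gridTime hc t _ hG, E]
      refine tendsto_lintegral_of_dominated_convergence (fun _ => (M : ℝ≥0∞)) (fun n => ?_)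
        (fun n => Eventually.of_forall fun ω' => ?_)
        (by simpa using ENNReal.mul_ne_top ENNReal.coe_ne_top (measure_ne_top _ _))
        (Eventually.of_forall hinner)
      · exact Measurable.lintegral_prod_right' (f := fun p : Ω × Ω =>
          G ((Y p.1).1 (gridTime n (pathClockInv c (Y p.1) t)), Y p.2))
          (hG.comp (((measurable_apply hY.measurable (hgridm n)).comp measurable_fst).prodMk
            (hY.measurable.comp measurable_snd)))
      · exact (lintegral_mono fun _ => hM _).trans (by simp)

theorem IsLevyPath.lintegral_strongMarkov (hY : IsLevyPath Y P) {c : ℝ → ℝ≥0∞}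
    (hc : Measurable c) (t : ℝ≥0) {ψ : ℝ × RCPath ℝ → ℝ≥0∞} (hψ : Measurable ψ) :
    ∫⁻ ω in {ω | (t : ℝ≥0∞) < pathTotal c (Y ω)},
        ψ ((Y ω).1 (pathClockInv c (Y ω) t), incr (pathClockInv c (Y ω) t) (Y ω)) ∂P =
      ∫⁻ ω in {ω | (t : ℝ≥0∞) < pathTotal c (Y ω)},
        ∫⁻ ω', ψ ((Y ω).1 (pathClockInv c (Y ω) t), Y ω') ∂P ∂P := by
  have hinv : Measurable fun ω => pathClockInv c (Y ω) t :=
    (measurable_pathClockInv hc).comp (hY.measurable.prodMk measurable_const)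
  have h1 : Measurable fun ω => (Y ω).1 (pathClockInv c (Y ω) t) :=
    measurable_apply hY.measurable hinv
  have h2 : Measurable fun ω => incr (pathClockInv c (Y ω) t) (Y ω) :=
    measurable_incr hY.measurable hinv
  have := Measure.isProbabilityMeasure_map (μ := P) hY.measurable.aemeasurable
  have h := congrArg (fun μ => ∫⁻ p, ψ p ∂μ) (hY.strongMarkov hc t)
  rw [lintegral_map hψ (h1.prodMk h2), lintegral_prod _ hψ.aemeasurable,
    lintegral_map hψ.lintegral_prod_right' h1] at h
  have hmapY : ∀ y : ℝ, ∫⁻ v, ψ (y, v) ∂P.map Y = ∫⁻ ω', ψ (y, Y ω') ∂P := fun y =>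
    lintegral_map (hψ.comp measurable_prodMk_left) hY.measurable
  simpa only [hmapY] using h

end StrongMarkov

/-! ### The laws of the time-changed process -/

theorem continuous_coe_add (x : ℝ) : Continuous fun y : ℝ => ((x + y : ℝ) : WithTop ℝ) :=
  WithTop.isOpenEmbedding_some.continuous.comp (by fun_prop)

/-- The path `x + v`, as a path with values in `(-∞, +∞]`. -/
def startAt (x : ℝ) (v : RCPath ℝ) : RCPath (WithTop ℝ) :=
  mapC (fun y => ((x + y : ℝ) : WithTop ℝ)) (continuous_coe_add x) v

@[simp] theorem startAt_apply (x : ℝ) (v : RCPath ℝ) (t : ℝ≥0) :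
    (startAt x v).1 t = ((x + v.1 t : ℝ) : WithTop ℝ) := rfl

theorem measurable_startAt {α : Type*} [MeasurableSpace α] {x : α → ℝ} (hx : Measurable x)
    {Z : α → RCPath ℝ} (hZ : Measurable Z) : Measurable fun a => startAt (x a) (Z a) :=
  (measurable_pi_lambda _ fun t =>
    WithTop.isOpenEmbedding_some.continuous.measurable.comp
      (hx.add ((measurable_eval_const t).comp hZ))).subtype_mk

theorem shift_startAt (x : ℝ) (v : RCPath ℝ) (h : ℝ≥0) :
    shift h (startAt x v) = startAt (x + v.1 h) (incr h v) := by
  ext t : 2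
  simp

theorem translate_startAt (z x : ℝ) (v : RCPath ℝ) :
    translate z (startAt x v) = startAt (z + x) v := by
  ext t : 2
  simp only [translate, mapC_apply, startAt_apply]
  rw [← WithTop.coe_add, add_assoc]

/-- The path of the time-changed process started from `x`. -/
def levyTimeChange (R : ℝ → ℝ) (x : ℝ) (v : RCPath ℝ) : RCPath (WithTop ℝ) :=
  timeChange (invRate R) (startAt x v)

theorem measurable_levyTimeChange (hR : Measurable R) {α : Type*} [MeasurableSpace α] {x : α → ℝ}
    (hx : Measurable x) {Z : α → RCPath ℝ} (hZ : Measurable Z) :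
    Measurable fun a => levyTimeChange R (x a) (Z a) :=
  (measurable_timeChange (measurable_invRate hR)).comp (measurable_startAt hx hZ)

theorem levyTimeChange_eq_timeChanged {Ω : Type*} {Y : Ω → RCPath ℝ} {R : ℝ → ℝ}
    {ξ : ℝ≥0 → Ω → ℝ} {ω : Ω} (h : ∀ t, (Y ω).1 t = ξ t ω) (x : ℝ) (t : ℝ≥0) :
    (levyTimeChange R x (Y ω)).1 t = timeChanged R ξ x ω t := by
  have hr : (fun u => invRate R ((startAt x (Y ω)).1 u)) =
      fun r => ENNReal.ofReal (1 / R (x + ξ r ω)) := by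
    ext u
    simp [invRate, h]
  by_cases ht : (t : ℝ≥0∞) < pathTotal (invRate R) (startAt x (Y ω))
  · have ht' := ht
    rw [pathTotal, hr] at ht'
    rw [levyTimeChange, timeChange_of_lt ht, timeChanged, if_pos ht', pathClockInv, hr,
      startAt_apply, h]
  · have ht' := ht
    rw [pathTotal, hr] at ht'
    rw [levyTimeChange, timeChange_of_not_lt ht, timeChanged, if_neg ht']

theorem measurableSet_eval_mem (t : ℝ≥0) {A : Set ℝ} (hA : MeasurableSet A) :
    MeasurableSet {w : RCPath (WithTop ℝ) | w.1 t ∈ ((↑) : ℝ → WithTop ℝ) '' A} :=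
  measurable_eval_const t (measurableSet_coe_image hA)

section Laws

variable {Ω : Type*} [MeasurableSpace Ω] {P : Measure Ω}
  {Y : Ω → RCPath ℝ} {R : ℝ → ℝ}

/-- Clocks with a continuous rate are finite along a locally bounded path. -/
theorem IsLevyPath.pathClock_ne_top (hY : IsLevyPath Y P) {c : WithTop ℝ → ℝ≥0∞} {ρ : ℝ → ℝ}
    (hρ : Continuous ρ) (hc : ∀ y : ℝ, c y = ENNReal.ofReal (ρ y)) (x : ℝ) (ω : Ω) (s : ℝ≥0) :
    pathClock c (startAt x (Y ω)) s ≠ ∞ := by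
  obtain ⟨K, hK⟩ := hY.bdd ω s
  obtain ⟨M, hM⟩ := (isCompact_Icc (a := x - K) (b := x + K)).bddAbove_image hρ.continuousOn
  have hle : pathClock c (startAt x (Y ω)) s ≤ ENNReal.ofReal M * s := by
    rw [pathClock, clock_eq_Iio, ← timeMeasure_Iio s, ← setLIntegral_const]
    refine setLIntegral_mono measurable_const fun u hu => ?_
    rw [startAt_apply, hc]
    refine ENNReal.ofReal_le_ofReal (hM ⟨_, ?_, rfl⟩)
    have := abs_le.1 (hK u (le_of_lt hu))
    constructor <;> linarith [this.1, this.2]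
  exact ne_top_of_le_ne_top (ENNReal.mul_ne_top ENNReal.ofReal_ne_top ENNReal.coe_ne_top) hle

theorem IsLevyPath.invRate_clock_ne_top (hY : IsLevyPath Y P) (hR : Continuous R)
    (hpos : ∀ x, 0 < R x) (x : ℝ) (ω : Ω) (s : ℝ≥0) :
    pathClock (invRate R) (startAt x (Y ω)) s ≠ ∞ :=
  hY.pathClock_ne_top (ρ := fun y => 1 / R y)
    (continuous_const.div hR fun x => (hpos x).ne') (fun y => by simp [invRate]) x ω s

theorem goodClock_of_ne_top {c : WithTop ℝ → ℝ≥0∞} {w : RCPath (WithTop ℝ)}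
    (h : ∀ s, pathClock c w s ≠ ∞) : GoodClock c w := fun u _ => h u

theorem invRate_ne_zero (hpos : ∀ x, 0 < R x) (y : WithTop ℝ) : invRate R y ≠ 0 := by
  have := hpos (y.untopD 0)
  simp only [invRate, ne_eq, ENNReal.ofReal_eq_zero, not_le]
  positivity

/-- A positive rate makes the clock positive at once, so its inverse starts at `0`. -/
theorem levyTimeChange_zero (hY : IsLevyPath Y P) (hR : Continuous R) (hpos : ∀ x, 0 < R x)
    (x : ℝ) (ω : Ω) : (levyTimeChange R x (Y ω)).1 0 = x := by
  have hmono : StrictMono (pathClock (invRate R) (startAt x (Y ω))) :=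
    clock_strictMono ((measurable_invRate hR.measurable).comp (measurable_path _))
      (fun s => invRate_ne_zero hpos _) (hY.invRate_clock_ne_top hR hpos x ω)
  have h0 : ∀ a : ℝ≥0, 0 < a → ((0 : ℝ≥0) : ℝ≥0∞) < pathClock (invRate R) (startAt x (Y ω)) a := by
    intro a ha
    have := hmono ha
    rwa [pathClock, clock_zero] at this
  have htot : ((0 : ℝ≥0) : ℝ≥0∞) < pathTotal (invRate R) (startAt x (Y ω)) :=
    (h0 1 one_pos).trans_le (clock_le_totalClock _ _)
  have hinv : pathClockInv (invRate R) (startAt x (Y ω)) 0 = 0 := by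
    refine le_antisymm (le_of_forall_gt fun a ha => ?_) bot_le
    exact (clockInv_lt_iff htot).2 (h0 a ha)
  rw [levyTimeChange, timeChange_of_lt htot, hinv, startAt_apply, hY.zero, add_zero]

/-- This cancellation is the reason for the form of `g(z,·)`: composed with the clock of `X` from
`x` it produces the clock of `X` from `z + x`. -/
theorem scalingRate_mul_invRate (hpos : ∀ x, 0 < R x) (z y : ℝ) :
    (scalingRate R z * invRate R) y = ENNReal.ofReal (1 / R (z + y)) := by
  have hs : scalingRate R z (y : WithTop ℝ) = ENNReal.ofReal (R y / R (z + y)) := by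
    simp [scalingRate_eq]
  rw [Pi.mul_apply, hs, invRate, WithTop.untopD_coe, ← ENNReal.ofReal_mul (by
    have := hpos y; have := hpos (z + y); positivity)]
  congr 1
  have := (hpos y).ne'
  field_simp

theorem timeChange_congr {c c' : WithTop ℝ → ℝ≥0∞} {w : RCPath (WithTop ℝ)}
    (h : ∀ s, c (w.1 s) = c' (w.1 s)) : timeChange c w = timeChange c' w := by
  ext t : 2
  have h1 : pathTotal c w = pathTotal c' w := by simp only [pathTotal, h]
  have h2 : pathClockInv c w t = pathClockInv c' w t := by simp only [pathClockInv, h]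
  by_cases ht : (t : ℝ≥0∞) < pathTotal c w
  · rw [timeChange_of_lt ht, timeChange_of_lt (h1 ▸ ht), h2]
  · rw [timeChange_of_not_lt ht, timeChange_of_not_lt (h1 ▸ ht)]

/-- The path transform maps the time-changed process started from `x` to the one started from
`z + x`. -/
theorem pathTransformRC_levyTimeChange (hY : IsLevyPath Y P) (hR : Continuous R)
    (hpos : ∀ x, 0 < R x) (z x : ℝ) (ω : Ω) :
    pathTransformRC R z (levyTimeChange R x (Y ω)) = levyTimeChange R (z + x) (Y ω) := by
  rw [pathTransformRC, levyTimeChange, timeChange_timeChange (measurable_invRate hR.measurable)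
    (measurable_scalingRate hR.measurable z) (fun s => invRate_ne_zero hpos _)
    (hY.invRate_clock_ne_top hR hpos x ω), levyTimeChange, ← translate_startAt,
    timeChange_translate]
  congr 1
  refine timeChange_congr fun s => ?_
  rw [startAt_apply, scalingRate_mul_invRate hpos, invRate, ← WithTop.coe_add, WithTop.untopD_coe]

/-- The composed clock has the continuous rate `1 / R(z + ·)` along a locally bounded Lévy path,
hence is finite. -/
theorem goodClock_levyTimeChange (hY : IsLevyPath Y P) (hR : Continuous R)
    (hpos : ∀ x, 0 < R x) (z x : ℝ) (ω : Ω) :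
    GoodClock (scalingRate R z) (levyTimeChange R x (Y ω)) := by
  refine goodClock_timeChange (measurable_invRate hR.measurable)
    (measurable_scalingRate hR.measurable z) (hY.invRate_clock_ne_top hR hpos x ω) ?_
  exact hY.pathClock_ne_top (ρ := fun y => 1 / R (z + y))
    (continuous_const.div (by fun_prop) fun x => (hpos _).ne')
    (scalingRate_mul_invRate hpos z) x ω

variable [IsProbabilityMeasure P]

/-- The kernel of laws of the time-changed process. -/
def pathLaw (R : ℝ → ℝ) (Y : Ω → RCPath ℝ) (P : Measure Ω) [SFinite P] :
    Kernel ℝ (RCPath (WithTop ℝ)) :=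
  (Kernel.id ×ₖ Kernel.const ℝ P).map fun p => levyTimeChange R p.1 (Y p.2)

theorem measurable_levyTimeChange_prod (hR : Measurable R) (hY : Measurable Y) :
    Measurable fun p : ℝ × Ω => levyTimeChange R p.1 (Y p.2) :=
  measurable_levyTimeChange hR measurable_fst (hY.comp measurable_snd)

theorem lintegral_pathLaw (hR : Measurable R) (hY : Measurable Y) (x : ℝ)
    {F : RCPath (WithTop ℝ) → ℝ≥0∞} (hF : Measurable F) :
    ∫⁻ w, F w ∂pathLaw R Y P x = ∫⁻ ω, F (levyTimeChange R x (Y ω)) ∂P := by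
  have hm := measurable_levyTimeChange_prod hR hY
  rw [pathLaw, Kernel.map_apply _ hm, lintegral_map hF hm, Kernel.prod_apply, Kernel.id_apply,
    Kernel.const_apply]
  have hFm : Measurable fun p : ℝ × Ω => F (levyTimeChange R p.1 (Y p.2)) := hF.comp hm
  rw [lintegral_prod _ hFm.aemeasurable, lintegral_dirac' _ hFm.lintegral_prod_right']

theorem isMarkovKernel_pathLaw (hR : Measurable R) (hY : Measurable Y) :
    IsMarkovKernel (pathLaw R Y P) :=
  Kernel.IsMarkovKernel.map _ (measurable_levyTimeChange_prod hR hY)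

theorem pathLaw_apply (hR : Measurable R) (hY : Measurable Y) (x : ℝ)
    {S : Set (RCPath (WithTop ℝ))} (hS : MeasurableSet S) :
    pathLaw R Y P x S = P {ω | levyTimeChange R x (Y ω) ∈ S} := by
  rw [← lintegral_indicator_one hS, lintegral_pathLaw hR hY x (measurable_one.indicator hS),
    ← lintegral_indicator_one]
  · rfl
  · exact measurable_levyTimeChange hR measurable_const hY hS

theorem transition_eq_pathLaw {ξ : ℝ≥0 → Ω → ℝ} (hR : Measurable R) (hY : Measurable Y)
    (h : ∀ᵐ ω ∂P, ∀ t, (Y ω).1 t = ξ t ω) (t : ℝ≥0) (x : ℝ) {A : Set ℝ} (hA : MeasurableSet A) :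
    transition R ξ P t x A = pathLaw R Y P x {w | w.1 t ∈ ((↑) : ℝ → WithTop ℝ) '' A} := by
  rw [pathLaw_apply hR hY x (measurableSet_eval_mem t hA), transition]
  refine measure_congr ?_
  filter_upwards [h] with ω hω
  have := levyTimeChange_eq_timeChanged (R := R) hω x t
  apply propext
  change (∃ y ∈ A, timeChanged R ξ x ω t = y) ↔ (levyTimeChange R x (Y ω)).1 t ∈ _
  rw [this]
  exact ⟨fun ⟨y, hy, he⟩ => ⟨y, hy, he.symm⟩, fun ⟨y, hy, he⟩ => ⟨y, hy, he.symm⟩⟩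

/-- Markov property of the time-changed process. -/
theorem IsLevyPath.markov_pathLaw (hY : IsLevyPath Y P) (hR : Continuous R) (hpos : ∀ x, 0 < R x)
    (x : ℝ) (t : ℝ≥0) {φ : ℝ → ℝ≥0∞} (hφ : Measurable φ) {F : RCPath (WithTop ℝ) → ℝ≥0∞}
    (hF : Measurable F) :
    ∫⁻ w in {w | w.1 t ≠ ⊤}, φ ((w.1 t).untopD 0) * F (shift t w) ∂pathLaw R Y P x =
      ∫⁻ w in {w | w.1 t ≠ ⊤}, φ ((w.1 t).untopD 0) *
        ∫⁻ w', F w' ∂pathLaw R Y P ((w.1 t).untopD 0) ∂pathLaw R Y P x := by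
  have hRm := hR.measurable
  have hTm : MeasurableSet {w : RCPath (WithTop ℝ) | w.1 t ≠ ⊤} :=
    measurable_eval_const t (measurableSet_singleton _).compl
  have hev : Measurable fun w : RCPath (WithTop ℝ) => (w.1 t).untopD 0 :=
    measurable_untopD.comp (measurable_eval_const t)
  have hK : Measurable fun y => ∫⁻ w', F w' ∂pathLaw R Y P y := hF.lintegral_kernel
  -- With this rate the clock of `X` is a clock of the Lévy path itself, so time `t` of `X` is an
  -- inverse-clock time to which the strong Markov property applies.
  set c : ℝ → ℝ≥0∞ := fun y => invRate R ((x + y : ℝ) : WithTop ℝ)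
  have hc : Measurable c := (measurable_invRate hRm).comp (continuous_coe_add x).measurable
  have htot : ∀ ω, pathTotal (invRate R) (startAt x (Y ω)) = pathTotal c (Y ω) := fun ω => rfl
  have hinv : ∀ ω, pathClockInv (invRate R) (startAt x (Y ω)) t = pathClockInv c (Y ω) t :=
    fun ω => rfl
  have hval : ∀ ω, (t : ℝ≥0∞) < pathTotal c (Y ω) → (levyTimeChange R x (Y ω)).1 t =
      ((x + (Y ω).1 (pathClockInv c (Y ω) t) : ℝ) : WithTop ℝ) := fun ω h => by
    rw [levyTimeChange, timeChange_of_lt (by rwa [htot]), hinv, startAt_apply]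
  have hset : ∀ ω, (levyTimeChange R x (Y ω)).1 t ≠ ⊤ ↔ (t : ℝ≥0∞) < pathTotal c (Y ω) := by
    intro ω
    by_cases h : (t : ℝ≥0∞) < pathTotal c (Y ω)
    · rw [hval ω h]
      simp [h]
    · rw [levyTimeChange, timeChange_of_not_lt (by rwa [htot])]
      simp [h]
  have hshift : ∀ ω, (t : ℝ≥0∞) < pathTotal c (Y ω) → shift t (levyTimeChange R x (Y ω)) =
      levyTimeChange R (x + (Y ω).1 (pathClockInv c (Y ω) t))
        (incr (pathClockInv c (Y ω) t) (Y ω)) := by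
    intro ω h
    rw [levyTimeChange, (goodClock_of_ne_top (hY.invRate_clock_ne_top hR hpos x ω)).shift_timeChange
      (by rwa [htot]) (by simp), hinv, shift_startAt, levyTimeChange]
  have hEm : MeasurableSet {ω | (t : ℝ≥0∞) < pathTotal c (Y ω)} :=
    measurableSet_lt measurable_const ((measurable_pathTotal hc).comp hY.measurable)
  have hm1 : Measurable fun w : RCPath (WithTop ℝ) => φ ((w.1 t).untopD 0) * F (shift t w) :=
    (hφ.comp hev).mul (hF.comp (measurable_shift measurable_id measurable_const))
  have hm2 : Measurable fun w : RCPath (WithTop ℝ) => φ ((w.1 t).untopD 0) *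
      ∫⁻ w', F w' ∂pathLaw R Y P ((w.1 t).untopD 0) := (hφ.comp hev).mul (hK.comp hev)
  rw [← lintegral_indicator hTm, ← lintegral_indicator hTm,
    lintegral_pathLaw hRm hY.measurable x (hm1.indicator hTm),
    lintegral_pathLaw hRm hY.measurable x (hm2.indicator hTm)]
  have hψ : Measurable fun p : ℝ × RCPath ℝ => φ (x + p.1) * F (levyTimeChange R (x + p.1) p.2) :=
    (hφ.comp (measurable_fst.const_add x)).mul
      (hF.comp (measurable_levyTimeChange hRm (measurable_fst.const_add x) measurable_snd))
  have hSM := hY.lintegral_strongMarkov hc t hψ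
  rw [← lintegral_indicator hEm, ← lintegral_indicator hEm] at hSM
  convert hSM using 3 with ω ω
  · by_cases h : (t : ℝ≥0∞) < pathTotal c (Y ω)
    · have h' := (hset ω).2 h
      rw [indicator_of_mem (by exact h'), indicator_of_mem (by exact h), hshift ω h, hval ω h]
      rfl
    · have h' := mt (hset ω).1 h
      rw [indicator_of_notMem (by exact h'), indicator_of_notMem (by exact h)]
  · by_cases h : (t : ℝ≥0∞) < pathTotal c (Y ω)
    · have h' := (hset ω).2 h
      have hm3 : Measurable fun ω' => F (levyTimeChange R
          (x + (Y ω).1 (pathClockInv c (Y ω) t)) (Y ω')) :=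
        hF.comp (measurable_levyTimeChange hRm measurable_const hY.measurable)
      rw [indicator_of_mem (by exact h'), indicator_of_mem (by exact h), hval ω h,
        WithTop.untopD_coe, lintegral_pathLaw hRm hY.measurable _ hF, ← lintegral_const_mul _ hm3]
    · have h' := mt (hset ω).1 h
      rw [indicator_of_notMem (by exact h'), indicator_of_notMem (by exact h)]

theorem lintegral_pathTransformRC_pathLaw (hY : IsLevyPath Y P) (hR : Continuous R)
    (hpos : ∀ x, 0 < R x) (z x : ℝ) {F : RCPath (WithTop ℝ) → ℝ≥0∞} (hF : Measurable F) :
    ∫⁻ w, F (pathTransformRC R z w) ∂pathLaw R Y P x = ∫⁻ w, F w ∂pathLaw R Y P (z + x) := by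
  have hm : Measurable fun w => F (pathTransformRC R z w) :=
    hF.comp (measurable_pathTransformRC hR.measurable z)
  rw [lintegral_pathLaw hR.measurable hY.measurable _ hm,
    lintegral_pathLaw hR.measurable hY.measurable _ hF]
  simp only [pathTransformRC_levyTimeChange hY hR hpos]

end Laws

/-! ### Cylinder sets -/

/-- The cylinder set of the paths that are in `A₁` at time `t₁`, in `A₂` at time `t₁ + t₂`, and so
on. -/
def cyl : List (ℝ≥0 × Set ℝ) → Set (RCPath (WithTop ℝ))
  | [] => univ
  | p :: l => {w | w.1 p.1 ∈ ((↑) : ℝ → WithTop ℝ) '' p.2 ∧ shift p.1 w ∈ cyl l}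

/-- The cylinder sets over Borel sets. -/
def cylSets : Set (Set (RCPath (WithTop ℝ))) :=
  {s | ∃ l, (∀ p ∈ l, MeasurableSet p.2) ∧ cyl l = s}

theorem measurableSet_cyl : ∀ {l : List (ℝ≥0 × Set ℝ)}, (∀ p ∈ l, MeasurableSet p.2) →
    MeasurableSet (cyl l)
  | [], _ => MeasurableSet.univ
  | p :: l, h => (measurableSet_eval_mem p.1 (h p (by simp))).inter
      (measurable_shift measurable_id measurable_const
        (measurableSet_cyl (l := l) fun q hq => h q (by simp [hq])))

theorem mem_cyl_shift {t t' : ℝ≥0} (h : t ≤ t') (A : Set ℝ) (l : List (ℝ≥0 × Set ℝ))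
    (w : RCPath (WithTop ℝ)) : w ∈ cyl ((t', A) :: l) ↔ shift t w ∈ cyl ((t' - t, A) :: l) := by
  have h1 : t + (t' - t) = t' := add_tsub_cancel_of_le h
  simp only [cyl, mem_ofPred_eq, shift_apply, shift_shift, h1]

/-- The lists are merged by time: the earlier head comes first and the gap before the other head is
shortened accordingly. The induction is on the total length. -/
theorem exists_cyl_eq_inter : ∀ (N : ℕ) (l l' : List (ℝ≥0 × Set ℝ)), l.length + l'.length ≤ N →
    (∀ p ∈ l, MeasurableSet p.2) → (∀ p ∈ l', MeasurableSet p.2) →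
    ∃ k, (∀ p ∈ k, MeasurableSet p.2) ∧ cyl k = cyl l ∩ cyl l'
  | _, [], l', _, _, h' => ⟨l', h', by simp [cyl]⟩
  | _, l, [], _, h, _ => ⟨l, h, by simp [cyl]⟩
  | 0, _ :: _, _ :: _, hN, _, _ => by simp at hN
  | N + 1, (t, A) :: l, (t', A') :: l', hN, h, h' => by
    simp only [List.length_cons] at hN
    rcases le_total t t' with htt | htt
    · obtain ⟨k, hk, he⟩ := exists_cyl_eq_inter N l ((t' - t, A') :: l')
        (by simp only [List.length_cons]; omega) (fun p hp => h p (by simp [hp]))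
        (fun p hp => by
          rcases List.mem_cons.1 hp with rfl | hp
          · exact h' (t', A') (by simp)
          · exact h' p (by simp [hp]))
      refine ⟨(t, A) :: k, fun p hp => ?_, ?_⟩
      · rcases List.mem_cons.1 hp with rfl | hp
        · exact h (t, A) (by simp)
        · exact hk p hp
      · ext w
        rw [mem_inter_iff, mem_cyl_shift htt A' l' w]
        simp only [cyl, mem_ofPred_eq, he, mem_inter_iff]
        tauto
    · obtain ⟨k, hk, he⟩ := exists_cyl_eq_inter N ((t - t', A) :: l) l'
        (by simp only [List.length_cons]; omega)
        (fun p hp => by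
          rcases List.mem_cons.1 hp with rfl | hp
          · exact h (t, A) (by simp)
          · exact h p (by simp [hp])) (fun p hp => h' p (by simp [hp]))
      refine ⟨(t', A') :: k, fun p hp => ?_, ?_⟩
      · rcases List.mem_cons.1 hp with rfl | hp
        · exact h' (t', A') (by simp)
        · exact hk p hp
      · ext w
        rw [mem_inter_iff, mem_cyl_shift htt A l w]
        simp only [cyl, mem_ofPred_eq, he, mem_inter_iff]
        tauto

theorem isPiSystem_cylSets : IsPiSystem cylSets := by
  rintro _ ⟨l, hl, rfl⟩ _ ⟨l', hl', rfl⟩ _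
  exact exists_cyl_eq_inter _ l l' le_rfl hl hl'

/-- Cylinder sets test real values only; the event `w t = ⊤` is recovered as the complement of `w t
∈ ℝ`. -/
theorem generateFrom_cylSets :
    (Subtype.instMeasurableSpace : MeasurableSpace (RCPath (WithTop ℝ))) =
      MeasurableSpace.generateFrom cylSets := by
  refine le_antisymm ?_ (MeasurableSpace.generateFrom_le ?_)
  · have hset : ∀ (t : ℝ≥0) (A : Set ℝ), MeasurableSet A →
        MeasurableSet[MeasurableSpace.generateFrom cylSets]
          {w : RCPath (WithTop ℝ) | w.1 t ∈ ((↑) : ℝ → WithTop ℝ) '' A} := fun t A hA =>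
      MeasurableSpace.measurableSet_generateFrom ⟨[(t, A)], by simpa using hA, by simp [cyl]⟩
    have hev : ∀ t, Measurable[MeasurableSpace.generateFrom cylSets]
        fun w : RCPath (WithTop ℝ) => w.1 t := by
      intro t B hB
      have hpre : MeasurableSet (((↑) : ℝ → WithTop ℝ) ⁻¹' B) :=
        WithTop.isOpenEmbedding_some.continuous.measurable hB
      by_cases htop : ⊤ ∈ B
      · have : (fun w : RCPath (WithTop ℝ) => w.1 t) ⁻¹' B =
            {w | w.1 t ∈ ((↑) : ℝ → WithTop ℝ) '' (((↑) : ℝ → WithTop ℝ) ⁻¹' B)} ∪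
              {w | w.1 t ∈ ((↑) : ℝ → WithTop ℝ) '' univ}ᶜ := by
          ext w
          simp only [mem_preimage, mem_union, mem_ofPred_eq, mem_compl_iff]
          generalize w.1 t = y
          cases y <;> simp [htop]
        rw [this]
        exact (hset _ _ hpre).union (hset _ _ MeasurableSet.univ).compl
      · have : (fun w : RCPath (WithTop ℝ) => w.1 t) ⁻¹' B =
            {w | w.1 t ∈ ((↑) : ℝ → WithTop ℝ) '' (((↑) : ℝ → WithTop ℝ) ⁻¹' B)} := by
          ext w
          simp only [mem_preimage, mem_ofPred_eq]
          generalize w.1 t = y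
          cases y <;> simp [htop]
        rw [this]
        exact hset _ _ hpre
    have hval : Measurable[MeasurableSpace.generateFrom cylSets]
        (Subtype.val : RCPath (WithTop ℝ) → ℝ≥0 → WithTop ℝ) :=
      @measurable_pi_lambda _ _ _ (_) _ _ hev
    exact hval.comap_le
  · rintro _ ⟨l, hl, rfl⟩
    exact measurableSet_cyl hl

/-! ### Excursions as right-continuous paths -/

/-- An excursion as a right-continuous path. -/
def toPath (e : Excursion) : RCPath (WithTop ℝ) := ⟨e.1, fun t => (e.2.1 t).1⟩

@[simp] theorem toPath_apply (e : Excursion) (t : ℝ≥0) : (toPath e).1 t = e.1 t := rfl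

theorem measurable_toPath : Measurable toPath := measurable_subtype_coe.subtype_mk

theorem measurable_excursion_eval (t : ℝ≥0) : Measurable fun e : Excursion => e.1 t :=
  (measurable_pi_apply t).comp measurable_subtype_coe

/-- Positivity of `s` matters: the lifetime ignores time `0`, at which an excursion may sit at `+∞`.
-/
theorem lt_lifetime_iff {e : Excursion} {s : ℝ≥0} (hs : 0 < s) :
    (s : ℝ≥0∞) < lifetime e.1 ↔ e.1 s ≠ ⊤ := by
  constructor
  · intro h htop
    exact absurd h (not_lt.2 (iInf₂_le (f := fun (t : ℝ≥0) (_ : t ∈ {t : ℝ≥0 | 0 < t ∧ e.1 t = ⊤}) =>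
      (t : ℝ≥0∞)) s ⟨hs, htop⟩))
  · intro h
    by_contra hlt
    exact h (e.2.2 s (not_lt.1 hlt))

/-- An excursion stays at `+∞`. -/
theorem eq_top_of_le {e : Excursion} {s t : ℝ≥0} (hs : 0 < s) (hst : s ≤ t) (h : e.1 s = ⊤) :
    e.1 t = ⊤ := by
  refine e.2.2 t (le_trans ?_ (show (s : ℝ≥0∞) ≤ t by exact_mod_cast hst))
  by_contra hlt
  exact (lt_lifetime_iff hs).1 (not_le.1 hlt) h

theorem exists_ne_top {e : Excursion} (h : 0 < lifetime e.1) :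
    ∃ b : ℝ≥0, 0 < b ∧ ∀ s, 0 < s → s < b → e.1 s ≠ ⊤ := by
  obtain ⟨b, hb, hbl⟩ := ENNReal.lt_iff_exists_nnreal_btwn.1 h
  refine ⟨b, by exact_mod_cast hb, fun s hs hsb => (lt_lifetime_iff hs).1 ?_⟩
  exact lt_trans (by exact_mod_cast hsb) hbl

theorem measurable_past {s u : ℝ≥0} (h : u ≤ s) : Measurable[past s] fun e : Excursion => e.1 u := by
  have : MeasurableSpace.comap (fun w : Excursion => w.1 u) inferInstance ≤ past s :=
    le_iSup₂_of_le u h le_rfl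
  exact (comap_measurable _).mono this le_rfl

theorem past_mono {s t : ℝ≥0} (h : s ≤ t) : past s ≤ past t :=
  iSup₂_le fun u hu => le_iSup₂_of_le u (le_trans hu h) le_rfl

theorem past_le (s : ℝ≥0) : past s ≤ (inferInstance : MeasurableSpace Excursion) :=
  iSup₂_le fun u _ => (measurable_excursion_eval u).comap_le

/-- The mean occupation measure as an image measure. -/
theorem meanOccupation_eq_map (n : Measure Excursion) [SFinite n] :
    meanOccupation n = ((n.prod timeMeasure).restrict {p | p.1.1 p.2 ≠ ⊤}).map
      fun p => (p.1.1 p.2).untopD 0 := by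
  have hm : Measurable fun p : Excursion × ℝ≥0 => (p.1.1 p.2).untopD 0 :=
    measurable_untopD.comp measurable_eval
  have hT : MeasurableSet {p : Excursion × ℝ≥0 | p.1.1 p.2 ≠ ⊤} :=
    measurable_eval (measurableSet_singleton _).compl
  ext A hA
  rw [meanOccupation_apply n hA, Measure.map_apply hm hA, Measure.restrict_apply (hm hA),
    Measure.prod_apply ((hm hA).inter hT)]
  refine lintegral_congr fun e => ?_
  rw [occupationTime, occupationSet_eq]
  congr 1
  ext s
  simp only [mem_preimage, mem_inter_iff, mem_ofPred_eq]
  generalize e.1 s = y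
  cases y <;> simp

theorem lintegral_meanOccupation (n : Measure Excursion) [SFinite n] {φ : ℝ → ℝ≥0∞}
    (hφ : Measurable φ) :
    ∫⁻ y, φ y ∂meanOccupation n =
      ∫⁻ e, ∫⁻ s in {s | e.1 s ≠ ⊤}, φ ((e.1 s).untopD 0) ∂timeMeasure ∂n := by
  have hm : Measurable fun p : Excursion × ℝ≥0 => (p.1.1 p.2).untopD 0 :=
    measurable_untopD.comp measurable_eval
  have hT : MeasurableSet {p : Excursion × ℝ≥0 | p.1.1 p.2 ≠ ⊤} :=
    measurable_eval (measurableSet_singleton _).compl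
  have hφm : Measurable fun p : Excursion × ℝ≥0 => φ ((p.1.1 p.2).untopD 0) := hφ.comp hm
  rw [meanOccupation_eq_map, lintegral_map hφ hm, ← lintegral_indicator hT,
    lintegral_prod _ (hφm.indicator hT).aemeasurable]
  refine lintegral_congr fun e => ?_
  have hT' : MeasurableSet {s | e.1 s ≠ ⊤} :=
    (measurable_path (toPath e)) (measurableSet_singleton _).compl
  rw [← lintegral_indicator hT']
  rfl

/-! ### The Markov property for path functionals -/

section Markov

variable {Ω : Type*} [MeasurableSpace Ω] {P : Measure Ω} [IsProbabilityMeasure P]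
  {Y : Ω → RCPath ℝ} {R : ℝ → ℝ} {n : Measure Excursion}

theorem measurableSet_past_ne_top {s u : ℝ≥0} (h : u ≤ s) :
    MeasurableSet[past s] {e : Excursion | e.1 u ≠ ⊤} :=
  measurable_past h (measurableSet_singleton _).compl

/-- The Markov property of an excursion measure, in terms of the laws of the time-changed
process. -/
theorem IsExcursionMeasure.markov_pathLaw {ξ : ℝ≥0 → Ω → ℝ} (hn : IsExcursionMeasure R ξ P n)
    (hR : Measurable R) (hY : Measurable Y) (h : ∀ᵐ ω ∂P, ∀ t, (Y ω).1 t = ξ t ω) {s t : ℝ≥0}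
    (hs : 0 < s) (ht : 0 < t) {Λ : Set Excursion} (hΛ : MeasurableSet[past s] Λ) {A : Set ℝ}
    (hA : MeasurableSet A) :
    n (Λ ∩ {e | e.1 (s + t) ∈ ((↑) : ℝ → WithTop ℝ) '' A}) =
      ∫⁻ e in Λ ∩ {e | e.1 s ≠ ⊤}, pathLaw R Y P ((e.1 s).untopD 0)
        {w | w.1 t ∈ ((↑) : ℝ → WithTop ℝ) '' A} ∂n := by
  have := hn.markov s t hs ht Λ hΛ A hA
  simp only [transition_eq_pathLaw hR hY h _ _ hA, lt_lifetime_iff hs] at this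
  rw [← this]
  congr 2
  ext e
  simp only [mem_ofPred_eq]
  constructor
  · rintro ⟨y, hy, he⟩
    exact ⟨(lt_lifetime_iff (by positivity)).2 (by rw [← he]; simp), y, hy, he.symm⟩
  · rintro ⟨-, y, hy, he⟩
    exact ⟨y, hy, he.symm⟩

/-- The Markov property in terms of path laws. -/
def HasPathMarkov (κ : Kernel ℝ (RCPath (WithTop ℝ))) (n : Measure Excursion) : Prop :=
  ∀ ⦃s t : ℝ≥0⦄, 0 < s → 0 < t → ∀ ⦃Λ : Set Excursion⦄, MeasurableSet[past s] Λ →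
    ∀ ⦃A : Set ℝ⦄, MeasurableSet A →
    n (Λ ∩ {e | e.1 (s + t) ∈ ((↑) : ℝ → WithTop ℝ) '' A}) =
      ∫⁻ e in Λ ∩ {e | e.1 s ≠ ⊤}, κ ((e.1 s).untopD 0)
        {w | w.1 t ∈ ((↑) : ℝ → WithTop ℝ) '' A} ∂n

theorem measurable_untopD_eval (t : ℝ≥0) : Measurable fun e : Excursion => (e.1 t).untopD 0 :=
  measurable_untopD.comp (measurable_excursion_eval t)

theorem measurable_untopD_path (t : ℝ≥0) :
    Measurable fun w : RCPath (WithTop ℝ) => (w.1 t).untopD 0 :=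
  measurable_untopD.comp (measurable_eval_const t)

theorem measurableSet_path_ne_top (t : ℝ≥0) :
    MeasurableSet {w : RCPath (WithTop ℝ) | w.1 t ≠ ⊤} :=
  measurable_eval_const t (measurableSet_singleton _).compl

theorem mem_coe_image_iff {y : WithTop ℝ} {A : Set ℝ} :
    y ∈ ((↑) : ℝ → WithTop ℝ) '' A ↔ y ≠ ⊤ ∧ y.untopD 0 ∈ A := by
  cases y <;> simp

theorem HasPathMarkov.lintegral {κ : Kernel ℝ (RCPath (WithTop ℝ))} [IsMarkovKernel κ]
    (h : HasPathMarkov κ n) {s t : ℝ≥0}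
    (hs : 0 < s) (ht : 0 < t) {Λ : Set Excursion} (hΛ : MeasurableSet[past s] Λ) {φ : ℝ → ℝ≥0∞}
    (hφ : Measurable φ) :
    ∫⁻ e in Λ ∩ {e | e.1 (s + t) ≠ ⊤}, φ ((e.1 (s + t)).untopD 0) ∂n =
      ∫⁻ e in Λ ∩ {e | e.1 s ≠ ⊤}, ∫⁻ w in {w | w.1 t ≠ ⊤}, φ ((w.1 t).untopD 0)
        ∂κ ((e.1 s).untopD 0) ∂n := by
  set k : Kernel ℝ ℝ := (κ.restrict (measurableSet_path_ne_top t)).map fun w => (w.1 t).untopD 0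
  have hk : ∀ y, k y = ((κ y).restrict {w | w.1 t ≠ ⊤}).map fun w => (w.1 t).untopD 0 := fun y => by
    rw [Kernel.map_apply _ (measurable_untopD_path t), Kernel.restrict_apply]
  have heq : (n.restrict (Λ ∩ {e | e.1 (s + t) ≠ ⊤})).map (fun e => (e.1 (s + t)).untopD 0) =
      ((n.restrict (Λ ∩ {e | e.1 s ≠ ⊤})).map fun e => (e.1 s).untopD 0).bind k := by
    ext A hA
    rw [Measure.map_apply (measurable_untopD_eval _) hA,
      Measure.restrict_apply (measurable_untopD_eval _ hA), Measure.bind_apply hA k.aemeasurable,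
      lintegral_map (k.measurable_coe hA) (measurable_untopD_eval _)]
    have h1 := h hs ht hΛ hA
    convert h1 using 2
    · ext e
      simp only [mem_inter_iff, mem_preimage, mem_ofPred_eq, mem_coe_image_iff]
      tauto
    · ext e
      rw [hk, Measure.map_apply (measurable_untopD_path _) hA,
        Measure.restrict_apply (measurable_untopD_path _ hA)]
      congr 1
      ext w
      simp only [mem_inter_iff, mem_preimage, mem_ofPred_eq, mem_coe_image_iff]
      tauto
  rw [← lintegral_map hφ (measurable_untopD_eval _), heq,
    Measure.lintegral_bind k.aemeasurable hφ.aemeasurable,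
    lintegral_map hφ.lintegral_kernel (measurable_untopD_eval _)]
  refine lintegral_congr fun e => ?_
  rw [hk, lintegral_map hφ (measurable_untopD_path _)]

theorem pathLaw_cyl_zero (hY : IsLevyPath Y P) (hR : Continuous R) (hpos : ∀ x, 0 < R x) (x : ℝ)
    {A : Set ℝ} {l : List (ℝ≥0 × Set ℝ)} (hA : MeasurableSet A)
    (hl : ∀ p ∈ l, MeasurableSet p.2) :
    pathLaw R Y P x (cyl ((0, A) :: l)) = A.indicator (fun x => pathLaw R Y P x (cyl l)) x := by
  have hm : MeasurableSet (cyl ((0, A) :: l)) := measurableSet_cyl fun p hp => by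
    rcases List.mem_cons.1 hp with rfl | hp
    · exact hA
    · exact hl p hp
  rw [pathLaw_apply hR.measurable hY.measurable x hm]
  have : {ω | levyTimeChange R x (Y ω) ∈ cyl ((0, A) :: l)} =
      {ω | x ∈ A ∧ levyTimeChange R x (Y ω) ∈ cyl l} := by
    ext ω
    simp [cyl, levyTimeChange_zero hY hR hpos]
  rw [this]
  by_cases hx : x ∈ A
  · simp [hx, pathLaw_apply hR.measurable hY.measurable x (measurableSet_cyl hl)]
  · simp [hx]

theorem pathLaw_cyl_cons (hY : IsLevyPath Y P) (hR : Continuous R) (hpos : ∀ x, 0 < R x) (x : ℝ)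
    (t : ℝ≥0) {A : Set ℝ} {l : List (ℝ≥0 × Set ℝ)} (hA : MeasurableSet A)
    (hl : ∀ p ∈ l, MeasurableSet p.2) :
    pathLaw R Y P x (cyl ((t, A) :: l)) = ∫⁻ w in {w | w.1 t ≠ ⊤},
      A.indicator (fun y => pathLaw R Y P y (cyl l)) ((w.1 t).untopD 0) ∂pathLaw R Y P x := by
  have hm : MeasurableSet (cyl ((t, A) :: l)) := measurableSet_cyl fun p hp => by
    rcases List.mem_cons.1 hp with rfl | hp
    · exact hA
    · exact hl p hp
  have := hY.markov_pathLaw hR hpos x t (φ := A.indicator 1) (measurable_one.indicator hA)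
    (F := (cyl l).indicator 1) (measurable_one.indicator (measurableSet_cyl hl))
  rw [← lintegral_indicator_one hm]
  simp only [lintegral_indicator_one (measurableSet_cyl hl)] at this
  rw [← lintegral_indicator (measurableSet_path_ne_top t),
    ← lintegral_indicator (measurableSet_path_ne_top t)] at this
  rw [← lintegral_indicator (measurableSet_path_ne_top t)]
  convert this using 3 with w w
  · by_cases h1 : w.1 t = ⊤
    · have : w ∉ cyl ((t, A) :: l) := by
        simp [cyl, h1]
      simp [indicator, h1, this]
    · by_cases h2 : (w.1 t).untopD 0 ∈ A <;> by_cases h3 : shift t w ∈ cyl l <;>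
        simp [indicator, cyl, mem_coe_image_iff, h1, h2, h3, -mem_image]
  · by_cases h1 : w.1 t = ⊤ <;> by_cases h2 : (w.1 t).untopD 0 ∈ A <;> simp [indicator, h1, h2]

/-- Induction on the list, with `s` and `Λ` free: the first condition is absorbed into `Λ` and the
time advances to `s + t`. A gap of length `0` is treated apart because `HasPathMarkov` concerns `t >
0`. -/
theorem HasPathMarkov.measure_cyl (h : HasPathMarkov (pathLaw R Y P) n) (hY : IsLevyPath Y P)
    (hR : Continuous R) (hpos : ∀ x, 0 < R x) :
    ∀ {l : List (ℝ≥0 × Set ℝ)}, (∀ p ∈ l, MeasurableSet p.2) → ∀ {s : ℝ≥0}, 0 < s →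
    ∀ {Λ : Set Excursion}, MeasurableSet[past s] Λ →
    n (Λ ∩ {e | e.1 s ≠ ⊤} ∩ {e | shift s (toPath e) ∈ cyl l}) =
      ∫⁻ e in Λ ∩ {e | e.1 s ≠ ⊤}, pathLaw R Y P ((e.1 s).untopD 0) (cyl l) ∂n := by
  have := isMarkovKernel_pathLaw (P := P) hR.measurable hY.measurable
  intro l
  induction l with
  | nil =>
    intro _ s _ Λ _
    simp [TimeChangedLevy.cyl]
  | cons p l ih =>
    obtain ⟨t, A⟩ := p
    intro hl s hs Λ hΛ
    have hA : MeasurableSet A := hl (t, A) (by simp)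
    have hl' : ∀ p ∈ l, MeasurableSet p.2 := fun p hp => hl p (by simp [hp])
    have hφ : Measurable fun y => pathLaw R Y P y (TimeChangedLevy.cyl l) :=
      Kernel.measurable_coe _ (measurableSet_cyl hl')
    have hAset : ∀ u, MeasurableSet[past u]
        {e : Excursion | e.1 u ∈ ((↑) : ℝ → WithTop ℝ) '' A} := fun u =>
      measurable_past le_rfl (measurableSet_coe_image hA)
    have hAset' : ∀ u, MeasurableSet {e : Excursion | e.1 u ∈ ((↑) : ℝ → WithTop ℝ) '' A} :=
      fun u => past_le u _ (hAset u)
    rcases eq_zero_or_pos t with rfl | ht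
    · have hI := ih hl' hs (MeasurableSet.inter hΛ (hAset s))
      have e1 : Λ ∩ {e | e.1 s ≠ ⊤} ∩ {e | shift s (toPath e) ∈
          TimeChangedLevy.cyl ((0, A) :: l)} = Λ ∩ {e | e.1 s ∈ ((↑) : ℝ → WithTop ℝ) '' A} ∩
          {e | e.1 s ≠ ⊤} ∩ {e | shift s (toPath e) ∈ TimeChangedLevy.cyl l} := by
        ext e
        simp only [TimeChangedLevy.cyl, mem_inter_iff, mem_ofPred_eq, shift_apply, add_zero,
          shift_zero, toPath_apply]
        tauto
      rw [e1, hI]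
      have e2 : Λ ∩ {e | e.1 s ∈ ((↑) : ℝ → WithTop ℝ) '' A} ∩ {e | e.1 s ≠ ⊤} =
          {e | e.1 s ∈ ((↑) : ℝ → WithTop ℝ) '' A} ∩ (Λ ∩ {e | e.1 s ≠ ⊤}) := by
        ext e
        simp only [mem_inter_iff]
        tauto
      rw [e2, ← Measure.restrict_restrict (hAset' s), ← lintegral_indicator (hAset' s)]
      refine setLIntegral_congr_fun ((past_le s _ hΛ).inter
        (past_le s _ (measurableSet_past_ne_top le_rfl))) fun e he => ?_
      have he2 : e.1 s ≠ ⊤ := he.2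
      simp only [pathLaw_cyl_zero hY hR hpos _ hA hl']
      by_cases h2 : (e.1 s).untopD 0 ∈ A <;>
        simp [indicator, mem_coe_image_iff, he2, h2, -mem_image]
    · have hΛ' : MeasurableSet[past (s + t)] (Λ ∩ {e | e.1 s ≠ ⊤} ∩
          {e | e.1 (s + t) ∈ ((↑) : ℝ → WithTop ℝ) '' A}) :=
        (MeasurableSet.inter (past_mono (by simp) _ hΛ)
          (measurableSet_past_ne_top (by simp))).inter (hAset _)
      have hI := ih hl' (s := s + t) (by positivity) hΛ'
      have e1 : Λ ∩ {e | e.1 s ≠ ⊤} ∩ {e | shift s (toPath e) ∈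
          TimeChangedLevy.cyl ((t, A) :: l)} = Λ ∩ {e | e.1 s ≠ ⊤} ∩
          {e | e.1 (s + t) ∈ ((↑) : ℝ → WithTop ℝ) '' A} ∩ {e | e.1 (s + t) ≠ ⊤} ∩
          {e | shift (s + t) (toPath e) ∈ TimeChangedLevy.cyl l} := by
        ext e
        simp only [TimeChangedLevy.cyl, mem_inter_iff, mem_ofPred_eq, shift_apply, shift_shift,
          toPath_apply, mem_coe_image_iff]
        tauto
      rw [e1, hI]
      have hM := h.lintegral hs ht (MeasurableSet.inter hΛ
        (measurableSet_past_ne_top (le_refl s))) (hφ.indicator hA)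
      have e3 : Λ ∩ {e | e.1 s ≠ ⊤} ∩ {e | e.1 s ≠ ⊤} = Λ ∩ {e | e.1 s ≠ ⊤} := by
        rw [inter_assoc, inter_self]
      rw [e3] at hM
      simp only [pathLaw_cyl_cons hY hR hpos _ t hA hl']
      rw [← hM]
      have e2 : Λ ∩ {e | e.1 s ≠ ⊤} ∩ {e | e.1 (s + t) ∈ ((↑) : ℝ → WithTop ℝ) '' A} ∩
          {e | e.1 (s + t) ≠ ⊤} = {e | e.1 (s + t) ∈ ((↑) : ℝ → WithTop ℝ) '' A} ∩
          (Λ ∩ {e | e.1 s ≠ ⊤} ∩ {e | e.1 (s + t) ≠ ⊤}) := by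
        ext e
        simp only [mem_inter_iff]
        tauto
      rw [e2, ← Measure.restrict_restrict (hAset' _), ← lintegral_indicator (hAset' _)]
      refine setLIntegral_congr_fun (((past_le s _ hΛ).inter
        (past_le s _ (measurableSet_past_ne_top le_rfl))).inter
        (past_le (s + t) _ (measurableSet_past_ne_top le_rfl))) fun e he => ?_
      have he2 : e.1 (s + t) ≠ ⊤ := he.2
      by_cases h2 : (e.1 (s + t)).untopD 0 ∈ A <;>
        simp [indicator, mem_coe_image_iff, he2, h2, -mem_image]

end Markov

/-! ### Time integrals of path functionals -/

/-- The image of `μ(dw) ds` on `{w_s ≠ ∞}` under `(w, s) ↦ w_{s + ·}`. -/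
def shiftMeasure (μ : Measure (RCPath (WithTop ℝ))) : Measure (RCPath (WithTop ℝ)) :=
  ((μ.prod timeMeasure).restrict {p | p.1.1 p.2 ≠ ⊤}).map fun p => shift p.2 p.1

theorem measurable_shift_prod :
    Measurable fun p : RCPath (WithTop ℝ) × ℝ≥0 => shift p.2 p.1 :=
  measurable_shift measurable_fst measurable_snd

theorem measurableSet_prod_ne_top :
    MeasurableSet {p : RCPath (WithTop ℝ) × ℝ≥0 | p.1.1 p.2 ≠ ⊤} :=
  RCPath.measurable_eval (measurableSet_singleton _).compl

theorem measurableSet_time_ne_top (w : RCPath (WithTop ℝ)) : MeasurableSet {s | w.1 s ≠ ⊤} :=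
  (measurable_path w) (measurableSet_singleton _).compl

theorem lintegral_shiftMeasure (μ : Measure (RCPath (WithTop ℝ))) [SFinite μ]
    {F : RCPath (WithTop ℝ) → ℝ≥0∞} (hF : Measurable F) :
    ∫⁻ w, F w ∂shiftMeasure μ =
      ∫⁻ w, ∫⁻ s in {s | w.1 s ≠ ⊤}, F (shift s w) ∂timeMeasure ∂μ := by
  have hFm : Measurable fun p : RCPath (WithTop ℝ) × ℝ≥0 => F (shift p.2 p.1) :=
    hF.comp measurable_shift_prod
  rw [shiftMeasure, lintegral_map hF measurable_shift_prod,
    ← lintegral_indicator measurableSet_prod_ne_top,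
    lintegral_prod _ (hFm.indicator measurableSet_prod_ne_top).aemeasurable]
  refine lintegral_congr fun w => ?_
  rw [← lintegral_indicator (measurableSet_time_ne_top w)]
  rfl

theorem measurable_lintegral_shift {F : RCPath (WithTop ℝ) → ℝ≥0∞} (hF : Measurable F) :
    Measurable fun w : RCPath (WithTop ℝ) =>
      ∫⁻ s in {s | w.1 s ≠ ⊤}, F (shift s w) ∂timeMeasure := by
  have hFm : Measurable fun p : RCPath (WithTop ℝ) × ℝ≥0 => F (shift p.2 p.1) :=
    hF.comp measurable_shift_prod
  have := (hFm.indicator measurableSet_prod_ne_top).lintegral_prod_right' (ν := timeMeasure)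
  convert this using 2 with w
  rw [← lintegral_indicator (measurableSet_time_ne_top w)]
  rfl

theorem measurableSet_start_mem {A : Set ℝ} (hA : MeasurableSet A) :
    MeasurableSet {w : RCPath (WithTop ℝ) | w.1 0 ∈ ((↑) : ℝ → WithTop ℝ) '' A} :=
  measurableSet_eval_mem 0 hA

section Identity

variable {Ω : Type*} [MeasurableSpace Ω] {P : Measure Ω} [IsProbabilityMeasure P]
  {Y : Ω → RCPath ℝ} {R : ℝ → ℝ} {n : Measure Excursion}

/-- Fubini brings the time integral outside, and `measure_cyl` applies for each `s > 0`; the time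
`0` is negligible. -/
theorem HasPathMarkov.shiftMeasure_cyl [SFinite n] (h : HasPathMarkov (pathLaw R Y P) n)
    (hY : IsLevyPath Y P) (hR : Continuous R) (hpos : ∀ x, 0 < R x) {l : List (ℝ≥0 × Set ℝ)}
    (hl : ∀ p ∈ l, MeasurableSet p.2) :
    shiftMeasure (n.map toPath) (cyl l) =
      (meanOccupation n).bind (pathLaw R Y P) (cyl l) := by
  have hC := measurableSet_cyl hl
  have hφ : Measurable fun y => pathLaw R Y P y (cyl l) := Kernel.measurable_coe _ hC
  rw [Measure.bind_apply hC (Kernel.aemeasurable _), lintegral_meanOccupation n hφ,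
    ← lintegral_indicator_one hC, lintegral_shiftMeasure _ (measurable_one.indicator hC),
    lintegral_map (measurable_lintegral_shift (measurable_one.indicator hC)) measurable_toPath]
  simp only [← lintegral_indicator (measurableSet_time_ne_top (toPath _))]
  have hT : ∀ e : Excursion, MeasurableSet {s | e.1 s ≠ ⊤} := fun e =>
    measurableSet_time_ne_top (toPath e)
  simp only [← lintegral_indicator (hT _)]
  have hprod : MeasurableSet {p : Excursion × ℝ≥0 | p.1.1 p.2 ≠ ⊤} :=
    measurable_eval (measurableSet_singleton _).compl
  have m1 : Measurable fun p : Excursion × ℝ≥0 => {s | (toPath p.1).1 s ≠ ⊤}.indicator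
      (fun s => (cyl l).indicator (1 : RCPath (WithTop ℝ) → ℝ≥0∞) (shift s (toPath p.1))) p.2 := by
    have : Measurable fun p : Excursion × ℝ≥0 =>
        (cyl l).indicator (1 : RCPath (WithTop ℝ) → ℝ≥0∞) (shift p.2 (toPath p.1)) :=
      (measurable_one.indicator hC).comp
        (measurable_shift (measurable_toPath.comp measurable_fst) measurable_snd)
    exact this.indicator hprod
  have m2 : Measurable fun p : Excursion × ℝ≥0 => {s | p.1.1 s ≠ ⊤}.indicator
      (fun s => pathLaw R Y P ((p.1.1 s).untopD 0) (cyl l)) p.2 := by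
    have : Measurable fun p : Excursion × ℝ≥0 => pathLaw R Y P ((p.1.1 p.2).untopD 0) (cyl l) :=
      hφ.comp (measurable_untopD.comp measurable_eval)
    exact this.indicator hprod
  have h1 := lintegral_lintegral_swap (f := fun (e : Excursion) s =>
    {s | (toPath e).1 s ≠ ⊤}.indicator
      (fun s => (cyl l).indicator (1 : RCPath (WithTop ℝ) → ℝ≥0∞) (shift s (toPath e))) s)
    (μ := n) (ν := timeMeasure) m1.aemeasurable
  have h2 := lintegral_lintegral_swap (f := fun (e : Excursion) s => {s | e.1 s ≠ ⊤}.indicator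
    (fun s => pathLaw R Y P ((e.1 s).untopD 0) (cyl l)) s)
    (μ := n) (ν := timeMeasure) m2.aemeasurable
  refine h1.trans (Eq.trans ?_ h2.symm)
  have hne : ∀ᵐ s ∂timeMeasure, s ≠ 0 := by
    rw [ae_iff]
    simp
  refine lintegral_congr_ae ?_
  filter_upwards [hne] with s hs
  have hs : 0 < s := pos_iff_ne_zero.2 hs
  have key := h.measure_cyl hY hR hpos hl hs (Λ := univ) MeasurableSet.univ
  simp only [univ_inter] at key
  have hset : MeasurableSet {e : Excursion | e.1 s ≠ ⊤} :=
    measurable_excursion_eval s (measurableSet_singleton _).compl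
  have hset' : MeasurableSet {e : Excursion | shift s (toPath e) ∈ cyl l} :=
    measurable_shift measurable_toPath measurable_const hC
  rw [← lintegral_indicator hset, ← lintegral_indicator_one (hset.inter hset')] at key
  refine Eq.trans (lintegral_congr fun e => ?_) key
  by_cases h1 : e.1 s = ⊤ <;> by_cases h2 : shift s (toPath e) ∈ cyl l <;>
    simp [indicator, h1, h2]

/-- The measure `n(∫₀^ζ 1(e_{s + ·} ∈ ·) ds)` is determined by the mean occupation measure. -/
theorem HasPathMarkov.shiftMeasure_eq [SFinite n] [SigmaFinite (meanOccupation n)]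
    (h : HasPathMarkov (pathLaw R Y P) n) (hY : IsLevyPath Y P) (hR : Continuous R)
    (hpos : ∀ x, 0 < R x) :
    shiftMeasure (n.map toPath) = (meanOccupation n).bind (pathLaw R Y P) := by
  have hmk := isMarkovKernel_pathLaw (P := P) hR.measurable hY.measurable
  set m := meanOccupation n
  set Q₁ := shiftMeasure (n.map toPath)
  set Q₂ := m.bind (pathLaw R Y P)
  -- Both measures may be infinite. Restricting the starting point to sets exhausting `m` makes them
  -- finite, and such a restriction only adds a cylinder condition at time `0`.
  set C : Set ℝ → Set (RCPath (WithTop ℝ)) :=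
    fun A => {w | w.1 0 ∈ ((↑) : ℝ → WithTop ℝ) '' A} with hCdef
  have hC : ∀ A, MeasurableSet A → MeasurableSet (C A) := fun A hA => measurableSet_start_mem hA
  have hCcyl : ∀ A, C A = cyl [(0, A)] := fun A => by simp [hCdef, cyl]
  have hCinter : ∀ A l, cyl l ∩ C A = cyl ((0, A) :: l) := fun A l => by
    ext w
    simp only [hCdef, cyl, mem_inter_iff, mem_ofPred_eq, shift_zero]
    tauto
  have hQ : ∀ l : List (ℝ≥0 × Set ℝ), (∀ p ∈ l, MeasurableSet p.2) → Q₁ (cyl l) = Q₂ (cyl l) :=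
    fun l hl => h.shiftMeasure_cyl hY hR hpos hl
  have hQ₂C : ∀ A, MeasurableSet A → Q₂ (C A) = m A := by
    intro A hA
    rw [Measure.bind_apply (hC A hA) (Kernel.aemeasurable _), ← lintegral_indicator_one hA]
    refine lintegral_congr fun x => ?_
    rw [hCcyl, pathLaw_cyl_zero hY hR hpos x hA (by simp)]
    by_cases hx : x ∈ A <;> simp [hx, cyl]
  have hQ₁C : ∀ A, MeasurableSet A → Q₁ (C A) = m A := fun A hA => by
    rw [← hQ₂C A hA, hCcyl]
    exact hQ _ (by simpa using hA)
  have hrestr : ∀ k, Q₁.restrict (C (spanningSets m k)) = Q₂.restrict (C (spanningSets m k)) := by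
    intro k
    have hS := measurableSet_spanningSets m k
    have hfin : m (spanningSets m k) < ∞ := measure_spanningSets_lt_top m k
    have : IsFiniteMeasure (Q₁.restrict (C (spanningSets m k))) :=
      ⟨by rwa [Measure.restrict_apply_univ, hQ₁C _ hS]⟩
    have : IsFiniteMeasure (Q₂.restrict (C (spanningSets m k))) :=
      ⟨by rwa [Measure.restrict_apply_univ, hQ₂C _ hS]⟩
    refine ext_of_generate_finite cylSets generateFrom_cylSets isPiSystem_cylSets ?_ ?_
    · rintro _ ⟨l, hl, rfl⟩
      rw [Measure.restrict_apply (measurableSet_cyl hl), Measure.restrict_apply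
        (measurableSet_cyl hl), hCinter]
      refine hQ _ fun p hp => ?_
      rcases List.mem_cons.1 hp with rfl | hp
      · exact hS
      · exact hl p hp
    · rw [Measure.restrict_apply_univ, Measure.restrict_apply_univ, hQ₁C _ hS, hQ₂C _ hS]
  have hU : (⋃ k, C (spanningSets m k)) = C univ := by
    ext w
    simp only [mem_iUnion, hCdef, mem_ofPred_eq, mem_coe_image_iff, mem_univ, and_true]
    constructor
    · rintro ⟨k, hk, -⟩
      exact hk
    · intro hw
      have : (w.1 0).untopD 0 ∈ ⋃ k, spanningSets m k := by
        rw [iUnion_spanningSets]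
        trivial
      obtain ⟨k, hk⟩ := mem_iUnion.1 this
      exact ⟨k, hw, hk⟩
  have hall := Measure.restrict_iUnion_congr.2 hrestr
  rw [hU] at hall
  -- Neither measure charges paths started at `⊤`: the first integrates only over times with `w s ≠
  -- ⊤`, and in the second the process starts from a real point.
  have hfull₁ : ∀ᵐ w ∂Q₁, w ∈ C univ := by
    rw [ae_iff, ← compl_ofPred, show {w | w ∈ C univ} = C univ from rfl,
      ← lintegral_indicator_one (hC _ MeasurableSet.univ).compl,
      lintegral_shiftMeasure _ (measurable_one.indicator (hC _ MeasurableSet.univ).compl)]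
    refine (lintegral_congr fun w => ?_).trans lintegral_zero
    refine (setLIntegral_congr_fun (measurableSet_time_ne_top w) fun s hs => ?_).trans
      (lintegral_zero)
    have hs' : w.1 s ≠ ⊤ := hs
    simp [hCdef, indicator, mem_coe_image_iff, hs', -mem_image]
  have hfull₂ : ∀ᵐ w ∂Q₂, w ∈ C univ := by
    rw [ae_iff, ← compl_ofPred, show {w | w ∈ C univ} = C univ from rfl,
      Measure.bind_apply (hC _ MeasurableSet.univ).compl (Kernel.aemeasurable _)]
    refine (lintegral_congr fun x => ?_).trans lintegral_zero
    rw [prob_compl_eq_zero_iff (hC _ MeasurableSet.univ), hCcyl,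
      pathLaw_cyl_zero hY hR hpos x MeasurableSet.univ (by simp)]
    simp [cyl]
  rw [← Measure.restrict_eq_self_of_ae_mem hfull₁, hall, Measure.restrict_eq_self_of_ae_mem hfull₂]

theorem HasPathMarkov.lintegral_shift [SFinite n] [SigmaFinite (meanOccupation n)]
    (h : HasPathMarkov (pathLaw R Y P) n) (hY : IsLevyPath Y P) (hR : Continuous R)
    (hpos : ∀ x, 0 < R x) {F : RCPath (WithTop ℝ) → ℝ≥0∞} (hF : Measurable F) :
    ∫⁻ e, ∫⁻ s in {s | e.1 s ≠ ⊤}, F (shift s (toPath e)) ∂timeMeasure ∂n =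
      ∫⁻ x, ∫⁻ w, F w ∂pathLaw R Y P x ∂meanOccupation n := by
  have := congrArg (fun μ => ∫⁻ w, F w ∂μ) (h.shiftMeasure_eq hY hR hpos)
  rw [lintegral_shiftMeasure _ hF, lintegral_map (measurable_lintegral_shift hF) measurable_toPath,
    Measure.lintegral_bind (Kernel.aemeasurable _) hF.aemeasurable] at this
  exact this

end Identity

/-! ### Kac's formula -/

/-- The function `u ↦ e^{-u}`, with values in `[0, ∞]`. -/
def expNeg (u : ℝ≥0∞) : ℝ≥0∞ := ENNReal.ofReal (Real.exp (-u.toReal))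

theorem measurable_expNeg : Measurable expNeg := by
  unfold expNeg
  fun_prop

theorem lintegral_exp_sub_timeMeasure (T : ℝ≥0) :
    ∫⁻ t in {t : ℝ≥0 | (t : ℝ≥0∞) < T}, ENNReal.ofReal (Real.exp ((t : ℝ) - T)) ∂timeMeasure =
      ENNReal.ofReal (1 - Real.exp (-(T : ℝ))) := by
  have hset : {t : ℝ≥0 | (t : ℝ≥0∞) < T} = ((↑) : ℝ≥0 → ℝ) ⁻¹' (Iio (T : ℝ)) := by
    ext t
    simp
  have hmap : (timeMeasure.restrict {t : ℝ≥0 | (t : ℝ≥0∞) < T}).map ((↑) : ℝ≥0 → ℝ) =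
      volume.restrict (Ioc 0 (T : ℝ)) := by
    rw [hset, ← measurableEmbedding_coe_nnreal.restrict_map, map_coe_timeMeasure,
      Measure.restrict_restrict measurableSet_Iio, inter_comm, Ici_inter_Iio,
      restrict_Ico_eq_restrict_Ioc]
  have hd : ∀ x : ℝ, HasDerivAt (fun x => Real.exp (x - (T : ℝ)))
      (Real.exp (x - (T : ℝ))) x := by
    intro x
    have h1 : HasDerivAt (fun x : ℝ => x - (T : ℝ)) 1 x := (hasDerivAt_id x).sub_const _
    simpa using h1.exp
  have hc : Continuous fun x => Real.exp (x - (T : ℝ)) := by fun_prop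
  have hint := intervalIntegral.integral_eq_sub_of_hasDerivAt (a := 0) (b := (T : ℝ))
    (fun x _ => hd x) (hc.intervalIntegrable _ _)
  rw [intervalIntegral.integral_of_le T.coe_nonneg] at hint
  have hm : Measurable fun x : ℝ => ENNReal.ofReal (Real.exp (x - (T : ℝ))) := by fun_prop
  rw [← lintegral_map (g := ((↑) : ℝ≥0 → ℝ)) hm measurableEmbedding_coe_nnreal.measurable, hmap,
    ← ofReal_integral_eq_lintegral_ofReal, hint]
  · simp
  · exact (hc.integrableOn_Icc).mono_set Ioc_subset_Icc_self
  · exact Eventually.of_forall fun x => (Real.exp_pos _).le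

theorem measurable_lintegral_add {v : ℝ≥0 → ℝ≥0∞} (hv : Measurable v) :
    Measurable fun s => ∫⁻ r, v (s + r) ∂timeMeasure := by
  have : Measurable fun p : ℝ≥0 × ℝ≥0 => v (p.1 + p.2) := hv.comp measurable_add
  exact this.lintegral_prod_right'

/-- Substituting the inverse clock turns the integral into that of `e^{t - T}` over `[0, T)`, where
`T` is the total. Finiteness of `T` is essential, as `expNeg ∞ = 1`. -/
theorem lintegral_mul_expNeg_tail {v : ℝ≥0 → ℝ≥0∞} (hv : Measurable v) (hfin : totalClock v ≠ ∞) :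
    ∫⁻ s, v s * expNeg (∫⁻ r, v (s + r) ∂timeMeasure) ∂timeMeasure =
      ENNReal.ofReal (1 - Real.exp (-(totalClock v).toReal)) := by
  have hclock : ∀ s, clock v s ≠ ∞ := fun s => ne_top_of_le_ne_top hfin (clock_le_totalClock _ _)
  have key := lintegral_clockInv hv (measurable_expNeg.comp (measurable_lintegral_add hv))
    fun s _ => ⟨s + 1, lt_add_one s, hclock _⟩
  have hset : MeasurableSet {t : ℝ≥0 | (t : ℝ≥0∞) < totalClock v} :=
    measurableSet_coe_lt _
  simp only [Function.comp_apply, mul_comm (expNeg _)] at key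
  have hT := lintegral_exp_sub_timeMeasure (totalClock v).toNNReal
  rw [ENNReal.coe_toNNReal hfin] at hT
  rw [← key]
  refine Eq.trans ?_ hT
  refine setLIntegral_congr_fun hset fun t ht => ?_
  have h1 := clock_clockInv_of_finite hclock ht
  have h2 := totalClock_add v (clockInv v t)
  rw [h1] at h2
  have h3 : (∫⁻ r, v (clockInv v t + r) ∂timeMeasure) ≠ ∞ := by
    intro h
    apply hfin
    rw [h2]
    simp only [totalClock, h, add_top]
  have h4 : (totalClock v).toReal = t + (∫⁻ r, v (clockInv v t + r) ∂timeMeasure).toReal := by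
    rw [h2, totalClock, ENNReal.toReal_add ENNReal.coe_ne_top h3]
    rfl
  simp only [expNeg]
  congr 2
  have : ((totalClock v).toNNReal : ℝ) = (totalClock v).toReal := rfl
  rw [this, h4]
  ring

/-- The time integral `∫₀^ζ V(w_{s + ·}) ds`. -/
def pathIntegral (V : RCPath (WithTop ℝ) → ℝ≥0∞) (w : RCPath (WithTop ℝ)) : ℝ≥0∞ :=
  ∫⁻ s in {s | w.1 s ≠ ⊤}, V (shift s w) ∂timeMeasure

theorem measurable_pathIntegral {V : RCPath (WithTop ℝ) → ℝ≥0∞} (hV : Measurable V) :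
    Measurable (pathIntegral V) :=
  measurable_lintegral_shift hV

/-- The part of `∫V` after time `s` is the path integral of `V` along the shifted path, so the
preceding identity becomes one for path functionals. -/
theorem lintegral_expNeg_pathIntegral {V : RCPath (WithTop ℝ) → ℝ≥0∞} (hV : Measurable V)
    {w : RCPath (WithTop ℝ)} (hfin : pathIntegral V w ≠ ∞) :
    pathIntegral (fun w => V w * expNeg (pathIntegral V w)) w =
      ENNReal.ofReal (1 - Real.exp (-(pathIntegral V w).toReal)) := by
  set v : ℝ≥0 → ℝ≥0∞ := {s | w.1 s ≠ ⊤}.indicator fun s => V (shift s w) with hvdef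
  have hVm : Measurable fun s => V (shift s w) :=
    hV.comp (measurable_shift measurable_const measurable_id)
  have hv : Measurable v := hVm.indicator (measurableSet_time_ne_top w)
  have htot : totalClock v = pathIntegral V w :=
    lintegral_indicator (measurableSet_time_ne_top w) _
  have htail : ∀ s, ∫⁻ r, v (s + r) ∂timeMeasure = pathIntegral V (shift s w) := by
    intro s
    rw [pathIntegral, ← lintegral_indicator (measurableSet_time_ne_top _)]
    refine lintegral_congr fun r => ?_
    by_cases hr : w.1 (s + r) = ⊤ <;> simp [hvdef, hr, shift_shift]
  rw [← htot] at hfin ⊢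
  rw [← lintegral_mul_expNeg_tail hv hfin, pathIntegral,
    ← lintegral_indicator (measurableSet_time_ne_top w)]
  refine lintegral_congr fun s => ?_
  rw [htail]
  by_cases hs : w.1 s = ⊤ <;> simp [hvdef, hs]

theorem lintegral_pathIntegral (μ : Measure (RCPath (WithTop ℝ))) [SFinite μ]
    {F : RCPath (WithTop ℝ) → ℝ≥0∞} (hF : Measurable F) :
    ∫⁻ w, pathIntegral F w ∂μ = ∫⁻ w, F w ∂shiftMeasure μ :=
  (lintegral_shiftMeasure μ hF).symm

/-- The right-hand side involves `μ` only through `shiftMeasure μ`; this is how time integrals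
determine `μ`. -/
theorem lintegral_one_sub_exp (μ : Measure (RCPath (WithTop ℝ))) [SFinite μ]
    {V : RCPath (WithTop ℝ) → ℝ≥0∞} (hV : Measurable V) (hfin : ∀ᵐ w ∂μ, pathIntegral V w ≠ ∞) :
    ∫⁻ w, ENNReal.ofReal (1 - Real.exp (-(pathIntegral V w).toReal)) ∂μ =
      ∫⁻ w, V w * expNeg (pathIntegral V w) ∂shiftMeasure μ := by
  have hm : Measurable fun w => V w * expNeg (pathIntegral V w) :=
    hV.mul (measurable_expNeg.comp (measurable_pathIntegral hV))
  rw [← lintegral_pathIntegral μ hm]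
  refine lintegral_congr_ae ?_
  filter_upwards [hfin] with w hw
  exact (lintegral_expNeg_pathIntegral hV hw).symm

/-! ### Moments -/

/-- Polynomials form an algebra separating the points of the cube, so mixed moments determine a
finite measure on it. -/
theorem map_eq_of_moments {X J : Type*} [MeasurableSpace X] [Fintype J] {μ ν : Measure X}
    [IsFiniteMeasure μ] [IsFiniteMeasure ν] {Z : X → J → unitInterval} (hZ : Measurable Z)
    (h : ∀ m : J → ℕ, ∫ x, ∏ j, (Z x j : ℝ) ^ m j ∂μ = ∫ x, ∏ j, (Z x j : ℝ) ^ m j ∂ν) :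
    μ.map Z = ν.map Z := by
  let co : J → BoundedContinuousFunction (J → unitInterval) ℝ := fun j =>
    BoundedContinuousFunction.mkOfCompact ⟨fun p => (p j : ℝ), by fun_prop⟩
  let Φ : MvPolynomial J ℝ →ₐ[ℝ] BoundedContinuousFunction (J → unitInterval) ℝ :=
    MvPolynomial.aeval co
  let A : StarSubalgebra ℝ (BoundedContinuousFunction (J → unitInterval) ℝ) :=
    { Φ.range with
      star_mem' := fun {a} ha => by
        have : star a = a := by ext; simp
        rwa [this] }
  have := Measure.isFiniteMeasure_map μ Z
  have := Measure.isFiniteMeasure_map ν Z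
  have hΦ : ∀ (p : MvPolynomial J ℝ) y, Φ p y = MvPolynomial.eval (fun j => (y j : ℝ)) p := by
    intro p y
    induction p using MvPolynomial.induction_on with
    | C a => simp [Φ]
    | add p q hp hq => simp [hp, hq]
    | mul_X p j hp => simp [hp, Φ, co]
  have hmono : ∀ d : J →₀ ℕ, Continuous fun y : J → unitInterval => ∏ j, (y j : ℝ) ^ d j :=
    fun d => by fun_prop
  have hbd : ∀ (d : J →₀ ℕ) (y : J → unitInterval), ‖∏ j, (y j : ℝ) ^ d j‖ ≤ 1 := fun d y => by
    rw [Real.norm_of_nonneg (Finset.prod_nonneg fun j _ => pow_nonneg (y j).2.1 _)]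
    exact Finset.prod_le_one (fun j _ => pow_nonneg (y j).2.1 _)
      fun j _ => pow_le_one₀ (y j).2.1 (y j).2.2
  have hint : ∀ (ρ : Measure X) [IsFiniteMeasure ρ] (d : J →₀ ℕ),
      Integrable (fun x => ∏ j, (Z x j : ℝ) ^ d j) ρ := fun ρ _ d =>
    Integrable.of_bound ((hmono d).measurable.comp hZ).aestronglyMeasurable 1
      (Eventually.of_forall fun x => hbd d (Z x))
  refine ext_of_forall_mem_subalgebra_integral_eq_of_polish (𝕜 := ℝ) (A := A) ?_ ?_
  · intro x y hxy
    obtain ⟨j, hj⟩ := Function.ne_iff.1 hxy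
    refine ⟨_, ⟨_, ⟨co j, ⟨MvPolynomial.X j, by simp [Φ]⟩, rfl⟩, rfl⟩, ?_⟩
    intro h
    exact hj (Subtype.ext h)
  · rintro _ ⟨p, rfl⟩
    have hm : StronglyMeasurable fun y => Φ p y := (Φ p).continuous.stronglyMeasurable
    have e1 := integral_map (μ := μ) hZ.aemeasurable hm.aestronglyMeasurable
    have e2 := integral_map (μ := ν) hZ.aemeasurable hm.aestronglyMeasurable
    refine e1.trans (Eq.trans ?_ e2.symm)
    simp only [hΦ, MvPolynomial.eval_eq']
    rw [integral_finsetSum _ fun d _ => (hint μ d).const_mul _,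
      integral_finsetSum _ fun d _ => (hint ν d).const_mul _]
    refine Finset.sum_congr rfl fun d _ => ?_
    rw [integral_const_mul, integral_const_mul, h d]

/-! ### Measures on paths are determined by their time integrals -/

section Laplace

variable {μ ν : Measure (RCPath (WithTop ℝ))} [SFinite μ] [SFinite ν]
  {V W : RCPath (WithTop ℝ) → ℝ≥0∞}

theorem ae_pathIntegral_ne_top (hV : Measurable V) (hVfin : ∫⁻ w, V w ∂shiftMeasure μ ≠ ∞) :
    ∀ᵐ w ∂μ, pathIntegral V w ≠ ∞ := by
  rw [← lintegral_pathIntegral μ hV] at hVfin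
  filter_upwards [ae_lt_top (measurable_pathIntegral hV) hVfin] with w hw using hw.ne

theorem expNeg_le_one (u : ℝ≥0∞) : expNeg u ≤ 1 := by
  rw [expNeg, ENNReal.ofReal_le_one, Real.exp_le_one_iff]
  simp

/-- The function `w ↦ 1 - e^{-∫ V}`. -/
def oneSubExp (V : RCPath (WithTop ℝ) → ℝ≥0∞) (w : RCPath (WithTop ℝ)) : ℝ≥0∞ :=
  ENNReal.ofReal (1 - Real.exp (-(pathIntegral V w).toReal))

theorem measurable_oneSubExp (hV : Measurable V) : Measurable (oneSubExp V) := by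
  have := measurable_pathIntegral hV
  unfold oneSubExp
  fun_prop

theorem lintegral_oneSubExp_ne_top (hV : Measurable V)
    (hVfin : ∫⁻ w, V w ∂shiftMeasure μ ≠ ∞) : ∫⁻ w, oneSubExp V w ∂μ ≠ ∞ := by
  unfold oneSubExp
  rw [lintegral_one_sub_exp μ hV (ae_pathIntegral_ne_top hV hVfin)]
  refine ne_top_of_le_ne_top hVfin (lintegral_mono fun w => ?_)
  exact mul_le_of_le_one_right' (expNeg_le_one _)

theorem lintegral_oneSubExp_congr (h : shiftMeasure μ = shiftMeasure ν) (hV : Measurable V)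
    (hVfin : ∫⁻ w, V w ∂shiftMeasure μ ≠ ∞) :
    ∫⁻ w, oneSubExp V w ∂μ = ∫⁻ w, oneSubExp V w ∂ν := by
  unfold oneSubExp
  rw [lintegral_one_sub_exp μ hV (ae_pathIntegral_ne_top hV hVfin),
    lintegral_one_sub_exp ν hV (ae_pathIntegral_ne_top hV (h ▸ hVfin)), h]

theorem pathIntegral_add (hV : Measurable V) (w : RCPath (WithTop ℝ)) :
    pathIntegral (fun w => V w + W w) w = pathIntegral V w + pathIntegral W w := by
  have hVm : Measurable fun s => V (shift s w) :=
    hV.comp (measurable_shift measurable_const measurable_id)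
  exact lintegral_add_left hVm _

/-- Integrates `(1 - e^{-a}) e^{-b} + (1 - e^{-b}) = 1 - e^{-a-b}`. The additive form avoids
subtraction in `[0, ∞]`; with `lintegral_oneSubExp_congr` it shows that the Laplace functionals
under the density `1 - e^{-∫V}` depend on the shift measure only. -/
theorem lintegral_oneSubExp_mul_add (hV : Measurable V) (hW : Measurable W)
    (hVfin : ∫⁻ w, V w ∂shiftMeasure μ ≠ ∞) (hWfin : ∫⁻ w, W w ∂shiftMeasure μ ≠ ∞) :
    ∫⁻ w, oneSubExp V w * expNeg (pathIntegral W w) ∂μ + ∫⁻ w, oneSubExp W w ∂μ =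
      ∫⁻ w, oneSubExp (fun w => V w + W w) w ∂μ := by
  rw [← lintegral_add_right _ (measurable_oneSubExp hW)]
  refine lintegral_congr_ae ?_
  filter_upwards [ae_pathIntegral_ne_top hV hVfin, ae_pathIntegral_ne_top hW hWfin] with w h1 h2
  simp only [oneSubExp, expNeg, pathIntegral_add hV]
  have hle : ∀ u : ℝ≥0∞, 0 ≤ 1 - Real.exp (-u.toReal) := fun u => by
    rw [sub_nonneg, Real.exp_le_one_iff]
    simp
  rw [← ENNReal.ofReal_mul (hle _), ← ENNReal.ofReal_add
    (mul_nonneg (hle _) (Real.exp_pos _).le) (hle _), ENNReal.toReal_add h1 h2, neg_add,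
    Real.exp_add]
  congr 1
  ring

theorem lintegral_oneSubExp_mul_congr (h : shiftMeasure μ = shiftMeasure ν) (hV : Measurable V)
    (hW : Measurable W) (hVfin : ∫⁻ w, V w ∂shiftMeasure μ ≠ ∞)
    (hWfin : ∫⁻ w, W w ∂shiftMeasure μ ≠ ∞) :
    ∫⁻ w, oneSubExp V w * expNeg (pathIntegral W w) ∂μ =
      ∫⁻ w, oneSubExp V w * expNeg (pathIntegral W w) ∂ν := by
  have h1 := lintegral_oneSubExp_mul_add hV hW hVfin hWfin
  have h2 := lintegral_oneSubExp_mul_add (μ := ν) hV hW (h ▸ hVfin) (h ▸ hWfin)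
  have hVW : ∫⁻ w, V w + W w ∂shiftMeasure μ ≠ ∞ := by
    rw [lintegral_add_left hV]
    exact ENNReal.add_ne_top.2 ⟨hVfin, hWfin⟩
  have hVWm : Measurable fun w => V w + W w := hV.add hW
  rw [← lintegral_oneSubExp_congr h hVWm hVW, ← h1,
    ← lintegral_oneSubExp_congr h hW hWfin] at h2
  exact ((ENNReal.add_left_inj (lintegral_oneSubExp_ne_top hW hWfin)).1 h2).symm

end Laplace

/-! ### Recovering a path from its time integrals -/

theorem tendsto_average_clock {c : ℝ≥0 → ℝ≥0∞} (hc : ContinuousAt c 0) :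
    Tendsto (fun k : ℕ => ((k + 1 : ℝ≥0) : ℝ≥0∞) * clock c (1 / (k + 1))) atTop (𝓝 (c 0)) := by
  have hlim : Tendsto (fun k : ℕ => 1 / ((k : ℝ≥0) + 1)) atTop (𝓝 0) :=
    tendsto_one_div_add_atTop_nhds_zero_nat (𝕜 := ℝ≥0)
  have hsmall : ∀ p : ℝ≥0 → Prop, (∀ᶠ s in 𝓝 0, p s) →
      ∀ᶠ k : ℕ in atTop, ∀ s < 1 / ((k : ℝ≥0) + 1), p s := by
    intro p hp
    obtain ⟨δ, hδ, h⟩ := Metric.eventually_nhds_iff.1 hp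
    filter_upwards [hlim.eventually (Metric.ball_mem_nhds 0 hδ)] with k hk s hs
    refine h ?_
    rw [NNReal.dist_eq] at hk ⊢
    simp only [NNReal.coe_zero, sub_zero, NNReal.abs_eq] at hk ⊢
    exact (NNReal.coe_lt_coe.2 hs).trans hk
  have hcancel : ∀ (k : ℕ) (l : ℝ≥0∞),
      ((k + 1 : ℝ≥0) : ℝ≥0∞) * (l * ((1 / (k + 1) : ℝ≥0) : ℝ≥0∞)) = l := by
    intro k l
    rw [mul_left_comm, ← ENNReal.coe_mul, mul_one_div_cancel (by positivity), ENNReal.coe_one,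
      mul_one]
  have hconst : ∀ (k : ℕ) (l : ℝ≥0∞), ∫⁻ _ in Iio (1 / ((k : ℝ≥0) + 1)), l ∂timeMeasure =
      l * ((1 / (k + 1) : ℝ≥0) : ℝ≥0∞) := fun k l => by
    rw [setLIntegral_const, timeMeasure_Iio]
  refine tendsto_order.2 ⟨fun l hl => ?_, fun u hu => ?_⟩
  · obtain ⟨l', h1, h2⟩ := exists_between hl
    filter_upwards [hsmall _ (hc.eventually_const_lt h2)] with k hk
    refine h1.trans_le ?_
    rw [← hcancel k l', ← hconst, clock_eq_Iio]
    refine mul_le_mul_right ?_ _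
    exact setLIntegral_mono' measurableSet_Iio fun s hs => (hk s hs).le
  · obtain ⟨u', h1, h2⟩ := exists_between hu
    filter_upwards [hsmall _ (hc.eventually_lt_const h1)] with k hk
    refine lt_of_le_of_lt ?_ h2
    rw [← hcancel k u', ← hconst, clock_eq_Iio]
    refine mul_le_mul_right ?_ _
    exact setLIntegral_mono' measurableSet_Iio fun s hs => (hk s hs).le

/-- For almost every time, the path stays at `∞` if it is there at that time. -/
def Absorbed (w : RCPath (WithTop ℝ)) : Prop :=
  ∀ᵐ s ∂timeMeasure, w.1 s = ⊤ → ∀ t, w.1 (t + s) = ⊤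

theorem absorbed_of_forall_pos {w : RCPath (WithTop ℝ)}
    (h : ∀ s t, 0 < s → s ≤ t → w.1 s = ⊤ → w.1 t = ⊤) : Absorbed w := by
  have hne : ∀ᵐ s ∂timeMeasure, s ≠ 0 := by
    rw [ae_iff]
    simp
  filter_upwards [hne] with s hs htop t
  exact h s _ (pos_iff_ne_zero.2 hs) le_add_self htop

theorem exists_denseSeq_ne_top {w : RCPath (WithTop ℝ)} {t : ℝ≥0} (h : w.1 t ≠ ⊤) :
    ∃ k, w.1 (TopologicalSpace.denseSeq ℝ≥0 k) ≠ ⊤ := by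
  obtain ⟨b, hb, hsub⟩ := exists_gt_ne_top w h
  obtain ⟨_, ⟨k, rfl⟩, h1, h2⟩ := (TopologicalSpace.denseRange_denseSeq ℝ≥0).exists_between hb
  exact ⟨k, hsub _ ⟨h1.le, h2⟩⟩

theorem measurableSet_absorbed : MeasurableSet {w | Absorbed w} := by
  have : {w | Absorbed w} = ⋂ k, {w | timeMeasure {s | w.1 s = ⊤ ∧
      w.1 (TopologicalSpace.denseSeq ℝ≥0 k + s) ≠ ⊤} = 0} := by
    ext w
    simp only [mem_iInter, mem_ofPred_eq, Absorbed]
    constructor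
    · intro h k
      refine measure_mono_null (fun s hs => ?_) (ae_iff.1 h)
      exact fun h' => hs.2 (h' hs.1 _)
    · intro h
      have h' : ∀ᵐ s ∂timeMeasure, ∀ k, ¬ (w.1 s = ⊤ ∧
          w.1 (TopologicalSpace.denseSeq ℝ≥0 k + s) ≠ ⊤) :=
        ae_all_iff.2 fun k => by
          rw [ae_iff]
          simpa using h k
      -- By right-continuity, a later return to finite values would be seen at one of the countably
      -- many dense times.
      filter_upwards [h'] with s hs htop t
      by_contra hne
      obtain ⟨k, hk⟩ := exists_denseSeq_ne_top (w := shift s w) (t := t) (by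
        rwa [shift_apply, add_comm])
      rw [shift_apply, add_comm] at hk
      exact hs k ⟨htop, hk⟩
  rw [this]
  refine MeasurableSet.iInter fun k => ?_
  have hm : MeasurableSet {p : RCPath (WithTop ℝ) × ℝ≥0 | p.1.1 p.2 = ⊤ ∧
      p.1.1 (TopologicalSpace.denseSeq ℝ≥0 k + p.2) ≠ ⊤} :=
    (RCPath.measurable_eval (measurableSet_singleton _)).inter
      ((measurable_apply measurable_fst (measurable_snd.const_add _))
        (measurableSet_singleton _).compl)
  exact measurable_measure_prodMk_left hm (measurableSet_singleton 0)

theorem measurableSet_exists_ne_top :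
    MeasurableSet {w : RCPath (WithTop ℝ) | ∃ s, w.1 s ≠ ⊤} := by
  have : {w : RCPath (WithTop ℝ) | ∃ s, w.1 s ≠ ⊤} =
      ⋃ k, {w | w.1 (TopologicalSpace.denseSeq ℝ≥0 k) ≠ ⊤} := by
    ext w
    simp only [mem_iUnion, mem_ofPred_eq]
    exact ⟨fun ⟨s, hs⟩ => exists_denseSeq_ne_top hs, fun ⟨k, hk⟩ => ⟨_, hk⟩⟩
  rw [this]
  exact MeasurableSet.iUnion fun k =>
    measurable_eval_const _ (measurableSet_singleton _).compl

section Recover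

variable {f : WithTop ℝ → ℝ≥0}

/-- The path integral runs only over times `s` with `w s ≠ ⊤`, but absorbed times contribute nothing
since `f ⊤ = 0`. It is therefore `∫_t^∞ f(w_r) dr`. -/
theorem Absorbed.pathIntegral_eq {w : RCPath (WithTop ℝ)} (hw : Absorbed w) (hf : f ⊤ = 0)
    (t : ℝ≥0) : pathIntegral (fun w => (f (w.1 t) : ℝ≥0∞)) w =
      totalClock fun r => (f (w.1 (t + r)) : ℝ≥0∞) := by
  rw [pathIntegral, ← lintegral_indicator (measurableSet_time_ne_top w), totalClock]
  refine lintegral_congr_ae ?_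
  filter_upwards [hw] with s hs
  by_cases h : w.1 s = ⊤
  · simp [h, hs h t, hf]
  · simp [h, add_comm]

theorem Absorbed.pathIntegral_le {w : RCPath (WithTop ℝ)} (hw : Absorbed w) (hf : f ⊤ = 0)
    (t : ℝ≥0) : pathIntegral (fun w => (f (w.1 t) : ℝ≥0∞)) w ≤
      pathIntegral (fun w => (f (w.1 0) : ℝ≥0∞)) w := by
  rw [hw.pathIntegral_eq hf, hw.pathIntegral_eq hf,
    totalClock_add (fun r => (f (w.1 (0 + r)) : ℝ≥0∞)) t]
  simp

/-- Difference quotient of `t ↦ ∫_t^∞ f(w_r) dr` with step `1 / (k + 1)`; right-continuity of the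
path makes it converge. -/
theorem Absorbed.tendsto_pathIntegral {w : RCPath (WithTop ℝ)} (hw : Absorbed w)
    (hfc : Continuous f) (hf : f ⊤ = 0)
    (hfin : pathIntegral (fun w => (f (w.1 0) : ℝ≥0∞)) w ≠ ∞) (t : ℝ≥0) :
    Tendsto (fun k : ℕ => ((k : ℝ) + 1) *
      ((pathIntegral (fun w => (f (w.1 t) : ℝ≥0∞)) w).toReal -
        (pathIntegral (fun w => (f (w.1 (t + 1 / (k + 1))) : ℝ≥0∞)) w).toReal)) atTop
      (𝓝 (f (w.1 t))) := by
  set c : ℝ≥0 → ℝ≥0∞ := fun r => (f (w.1 (t + r)) : ℝ≥0∞) with hcdef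
  have hc : ContinuousAt c 0 := by
    have h1 := ((shift t w).2 0)
    have h2 : Ici (0 : ℝ≥0) = univ := by ext; simp
    rw [h2, continuousWithinAt_univ] at h1
    exact (ENNReal.continuous_coe.comp hfc).continuousAt.comp (f := (shift t w).1) h1
  have hlim := (ENNReal.tendsto_toReal (a := c 0) (by simp [hcdef])).comp (tendsto_average_clock hc)
  have h0 : (c 0).toReal = f (w.1 t) := by simp [hcdef]
  rw [h0] at hlim
  refine hlim.congr fun k => ?_
  have h1 : totalClock c ≠ ∞ := by
    rw [← hw.pathIntegral_eq hf]
    exact ne_top_of_le_ne_top hfin (hw.pathIntegral_le hf t)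
  have h2 : (totalClock fun r => (f (w.1 (t + 1 / (k + 1) + r)) : ℝ≥0∞)) =
      totalClock fun r => c (1 / (k + 1) + r) := by
    simp only [hcdef, add_assoc]
  rw [hw.pathIntegral_eq hf, hw.pathIntegral_eq hf, h2]
  change _ = _ * ((totalClock c).toReal - _)
  have h3 := totalClock_add c (1 / (k + 1))
  rw [h3] at h1
  obtain ⟨h4, h5⟩ := ENNReal.add_ne_top.1 h1
  rw [h3, ENNReal.toReal_add h4 h5, add_sub_cancel_right, Function.comp_apply, ENNReal.toReal_mul]
  rfl

end Recover

/-! ### Uniqueness of a measure on absorbed paths with given shift measure -/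

section Determined

variable {μ ν : Measure (RCPath (WithTop ℝ))} [SFinite μ] [SFinite ν] {f : Bool → WithTop ℝ → ℝ≥0}

/-- The path functionals `w ↦ f_b(w_t)`. -/
def evalFun (f : Bool → WithTop ℝ → ℝ≥0) (q : ℝ≥0 × Bool) (w : RCPath (WithTop ℝ)) : ℝ≥0∞ :=
  f q.2 (w.1 q.1)

theorem measurable_evalFun (hf : ∀ b, Continuous (f b)) (q : ℝ≥0 × Bool) :
    Measurable (evalFun f q) := by
  have : Measurable fun w : RCPath (WithTop ℝ) => f q.2 (w.1 q.1) :=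
    (hf q.2).measurable.comp (measurable_eval_const q.1)
  exact measurable_coe_nnreal_ennreal.comp this

/-- The variables `e^{-U}`, where `U` is the time integral of `w ↦ f_b(w_t)`. -/
def expIntegral (f : Bool → WithTop ℝ → ℝ≥0) (q : ℝ≥0 × Bool) (w : RCPath (WithTop ℝ)) :
    unitInterval :=
  ⟨Real.exp (-(pathIntegral (evalFun f q) w).toReal), (Real.exp_pos _).le, by
    rw [Real.exp_le_one_iff]
    simp⟩

theorem measurable_expIntegral (hf : ∀ b, Continuous (f b)) (q : ℝ≥0 × Bool) :
    Measurable (expIntegral f q) := by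
  have := measurable_pathIntegral (measurable_evalFun hf q)
  exact Measurable.subtype_mk (by fun_prop)

theorem Absorbed.pathIntegral_evalFun_le {w : RCPath (WithTop ℝ)} (hw : Absorbed w)
    (hf0 : ∀ b, f b ⊤ = 0) (hle : f true ≤ f false) (q : ℝ≥0 × Bool) :
    pathIntegral (evalFun f q) w ≤ pathIntegral (evalFun f (0, false)) w := by
  refine (hw.pathIntegral_le (hf0 q.2) q.1).trans (lintegral_mono fun s => ?_)
  have : f q.2 ≤ f false := by
    rcases q with ⟨t, _ | _⟩
    · exact le_rfl
    · exact hle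
  exact ENNReal.coe_le_coe.2 (this _)

theorem lintegral_evalFun_ne_top (hf : ∀ b, Continuous (f b)) (hf0 : ∀ b, f b ⊤ = 0)
    (hle : f true ≤ f false) (hμ : ∀ᵐ w ∂μ, Absorbed w)
    (hfin : ∫⁻ w, evalFun f (0, false) w ∂shiftMeasure μ ≠ ∞) (q : ℝ≥0 × Bool) :
    ∫⁻ w, evalFun f q w ∂shiftMeasure μ ≠ ∞ := by
  rw [← lintegral_pathIntegral μ (measurable_evalFun hf _)] at hfin ⊢
  refine ne_top_of_le_ne_top hfin (lintegral_mono_ae ?_)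
  filter_upwards [hμ] with w hw
  exact hw.pathIntegral_evalFun_le hf0 hle q

theorem isFiniteMeasure_withDensity_oneSubExp {V : RCPath (WithTop ℝ) → ℝ≥0∞} (hV : Measurable V)
    (hVfin : ∫⁻ w, V w ∂shiftMeasure μ ≠ ∞) : IsFiniteMeasure (μ.withDensity (oneSubExp V)) :=
  ⟨by
    rw [withDensity_apply _ MeasurableSet.univ, setLIntegral_univ]
    exact (lintegral_oneSubExp_ne_top hV hVfin).lt_top⟩

theorem expNeg_pathIntegral_sum {J : Type*} [Fintype J] (hf : ∀ b, Continuous (f b))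
    (q : J → ℝ≥0 × Bool) (m : J → ℕ) {w : RCPath (WithTop ℝ)}
    (hfin : ∀ j, pathIntegral (evalFun f (q j)) w ≠ ∞) :
    expNeg (pathIntegral (fun w => ∑ j, (m j : ℝ≥0∞) * evalFun f (q j) w) w) =
      ENNReal.ofReal (∏ j, (expIntegral f (q j) w : ℝ) ^ m j) := by
  have hm : ∀ j, Measurable fun s => evalFun f (q j) (shift s w) := fun j =>
    (measurable_evalFun hf _).comp (measurable_shift measurable_const measurable_id)
  have hsum : pathIntegral (fun w => ∑ j, (m j : ℝ≥0∞) * evalFun f (q j) w) w =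
      ∑ j, (m j : ℝ≥0∞) * pathIntegral (evalFun f (q j)) w := by
    rw [pathIntegral, lintegral_finsetSum _ fun j _ => (hm j).const_mul _]
    exact Finset.sum_congr rfl fun j _ => lintegral_const_mul _ (hm j)
  rw [hsum, expNeg, ENNReal.toReal_sum fun j _ =>
    ENNReal.mul_ne_top (ENNReal.natCast_ne_top _) (hfin j), ← Finset.sum_neg_distrib, Real.exp_sum]
  congr 1
  refine Finset.prod_congr rfl fun j _ => ?_
  rw [expIntegral, ← Real.exp_nat_mul]
  simp

theorem integral_withDensity_oneSubExp {J : Type*} [Fintype J] (hf : ∀ b, Continuous (f b))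
    (hf0 : ∀ b, f b ⊤ = 0) (hle : f true ≤ f false) (hμ : ∀ᵐ w ∂μ, Absorbed w)
    (hfin : ∫⁻ w, evalFun f (0, false) w ∂shiftMeasure μ ≠ ∞) (q : J → ℝ≥0 × Bool) (m : J → ℕ) :
    ∫ w, ∏ j, (expIntegral f (q j) w : ℝ) ^ m j
        ∂μ.withDensity (oneSubExp (evalFun f (0, false))) =
      (∫⁻ w, oneSubExp (evalFun f (0, false)) w *
        expNeg (pathIntegral (fun w => ∑ j, (m j : ℝ≥0∞) * evalFun f (q j) w) w) ∂μ).toReal := by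
  have hm : Measurable fun w => ∏ j, (expIntegral f (q j) w : ℝ) ^ m j :=
    Finset.measurable_fun_prod _ fun j _ =>
      (measurable_subtype_coe.comp (measurable_expIntegral hf (q j))).pow_const _
  rw [integral_eq_lintegral_of_nonneg_ae (Eventually.of_forall fun w =>
    Finset.prod_nonneg fun j _ => pow_nonneg (expIntegral f (q j) w).2.1 _) hm.aestronglyMeasurable,
    lintegral_withDensity_eq_lintegral_mul _ (measurable_oneSubExp (measurable_evalFun hf _))
      hm.ennreal_ofReal]
  congr 1
  refine lintegral_congr_ae ?_
  filter_upwards [hμ, ae_pathIntegral_ne_top (measurable_evalFun hf _) hfin] with w h1 h2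
  rw [Pi.mul_apply, expNeg_pathIntegral_sum hf q m fun j =>
    ne_top_of_le_ne_top h2 (h1.pathIntegral_evalFun_le hf0 hle _)]

/-- A mixed moment of the variables `e^{-U}` is a Laplace functional whose exponent is a combination
of time integrals with natural-number coefficients, so it is fixed by the shift measure. -/
theorem map_expIntegral_eq {J : Type*} [Fintype J] (hf : ∀ b, Continuous (f b))
    (hf0 : ∀ b, f b ⊤ = 0) (hle : f true ≤ f false) (hμ : ∀ᵐ w ∂μ, Absorbed w)
    (hν : ∀ᵐ w ∂ν, Absorbed w) (h : shiftMeasure μ = shiftMeasure ν)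
    (hfin : ∫⁻ w, evalFun f (0, false) w ∂shiftMeasure μ ≠ ∞) (q : J → ℝ≥0 × Bool) :
    (μ.withDensity (oneSubExp (evalFun f (0, false)))).map (fun w j => expIntegral f (q j) w) =
      (ν.withDensity (oneSubExp (evalFun f (0, false)))).map fun w j => expIntegral f (q j) w := by
  have h0 := measurable_evalFun hf (0, false)
  have := isFiniteMeasure_withDensity_oneSubExp h0 hfin
  have := isFiniteMeasure_withDensity_oneSubExp (μ := ν) h0 (h ▸ hfin)
  refine map_eq_of_moments (measurable_pi_lambda _ fun j => measurable_expIntegral hf _) fun m => ?_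
  rw [integral_withDensity_oneSubExp hf hf0 hle hμ hfin,
    integral_withDensity_oneSubExp hf hf0 hle hν (h ▸ hfin)]
  have hW : ∀ j, Measurable fun w => (m j : ℝ≥0∞) * evalFun f (q j) w := fun j =>
    (measurable_evalFun hf _).const_mul _
  rw [lintegral_oneSubExp_mul_congr h h0 (Finset.measurable_fun_sum _ fun j _ => hW j) hfin]
  rw [lintegral_finsetSum _ fun j _ => hW j]
  refine ENNReal.sum_ne_top.2 fun j _ => ?_
  rw [lintegral_const_mul _ (measurable_evalFun hf _)]
  exact ENNReal.mul_ne_top (ENNReal.natCast_ne_top _)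
    (lintegral_evalFun_ne_top hf hf0 hle hμ hfin _)

theorem timeMeasure_ne_top_pos {w : RCPath (WithTop ℝ)} (h : ∃ s, w.1 s ≠ ⊤) :
    timeMeasure {s | w.1 s ≠ ⊤} ≠ 0 := by
  obtain ⟨s, hs⟩ := h
  obtain ⟨b, hb, hsb⟩ := exists_gt_ne_top w hs
  have hsub : Iio b \ Iio s ⊆ {s | w.1 s ≠ ⊤} := fun r hr => hsb r ⟨not_lt.1 hr.2, hr.1⟩
  have h1 := (le_measure_sdiff (μ := timeMeasure) (s₁ := Iio b) (s₂ := Iio s)).trans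
    (measure_mono hsub)
  rw [timeMeasure_Iio, timeMeasure_Iio] at h1
  intro h0
  rw [h0, nonpos_iff_eq_zero, tsub_eq_zero_iff_le] at h1
  exact absurd (ENNReal.coe_le_coe.1 h1) (not_le.2 hb)

theorem pathIntegral_ne_zero {V : RCPath (WithTop ℝ) → ℝ≥0∞} (hV : Measurable V)
    {w : RCPath (WithTop ℝ)} (h : ∃ s, w.1 s ≠ ⊤) (hpos : ∀ s, w.1 s ≠ ⊤ → V (shift s w) ≠ 0) :
    pathIntegral V w ≠ 0 := by
  intro h0
  have hm : Measurable fun s => V (shift s w) :=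
    hV.comp (measurable_shift measurable_const measurable_id)
  rw [pathIntegral, lintegral_eq_zero_iff hm, EventuallyEq,
    ae_restrict_iff' (measurableSet_time_ne_top w)] at h0
  refine timeMeasure_ne_top_pos h (measure_mono_null (fun s hs => ?_) (ae_iff.1 h0))
  exact fun hs' => hpos s hs (hs' hs)

/-- A measure on absorbed paths is determined by the associated measure of time integrals. -/
theorem eq_of_shiftMeasure_eq (hf : ∀ b, Continuous (f b))
    (hf0 : ∀ b, f b ⊤ = 0) (hle : f true ≤ f false) (hpos : ∀ y ≠ ⊤, f false y ≠ 0)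
    {G : ℝ≥0 × ℝ≥0 → WithTop ℝ} (hG : Measurable G) (hGf : ∀ y, G (f false y, f true y) = y)
    (hμ : ∀ᵐ w ∂μ, Absorbed w ∧ ∃ s, w.1 s ≠ ⊤) (hν : ∀ᵐ w ∂ν, Absorbed w ∧ ∃ s, w.1 s ≠ ⊤)
    (h : shiftMeasure μ = shiftMeasure ν)
    (hfin : ∫⁻ w, evalFun f (0, false) w ∂shiftMeasure μ ≠ ∞) : μ = ν := by
  set D := oneSubExp (evalFun f (0, false)) with hDdef
  have h0 := measurable_evalFun hf (0, false)
  have hD : Measurable D := measurable_oneSubExp h0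
  have hfin' : ∫⁻ w, evalFun f (0, false) w ∂shiftMeasure ν ≠ ∞ := h ▸ hfin
  have i1 : IsFiniteMeasure (μ.withDensity D) := isFiniteMeasure_withDensity_oneSubExp h0 hfin
  have i2 : IsFiniteMeasure (ν.withDensity D) := isFiniteMeasure_withDensity_oneSubExp h0 hfin'
  have hDtop : ∀ w, D w ≠ ∞ := fun w => ENNReal.ofReal_ne_top
  have hDne : ∀ w, (∃ s, w.1 s ≠ ⊤) → pathIntegral (evalFun f (0, false)) w ≠ ∞ → D w ≠ 0 := by
    rintro w ⟨s, hs⟩ hw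
    have hne : pathIntegral (evalFun f (0, false)) w ≠ 0 :=
      pathIntegral_ne_zero h0 ⟨s, hs⟩ fun r hr => by simpa [evalFun] using hpos _ hr
    have := ENNReal.toReal_pos hne hw
    rw [hDdef, oneSubExp, ne_eq, ENNReal.ofReal_eq_zero, not_le, sub_pos, Real.exp_lt_one_iff]
    linarith
  -- With density `D` both measures are finite; `D` is finite, and nonzero almost everywhere, so it
  -- can be divided out again.
  suffices μ.withDensity D = ν.withDensity D by
    rw [← withDensity_inv_same hD (μ := μ) ?_ (Eventually.of_forall hDtop), this,
      withDensity_inv_same hD ?_ (Eventually.of_forall hDtop)]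
    · filter_upwards [hν, ae_pathIntegral_ne_top h0 hfin'] with w h1 h2 using hDne w h1.2 h2
    · filter_upwards [hμ, ae_pathIntegral_ne_top h0 hfin] with w h1 h2 using hDne w h1.2 h2
  let F : ℝ≥0 × Bool → RCPath (WithTop ℝ) → ℝ := fun q w => f q.2 (w.1 q.1)
  refine ext_of_forall_lintegral_finset (f := F) ?_ ?_
  · refine le_antisymm ?_ (Measurable.comap_le (measurable_pi_lambda _ fun q => ?_))
    · let Φ : RCPath (WithTop ℝ) → (ℝ≥0 × Bool → ℝ) := fun w q => F q w
      have hval : Measurable[MeasurableSpace.comap Φ MeasurableSpace.pi]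
          (Subtype.val : RCPath (WithTop ℝ) → ℝ≥0 → WithTop ℝ) := ?_
      · exact hval.comap_le
      refine @measurable_pi_lambda _ _ _ (MeasurableSpace.comap Φ MeasurableSpace.pi) _ _ fun t => ?_
      -- `G` reads the state off its two test values, so the functions `F` generate the whole
      -- σ-algebra.
      have hH : Measurable fun p : ℝ≥0 × Bool → ℝ =>
          G ((p (t, false)).toNNReal, (p (t, true)).toNNReal) := hG.comp (by fun_prop)
      convert hH.comp (comap_measurable Φ) using 1
      ext w
      simp [Φ, F, hGf]
    · exact measurable_coe_nnreal_real.comp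
        ((hf q.2).measurable.comp (measurable_eval_const q.1))
  intro I φ
  -- Each index is doubled to carry the time integrals from `t` and from `t + 1 / (k + 1)`; `H k`
  -- forms their difference quotient from logarithms, with limit `f(w_t)`.
  let q : ℕ → I ⊕ I → ℝ≥0 × Bool := fun k =>
    Sum.elim (fun i => i.1) fun i => (i.1.1 + 1 / (k + 1), i.1.2)
  let Z : ℕ → RCPath (WithTop ℝ) → (I ⊕ I) → unitInterval := fun k w j => expIntegral f (q k j) w
  let H : ℕ → ((I ⊕ I) → unitInterval) → I → ℝ := fun k y i =>
    ((k : ℝ) + 1) * (Real.log (y (Sum.inr i)) - Real.log (y (Sum.inl i)))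
  have hZ : ∀ k, Measurable (Z k) := fun k =>
    measurable_pi_lambda _ fun j => measurable_expIntegral hf _
  have hH : ∀ k, Measurable (H k) := fun k => by fun_prop
  have hφH : ∀ k, Measurable fun y => (φ (H k y) : ℝ≥0∞) := fun k =>
    measurable_coe_nnreal_ennreal.comp (φ.continuous.measurable.comp (hH k))
  have hlim : ∀ w, Absorbed w → pathIntegral (evalFun f (0, false)) w ≠ ∞ →
      Tendsto (fun k => (φ (H k (Z k w)) : ℝ≥0∞)) atTop (𝓝 (φ fun i => F i w)) := by
    intro w hw hwfin
    refine (ENNReal.continuous_coe.comp φ.continuous).continuousAt.tendsto.comp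
      (tendsto_pi_nhds.2 fun i => ?_)
    have hfin_i : pathIntegral (fun w => (f i.1.2 (w.1 0) : ℝ≥0∞)) w ≠ ∞ :=
      ne_top_of_le_ne_top hwfin (hw.pathIntegral_evalFun_le hf0 hle (0, i.1.2))
    refine (hw.tendsto_pathIntegral (hf i.1.2) (hf0 i.1.2) hfin_i i.1.1).congr fun k => ?_
    simp only [H, Z, q, expIntegral, Real.log_exp, Sum.elim_inl, Sum.elim_inr]
    rw [neg_sub_neg]
    rfl
  have hconv : ∀ (ρ : Measure (RCPath (WithTop ℝ))) [IsFiniteMeasure ρ],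
      (∀ᵐ w ∂ρ, Absorbed w ∧ pathIntegral (evalFun f (0, false)) w ≠ ∞) →
      Tendsto (fun k => ∫⁻ y, φ (H k y) ∂ρ.map (Z k)) atTop (𝓝 (∫⁻ w, φ (fun i => F i w) ∂ρ)) := by
    intro ρ _ hρ
    have hb : ∀ x, (φ x : ℝ≥0∞) ≤ (nndist φ 0 : ℝ≥0) := fun x => by
      have := φ.nndist_coe_le_nndist (g := 0) x
      exact ENNReal.coe_le_coe.2 (by simpa using this)
    have := tendsto_lintegral_of_dominated_convergence (μ := ρ)
      (F := fun k w => (φ (H k (Z k w)) : ℝ≥0∞)) (fun _ => ((nndist φ 0 : ℝ≥0) : ℝ≥0∞))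
      (fun k => (hφH k).comp (hZ k)) (fun k => Eventually.of_forall fun w => hb _)
      (by simp [ENNReal.mul_ne_top]) (hρ.mono fun w hw => hlim w hw.1 hw.2)
    refine this.congr fun k => ?_
    rw [lintegral_map (hφH k) (hZ k)]
  have hac : ∀ ρ : Measure (RCPath (WithTop ℝ)), ρ.withDensity D ≪ ρ := fun ρ =>
    withDensity_absolutelyContinuous _ _
  have l1 := hconv (μ.withDensity D) ((hac μ).ae_le (by
    filter_upwards [hμ, ae_pathIntegral_ne_top h0 hfin] with w h1 h2 using ⟨h1.1, h2⟩))
  have l2 := hconv (ν.withDensity D) ((hac ν).ae_le (by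
    filter_upwards [hν, ae_pathIntegral_ne_top h0 hfin'] with w h1 h2 using ⟨h1.1, h2⟩))
  have hZeq : ∀ k, (μ.withDensity D).map (Z k) = (ν.withDensity D).map (Z k) := fun k =>
    map_expIntegral_eq hf hf0 hle (hμ.mono fun w hw => hw.1) (hν.mono fun w hw => hw.1) h hfin (q k)
  simp only [hZeq] at l1
  exact tendsto_nhds_unique l1 l2

end Determined

/-! ### The path transform of paths with a well-behaved clock -/

theorem scalingRate_ne_zero {R : ℝ → ℝ} (hpos : ∀ x, 0 < R x) (z : ℝ) (y : WithTop ℝ) :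
    scalingRate R z y ≠ 0 := by
  cases y with
  | top => simp [scalingRate]
  | coe x =>
    have : 0 < R x / R (z + x) := div_pos (hpos _) (hpos _)
    simpa [scalingRate] using this

theorem pathIntegral_shift_le (V : RCPath (WithTop ℝ) → ℝ≥0∞) (s : ℝ≥0) (w : RCPath (WithTop ℝ)) :
    pathIntegral V (shift s w) ≤ pathIntegral V w := by
  rw [pathIntegral, pathIntegral, ← lintegral_indicator (measurableSet_time_ne_top _),
    ← lintegral_indicator (measurableSet_time_ne_top _)]
  refine le_trans (le_of_eq ?_) (setLIntegral_le_lintegral (Ici s) _)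
  rw [lintegral_Ici_timeMeasure]
  refine lintegral_congr fun r => ?_
  by_cases hr : w.1 (s + r) = ⊤ <;> simp [hr, shift_shift]

theorem GoodClock.shift {c : WithTop ℝ → ℝ≥0∞} {w : RCPath (WithTop ℝ)} (hw : GoodClock c w)
    (s : ℝ≥0) : GoodClock c (shift s w) := by
  intro t ht
  have := hw (s + t) ht
  rw [pathClock_shift] at this
  exact (ENNReal.add_ne_top.1 this).2

theorem measurableSet_goodClock {c : WithTop ℝ → ℝ≥0∞} (hc : Measurable c) :
    MeasurableSet {w | GoodClock c w} := by
  have : {w | GoodClock c w} = ⋂ k, {w | w.1 (TopologicalSpace.denseSeq ℝ≥0 k) = ⊤ ∨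
      pathClock c w (TopologicalSpace.denseSeq ℝ≥0 k) ≠ ∞} := by
    ext w
    simp only [mem_iInter, mem_ofPred_eq, GoodClock]
    constructor
    · exact fun h k => or_iff_not_imp_left.2 (h _)
    · intro h u hu
      obtain ⟨b, hb, hsub⟩ := exists_gt_ne_top w hu
      obtain ⟨_, ⟨k, rfl⟩, h1, h2⟩ := (TopologicalSpace.denseRange_denseSeq ℝ≥0).exists_between hb
      exact ne_top_of_le_ne_top ((h k).resolve_left (hsub _ ⟨h1.le, h2⟩)) (clock_mono _ h1.le)
  rw [this]
  refine MeasurableSet.iInter fun k => ?_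
  exact (measurable_eval_const _ (measurableSet_singleton _)).union
    ((measurable_pathClock hc).comp measurable_prodMk_right (measurableSet_singleton _).compl)

section Transform

variable {R : ℝ → ℝ} {z : ℝ} {w : RCPath (WithTop ℝ)}

theorem GoodClock.pathIntegral_pathTransformRC (hR : Measurable R)
    (hw : GoodClock (scalingRate R z) w) {F : RCPath (WithTop ℝ) → ℝ≥0∞} (hF : Measurable F) :
    pathIntegral F (pathTransformRC R z w) =
      pathIntegral (fun v => scalingRate R z (v.1 0) * F (pathTransformRC R z v)) w := by
  refine (hw.lintegral_pathTransformRC hR hF).trans ?_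
  simp [pathIntegral]

/-- With `F = 1` the change of variables says that the time the transform spends at finite values is
the integral of the positive rate `g` over the times when `w` is finite. -/
theorem GoodClock.exists_pathTransformRC_ne_top (hR : Measurable R) (hpos : ∀ x, 0 < R x)
    (hw : GoodClock (scalingRate R z) w) (h : ∃ s, w.1 s ≠ ⊤) :
    ∃ t, (pathTransformRC R z w).1 t ≠ ⊤ := by
  by_contra! hcon
  have h1 := hw.pathIntegral_pathTransformRC hR (F := fun _ => 1) measurable_const
  have h2 : pathIntegral (fun _ => 1) (pathTransformRC R z w) = 0 := by
    simp [pathIntegral, hcon]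
  rw [h2] at h1
  refine pathIntegral_ne_zero ?_ h (fun s _ => ?_) h1.symm
  · exact ((measurable_scalingRate hR z).comp (measurable_eval_const 0)).mul measurable_const
  · simpa using scalingRate_ne_zero hpos z _

theorem pathTransformRC_of_lt {t : ℝ≥0} (ht : (t : ℝ≥0∞) < pathTotal (scalingRate R z) w) :
    (pathTransformRC R z w).1 t = (z : WithTop ℝ) + w.1 (pathClockInv (scalingRate R z) w t) := by
  rw [pathTransformRC, translate, mapC_apply, timeChange_of_lt ht]

theorem pathTransformRC_of_not_lt {t : ℝ≥0} (ht : ¬ (t : ℝ≥0∞) < pathTotal (scalingRate R z) w) :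
    (pathTransformRC R z w).1 t = ⊤ := by
  rw [pathTransformRC, translate, mapC_apply, timeChange_of_not_lt ht]
  rfl

theorem GoodClock.pathTransformRC_eq_top_of_le (hw : GoodClock (scalingRate R z) w)
    (habs : ∀ s t, 0 < s → s ≤ t → w.1 s = ⊤ → w.1 t = ⊤) {b : ℝ≥0} (hb : 0 < b)
    (hne : ∀ s, 0 < s → s < b → w.1 s ≠ ⊤) {s t : ℝ≥0} (hs : 0 < s) (hst : s ≤ t)
    (h : (pathTransformRC R z w).1 s = ⊤) : (pathTransformRC R z w).1 t = ⊤ := by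
  by_cases ht : (t : ℝ≥0∞) < pathTotal (scalingRate R z) w
  · have hs' : (s : ℝ≥0∞) < pathTotal (scalingRate R z) w :=
      lt_of_le_of_lt (by exact_mod_cast hst) ht
    rw [pathTransformRC_of_lt hs'] at h
    have h1 : w.1 (pathClockInv (scalingRate R z) w s) = ⊤ := by simpa using h
    -- The path may be at `⊤` at time `0`, so absorption can be used at positive times only. A clock
    -- that is finite near `0` stays below `s` initially, which keeps its inverse at `s` positive.
    have h2 : 0 < pathClockInv (scalingRate R z) w s := by
      by_contra h0
      obtain ⟨b', hb1, hb2⟩ := exists_between hb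
      obtain ⟨a, ha, -, hclock⟩ := exists_clock_lt (x := s) hb1 (hw b' (hne b' hb1 hb2))
        (by rw [clock_zero]; exact_mod_cast hs)
      have := (clockInv_lt_iff hs').1 (lt_of_le_of_lt (not_lt.1 h0) ha)
      exact lt_asymm this hclock
    have h3 : w.1 (pathClockInv (scalingRate R z) w t) = ⊤ :=
      habs _ _ h2 (clockInv_mono hst ht) h1
    rw [pathTransformRC_of_lt ht, h3]
    rfl
  · exact pathTransformRC_of_not_lt ht

theorem GoodClock.shift_pathTransformRC (hw : GoodClock (scalingRate R z) w) {t : ℝ≥0}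
    (ht : (t : ℝ≥0∞) < pathTotal (scalingRate R z) w)
    (htop : w.1 (pathClockInv (scalingRate R z) w t) ≠ ⊤) :
    RCPath.shift t (pathTransformRC R z w) =
      pathTransformRC R z (RCPath.shift (pathClockInv (scalingRate R z) w t) w) := by
  rw [pathTransformRC, shift_translate, hw.shift_timeChange ht htop]
  rfl

theorem exists_time_of_ae {p : ℝ≥0 → Prop} (h : ∀ᵐ s ∂timeMeasure, p s) {δ : ℝ≥0} (hδ : 0 < δ) :
    ∃ s, 0 < s ∧ s < δ ∧ p s := by
  by_contra! hcon
  have hsub : Iio δ ⊆ {0} ∪ {s | ¬ p s} := by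
    intro s hs
    rcases eq_zero_or_pos s with rfl | h0
    · exact Or.inl rfl
    · exact Or.inr (hcon s h0 hs)
  have := measure_mono_null hsub (measure_union_null (measure_singleton 0) (ae_iff.1 h))
  rw [timeMeasure_Iio] at this
  exact hδ.ne' (by simpa using this)

/-- An infinite clock on `(0, δ)` is the increasing limit of the clocks on `[1 / (k + 1), δ)`, so
one of these exceeds `t`. -/
theorem exists_lt_clock_tail {c : ℝ≥0 → ℝ≥0∞} {δ : ℝ≥0}
    (h : clock c δ = ∞) (t : ℝ≥0) : ∃ ε, 0 < ε ∧ ∀ s < ε, s < δ →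
      (t : ℝ≥0∞) < clock (fun r => c (s + r)) (δ - s) := by
  set ν := timeMeasure.withDensity c
  have hU : Iio δ = {0} ∩ Iio δ ∪ ⋃ k : ℕ, Ico (1 / ((k : ℝ≥0) + 1)) δ := by
    ext s
    simp only [mem_union, mem_inter_iff, mem_singleton_iff, mem_iUnion, mem_Ico, mem_Iio]
    constructor
    · intro hs
      rcases eq_zero_or_pos s with h0 | h0
      · exact Or.inl ⟨h0, hs⟩
      · obtain ⟨k, hk⟩ := ((tendsto_one_div_add_atTop_nhds_zero_nat (𝕜 := ℝ≥0)).eventually_lt_const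
          h0).exists
        exact Or.inr ⟨k, hk.le, hs⟩
    · rintro (⟨-, hs⟩ | ⟨k, -, hs⟩) <;> exact hs
  have hmono : Monotone fun k : ℕ => Ico (1 / ((k : ℝ≥0) + 1)) δ := by
    intro k l hkl
    refine Ico_subset_Ico_left ?_
    gcongr
  have h1 : ν (⋃ k : ℕ, Ico (1 / ((k : ℝ≥0) + 1)) δ) = ∞ := by
    have h2 : ν (Iio δ) = ∞ := by
      rw [withDensity_apply _ measurableSet_Iio, ← clock_eq_Iio, h]
    have h3 : ν ({0} ∩ Iio δ) = 0 := by
      refine withDensity_absolutelyContinuous _ _ (measure_mono_null inter_subset_left ?_)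
      exact measure_singleton 0
    rw [hU] at h2
    have := measure_union_le (μ := ν) ({0} ∩ Iio δ) (⋃ k : ℕ, Ico (1 / ((k : ℝ≥0) + 1)) δ)
    rw [h2, h3, zero_add] at this
    exact top_le_iff.1 this
  rw [hmono.measure_iUnion] at h1
  obtain ⟨k, hk⟩ := lt_iSup_iff.1 (h1 ▸ ENNReal.coe_lt_top (r := t))
  refine ⟨1 / (k + 1), by positivity, fun s hs hsδ => hk.trans_le ?_⟩
  rw [withDensity_apply _ measurableSet_Ico, clock_eq_Iio, ← lintegral_indicator measurableSet_Iio]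
  have : ∀ r, (Iio (δ - s)).indicator (fun r => c (s + r)) r = (Iio δ).indicator c (s + r) := by
    intro r
    by_cases hr : s + r < δ
    · rw [indicator_of_mem (show s + r ∈ Iio δ from hr), indicator_of_mem]
      exact lt_tsub_iff_left.2 hr
    · rw [indicator_of_notMem (show s + r ∉ Iio δ from hr), indicator_of_notMem]
      exact fun h' => hr (lt_tsub_iff_left.1 h')
  simp only [this]
  rw [← lintegral_Ici_timeMeasure, ← lintegral_indicator measurableSet_Ico,
    ← lintegral_indicator measurableSet_Ici]
  refine lintegral_mono fun r => ?_
  by_cases hr : r ∈ Ico (1 / ((k : ℝ≥0) + 1)) δ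
  · rw [indicator_of_mem hr, indicator_of_mem (show r ∈ Ici s from hs.le.trans hr.1),
      indicator_of_mem (show r ∈ Iio δ from hr.2)]
  · rw [indicator_of_notMem hr]
    exact zero_le

/-- If the clock of `w` explodes instantaneously, then the time integrals of functionals at time
`t` of the transforms of the later parts of `w` stay bounded away from zero as `t → ∞`. -/
theorem exists_le_pathIntegral_of_clock_eq_top (hR : Measurable R) (hpos : ∀ x, 0 < R x)
    (habs : ∀ s t, 0 < s → s ≤ t → w.1 s = ⊤ → w.1 t = ⊤) {b : ℝ≥0} (hb : 0 < b)
    (hne : ∀ s, 0 < s → s < b → w.1 s ≠ ⊤)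
    (hgood : ∀ᵐ s ∂timeMeasure, w.1 s ≠ ⊤ → GoodClock (scalingRate R z) (shift s w))
    (hinf : ∀ s, 0 < s → pathClock (scalingRate R z) w s = ∞) {f : WithTop ℝ → ℝ≥0}
    (hf : Measurable f) (hf0 : f ⊤ = 0) (hfpos : ∀ y ≠ ⊤, f y ≠ 0) :
    ∃ L : ℝ≥0∞, L ≠ 0 ∧ ∀ t, L ≤ pathIntegral (fun v =>
      scalingRate R z (v.1 0) * f ((pathTransformRC R z v).1 t)) w := by
  have hfm : ∀ t, Measurable fun v : RCPath (WithTop ℝ) => (f (v.1 t) : ℝ≥0∞) := fun t =>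
    measurable_coe_nnreal_ennreal.comp (hf.comp (measurable_eval_const t))
  obtain ⟨δ, hδ, hδb, hδgood⟩ := exists_time_of_ae hgood hb
  have hδgood := hδgood (hne δ hδ hδb)
  have hδe : ∃ s, (pathTransformRC R z (shift δ w)).1 s ≠ ⊤ :=
    hδgood.exists_pathTransformRC_ne_top hR hpos ⟨0, by simpa using hne δ hδ hδb⟩
  -- `L` is the time integral of `f` along the transform of the part of `w` after `δ`; it does not
  -- involve `t`.
  refine ⟨pathIntegral (fun v => (f (v.1 0) : ℝ≥0∞)) (pathTransformRC R z (shift δ w)),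
    pathIntegral_ne_zero (hfm 0) hδe fun s hs => by simpa using hfpos _ hs, fun t => ?_⟩
  -- For `ε` close to `0` the clock started at `ε` passes `t` before `δ`. At its time `t` the
  -- transform of the path after `ε` still has the whole contribution `L` ahead of it.
  obtain ⟨ε₀, hε₀, hclock⟩ := exists_lt_clock_tail (hinf δ hδ) t
  obtain ⟨ε, hε, hεδ, hεgood⟩ := exists_time_of_ae hgood (lt_min hε₀ hδ)
  have hεδ' : ε < δ := hεδ.trans_le (min_le_right _ _)
  have hclock := hclock ε (hεδ.trans_le (min_le_left _ _)) hεδ'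
  set w₁ := shift ε w with hw₁
  have hw₁good : GoodClock (scalingRate R z) w₁ := hεgood (hne ε hε (hεδ'.trans hδb))
  have htot : (t : ℝ≥0∞) < pathTotal (scalingRate R z) w₁ :=
    lt_of_lt_of_le hclock (clock_le_totalClock _ _)
  set h := pathClockInv (scalingRate R z) w₁ t with hh
  have hlt : h < δ - ε := (clockInv_lt_iff htot).2 hclock
  have hltδ : ε + h < δ := lt_tsub_iff_left.1 hlt
  have htop : w₁.1 h ≠ ⊤ := hne _ (lt_of_lt_of_le hε le_self_add) (hltδ.trans hδb)
  set y := pathTransformRC R z w₁ with hy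
  have hyabs : Absorbed y := by
    refine absorbed_of_forall_pos fun s t hs hst hsy => ?_
    refine hw₁good.pathTransformRC_eq_top_of_le (b := δ - ε) (fun s t hs hst h' => ?_)
      (tsub_pos_of_lt hεδ') (fun s hs hsb => ?_) hs hst hsy
    · exact habs (ε + s) (ε + t) (lt_of_lt_of_le hε le_self_add) (by gcongr) h'
    · exact hne _ (lt_of_lt_of_le hε le_self_add) ((lt_tsub_iff_left.1 hsb).trans hδb)
  calc pathIntegral (fun v => (f (v.1 0) : ℝ≥0∞)) (pathTransformRC R z (shift δ w))
      = pathIntegral (fun v => scalingRate R z (v.1 0) * f ((pathTransformRC R z v).1 0))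
          (shift δ w) := hδgood.pathIntegral_pathTransformRC hR (hfm 0)
    _ = pathIntegral (fun v => scalingRate R z (v.1 0) * f ((pathTransformRC R z v).1 0))
          (shift (δ - (ε + h)) (shift h w₁)) := by
        rw [hw₁, shift_shift, shift_shift, ← add_assoc, add_tsub_cancel_of_le hltδ.le]
    _ ≤ pathIntegral (fun v => scalingRate R z (v.1 0) * f ((pathTransformRC R z v).1 0))
          (shift h w₁) := pathIntegral_shift_le _ _ _
    _ = pathIntegral (fun v => (f (v.1 0) : ℝ≥0∞)) (shift t y) := by
        rw [hy, hw₁good.shift_pathTransformRC htot htop]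
        exact ((hw₁good.shift h).pathIntegral_pathTransformRC hR (hfm 0)).symm
    _ ≤ pathIntegral (fun v => (f (v.1 t) : ℝ≥0∞)) y := by
        rw [hyabs.pathIntegral_eq hf0]
        refine (setLIntegral_le_lintegral _ _).trans (le_of_eq ?_)
        simp [totalClock]
    _ = pathIntegral (fun v => scalingRate R z (v.1 0) * f ((pathTransformRC R z v).1 t)) w₁ :=
        hw₁good.pathIntegral_pathTransformRC hR (hfm t)
    _ ≤ _ := pathIntegral_shift_le _ _ _

theorem goodClock_of_ae_shift {c : WithTop ℝ → ℝ≥0∞}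
    {b : ℝ≥0} (hb : 0 < b) (hne : ∀ s, 0 < s → s < b → w.1 s ≠ ⊤)
    (hgood : ∀ᵐ s ∂timeMeasure, w.1 s ≠ ⊤ → GoodClock c (shift s w))
    (hfin : ∃ s, 0 < s ∧ pathClock c w s ≠ ∞) : GoodClock c w := by
  obtain ⟨s, hs, hsfin⟩ := hfin
  intro u hu
  obtain ⟨ε, hε, hεs, hεgood⟩ := exists_time_of_ae hgood (lt_min hs hb)
  have hfinε : pathClock c w ε ≠ ∞ :=
    ne_top_of_le_ne_top hsfin (clock_mono _ (hεs.trans_le (min_le_left _ _)).le)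
  rcases le_total u ε with h | h
  · exact ne_top_of_le_ne_top hfinε (clock_mono _ h)
  · obtain ⟨r, rfl⟩ := exists_add_of_le h
    rw [pathClock_shift]
    exact ENNReal.add_ne_top.2 ⟨hfinε,
      hεgood (hne ε hε (hεs.trans_le (min_le_right _ _))) r hu⟩

end Transform

/-! ### Occupation of the transformed excursions -/

theorem exists_clock_ne_top_of_continuousAt {c : ℝ≥0 → ℝ≥0∞} (hc : ContinuousAt c 0)
    (h0 : c 0 ≠ ∞) : ∃ s, 0 < s ∧ clock c s ≠ ∞ := by
  have h1 : ∀ᶠ s in 𝓝 (0 : ℝ≥0), c s < c 0 + 1 :=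
    hc.eventually_lt_const (ENNReal.lt_add_right h0 one_ne_zero)
  obtain ⟨δ, hδ, h⟩ := Metric.eventually_nhds_iff.1 h1
  obtain ⟨δ, rfl⟩ : ∃ d : ℝ≥0, (d : ℝ) = δ := ⟨δ.toNNReal, Real.coe_toNNReal _ hδ.le⟩
  refine ⟨δ, by exact_mod_cast hδ, ?_⟩
  rw [clock_eq_Iio]
  refine ne_top_of_le_ne_top (b := (c 0 + 1) * timeMeasure (Iio δ)) ?_ ?_
  · rw [timeMeasure_Iio]
    exact ENNReal.mul_ne_top (ENNReal.add_ne_top.2 ⟨h0, ENNReal.one_ne_top⟩) ENNReal.coe_ne_top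
  · rw [← setLIntegral_const]
    refine setLIntegral_mono' measurableSet_Iio fun s hs => (h ?_).le
    have hs' : (s : ℝ) < δ := NNReal.coe_lt_coe.2 hs
    rw [NNReal.dist_eq]
    simpa using hs'

theorem continuousAt_scalingRate {R : ℝ → ℝ} (hR : Continuous R) (hpos : ∀ x, 0 < R x) (z x : ℝ) :
    ContinuousAt (scalingRate R z) (x : WithTop ℝ) := by
  rw [← WithTop.isOpenEmbedding_some.continuousAt_iff]
  have : scalingRate R z ∘ ((↑) : ℝ → WithTop ℝ) = fun x => ENNReal.ofReal (R x / R (z + x)) := rfl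
  rw [this]
  refine (ENNReal.continuous_ofReal.comp ?_).continuousAt
  exact hR.div (by fun_prop) fun x => (hpos _).ne'

/-- If the clock explodes instantaneously, then the transformed path is identically `∞`. -/
theorem pathTransformRC_eq_top {R : ℝ → ℝ} (hR : Continuous R) (hpos : ∀ x, 0 < R x) {z : ℝ}
    {w : RCPath (WithTop ℝ)} (hinf : ∀ s, 0 < s → pathClock (scalingRate R z) w s = ∞) (t : ℝ≥0) :
    (pathTransformRC R z w).1 t = ⊤ := by
  have h0 : w.1 0 = ⊤ := by
    by_contra hne
    obtain ⟨x, hx⟩ := WithTop.ne_top_iff_exists.1 hne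
    have hc : ContinuousAt w.1 0 := by
      have h1 := w.2 0
      have h2 : Ici (0 : ℝ≥0) = univ := by ext; simp
      rwa [h2, continuousWithinAt_univ] at h1
    have hg : ContinuousAt (scalingRate R z) (w.1 0) := hx ▸ continuousAt_scalingRate hR hpos z x
    obtain ⟨s, hs, hfin⟩ := exists_clock_ne_top_of_continuousAt
      (c := fun s => scalingRate R z (w.1 s)) (hg.comp hc)
      (by rw [← hx]; exact ENNReal.ofReal_ne_top)
    exact hfin (hinf s hs)
  have htot : (t : ℝ≥0∞) < pathTotal (scalingRate R z) w := by
    have h1 : (t : ℝ≥0∞) < pathClock (scalingRate R z) w 1 := by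
      rw [hinf 1 one_pos]
      exact ENNReal.coe_lt_top
    exact lt_of_lt_of_le h1 (clock_le_totalClock _ 1)
  -- Every positive time already carries an infinite clock, so the inverse clock never leaves `0`.
  have hinv : pathClockInv (scalingRate R z) w t = 0 := by
    by_contra hne
    obtain ⟨a, ha, ha'⟩ := exists_between (pos_iff_ne_zero.2 hne)
    have h1 : (t : ℝ≥0∞) < pathClock (scalingRate R z) w a := by
      rw [hinf a ha]
      exact ENNReal.coe_lt_top
    exact lt_asymm ha' ((clockInv_lt_iff htot).2 h1)
  rw [pathTransformRC_of_lt htot, hinv, h0]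
  rfl

theorem measurable_pathTransformRC_toPath {R : ℝ → ℝ} (hR : Measurable R) (z : ℝ) :
    Measurable fun e => pathTransformRC R z (toPath e) :=
  (measurable_pathTransformRC hR z).comp measurable_toPath

/-! ### The shift measure of the transformed excursion measure -/

section Occupation

variable {Ω : Type*} [MeasurableSpace Ω] {P : Measure Ω} [IsProbabilityMeasure P]
  {Y : Ω → RCPath ℝ} {R : ℝ → ℝ} {n : Measure Excursion} [SFinite n]
  [SigmaFinite (meanOccupation n)]

theorem HasPathMarkov.lintegral_pathIntegral (h : HasPathMarkov (pathLaw R Y P) n)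
    (hY : IsLevyPath Y P) (hR : Continuous R) (hpos : ∀ x, 0 < R x)
    {F : RCPath (WithTop ℝ) → ℝ≥0∞} (hF : Measurable F) :
    ∫⁻ e, pathIntegral F (toPath e) ∂n = ∫⁻ x, ∫⁻ w, F w ∂pathLaw R Y P x ∂meanOccupation n :=
  h.lintegral_shift hY hR hpos hF

/-- The time spent at bad shifted paths has `n`-integral `∫ P_x(bad) m(dx)`, and `P_x` charges no
bad path. -/
theorem HasPathMarkov.ae_shift_goodClock (h : HasPathMarkov (pathLaw R Y P) n)
    (hY : IsLevyPath Y P) (hR : Continuous R) (hpos : ∀ x, 0 < R x) (z : ℝ) :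
    ∀ᵐ e ∂n, ∀ᵐ s ∂timeMeasure, (toPath e).1 s ≠ ⊤ →
      GoodClock (scalingRate R z) (shift s (toPath e)) := by
  have hS : MeasurableSet {w | GoodClock (scalingRate R z) w}ᶜ :=
    (measurableSet_goodClock (measurable_scalingRate hR.measurable z)).compl
  have hF : Measurable ({w | GoodClock (scalingRate R z) w}ᶜ.indicator
    (1 : RCPath (WithTop ℝ) → ℝ≥0∞)) := measurable_one.indicator hS
  have h1 := h.lintegral_pathIntegral hY hR hpos hF
  have h2 : ∫⁻ x, ∫⁻ w, {w | GoodClock (scalingRate R z) w}ᶜ.indicator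
      (1 : RCPath (WithTop ℝ) → ℝ≥0∞) w ∂pathLaw R Y P x ∂meanOccupation n = 0 := by
    simp only [lintegral_pathLaw hR.measurable hY.measurable _ hF]
    simp [goodClock_levyTimeChange hY hR hpos]
  have hm : Measurable fun e => pathIntegral ({w | GoodClock (scalingRate R z) w}ᶜ.indicator
      (1 : RCPath (WithTop ℝ) → ℝ≥0∞)) (toPath e) :=
    (measurable_pathIntegral hF).comp measurable_toPath
  rw [h2, lintegral_eq_zero_iff hm] at h1
  filter_upwards [h1] with e he
  have he : pathIntegral _ (toPath e) = 0 := he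
  have hms : Measurable fun s => {w | GoodClock (scalingRate R z) w}ᶜ.indicator
      (1 : RCPath (WithTop ℝ) → ℝ≥0∞) (shift s (toPath e)) :=
    hF.comp (measurable_shift measurable_const measurable_id)
  rw [pathIntegral, lintegral_eq_zero_iff hms, EventuallyEq, ae_restrict_iff' (measurableSet_time_ne_top _)] at he
  filter_upwards [he] with s hs hs'
  by_contra hcon
  have := hs hs'
  simp [hcon] at this

/-- Under `P_x` the factor `g(z, v₀)` is the constant `g(z, x)`, and `Φ_z` carries `P_x` to
`P_{z+x}`. No clock condition on the excursions themselves is needed here. -/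
theorem HasPathMarkov.lintegral_pathIntegral_pathTransformRC (h : HasPathMarkov (pathLaw R Y P) n)
    (hY : IsLevyPath Y P) (hR : Continuous R) (hpos : ∀ x, 0 < R x) (z : ℝ)
    {F : RCPath (WithTop ℝ) → ℝ≥0∞} (hF : Measurable F) :
    ∫⁻ e, pathIntegral (fun v => scalingRate R z (v.1 0) * F (pathTransformRC R z v)) (toPath e) ∂n =
      ∫⁻ x, scalingRate R z (x : ℝ) * ∫⁻ w, F w ∂pathLaw R Y P (z + x) ∂meanOccupation n := by
  have hΦ : Measurable fun v => F (pathTransformRC R z v) :=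
    hF.comp (measurable_pathTransformRC hR.measurable z)
  have hm : Measurable fun v : RCPath (WithTop ℝ) =>
      scalingRate R z (v.1 0) * F (pathTransformRC R z v) :=
    ((measurable_scalingRate hR.measurable z).comp (measurable_eval_const 0)).mul hΦ
  rw [h.lintegral_pathIntegral hY hR hpos hm]
  refine lintegral_congr fun x => ?_
  rw [lintegral_pathLaw hR.measurable hY.measurable x hm,
    ← lintegral_pathTransformRC_pathLaw hY hR hpos z x hF,
    lintegral_pathLaw hR.measurable hY.measurable x hΦ]
  simp only [levyTimeChange_zero hY hR hpos]
  have : Measurable fun ω => F (pathTransformRC R z (levyTimeChange R x (Y ω))) :=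
    hΦ.comp (measurable_levyTimeChange hR.measurable measurable_const hY.measurable)
  rw [lintegral_const_mul _ this]

theorem HasPathMarkov.lintegral_shiftMeasure_pathTransformRC
    (h : HasPathMarkov (pathLaw R Y P) n) (hY : IsLevyPath Y P) (hR : Continuous R)
    (hpos : ∀ x, 0 < R x) {z : ℝ} (hgood : ∀ᵐ e ∂n, GoodClock (scalingRate R z) (toPath e))
    {F : RCPath (WithTop ℝ) → ℝ≥0∞} (hF : Measurable F) :
    ∫⁻ w, F w ∂shiftMeasure (n.map fun e => pathTransformRC R z (toPath e)) =
      ∫⁻ x, scalingRate R z (x : ℝ) * ∫⁻ w, F w ∂pathLaw R Y P (z + x) ∂meanOccupation n := by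
  rw [← TimeChangedLevy.lintegral_pathIntegral _ hF, lintegral_map (measurable_pathIntegral hF)
    (measurable_pathTransformRC_toPath hR.measurable z),
    ← h.lintegral_pathIntegral_pathTransformRC hY hR hpos z hF]
  refine lintegral_congr_ae ?_
  filter_upwards [hgood] with e he
  exact he.pathIntegral_pathTransformRC hR.measurable hF

theorem ae_goodClock_of_ae_exists {z : ℝ} (h : HasPathMarkov (pathLaw R Y P) n)
    (hY : IsLevyPath Y P) (hR : Continuous R) (hpos : ∀ x, 0 < R x)
    (hlife : ∀ᵐ e ∂n, 0 < lifetime e.1)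
    (hfin : ∀ᵐ e ∂n, ∃ s, 0 < s ∧ pathClock (scalingRate R z) (toPath e) s ≠ ∞) :
    ∀ᵐ e ∂n, GoodClock (scalingRate R z) (toPath e) := by
  filter_upwards [hlife, hfin, h.ae_shift_goodClock hY hR hpos z] with e h1 h2 h3
  obtain ⟨b, hb, hne⟩ := exists_ne_top h1
  exact goodClock_of_ae_shift hb hne h3 h2

end Occupation

theorem lintegral_shiftMeasure_smul {μ : Measure (RCPath (WithTop ℝ))} [SFinite μ] (c : ℝ≥0∞)
    [SFinite (c • μ)] {F : RCPath (WithTop ℝ) → ℝ≥0∞} (hF : Measurable F) :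
    ∫⁻ w, F w ∂shiftMeasure (c • μ) = c * ∫⁻ w, F w ∂shiftMeasure μ := by
  rw [← lintegral_pathIntegral _ hF, ← lintegral_pathIntegral _ hF, lintegral_smul_measure]
  rfl

/-- Under scale invariance, the clock of almost every excursion is finite near the origin. -/
theorem ae_exists_clock_ne_top_of_map_eq {R : ℝ → ℝ} {n : Measure Excursion} (hR : Continuous R)
    (hpos : ∀ x, 0 < R x) {z : ℝ} {c : ℝ≥0∞} (hlife : ∀ᵐ e ∂n, 0 < lifetime e.1)
    (hmap : n.map (fun e => pathTransformRC R z (toPath e)) = c • n.map toPath) :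
    ∀ᵐ e ∂n, ∃ s, 0 < s ∧ pathClock (scalingRate R z) (toPath e) s ≠ ∞ := by
  have h1 : ∀ᵐ w ∂n.map toPath, ∃ s, w.1 s ≠ ⊤ := by
    rw [ae_map_iff measurable_toPath.aemeasurable measurableSet_exists_ne_top]
    filter_upwards [hlife] with e he
    obtain ⟨b, hb, hne⟩ := exists_ne_top he
    obtain ⟨s, hs, hsb⟩ := exists_between hb
    exact ⟨s, hne s hs hsb⟩
  -- By invariance almost every transformed path is finite somewhere, which an instantaneous
  -- explosion of the clock would prevent.
  have h2 : ∀ᵐ w ∂n.map (fun e => pathTransformRC R z (toPath e)), ∃ s, w.1 s ≠ ⊤ :=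
    hmap ▸ Measure.ae_smul_measure h1 c
  rw [ae_map_iff (measurable_pathTransformRC_toPath hR.measurable z).aemeasurable
    measurableSet_exists_ne_top] at h2
  filter_upwards [h2] with e he
  by_contra! hcon
  obtain ⟨s, hs⟩ := he
  exact hs (pathTransformRC_eq_top hR hpos hcon s)

/-- The σ-algebra on right-continuous paths is pulled back from the product space, so the image
measures may be compared at either level. -/
theorem map_toPath_eq_iff {R : ℝ → ℝ} {n : Measure Excursion} (hR : Measurable R) (z : ℝ)
    (c : ℝ≥0∞) : n.map (fun w => pathTransform R z w.1) = c • n.map Subtype.val ↔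
      n.map (fun e => pathTransformRC R z (toPath e)) = c • n.map toPath := by
  have hm := measurable_pathTransformRC_toPath hR z
  have h1 : n.map (fun w => pathTransform R z w.1) =
      (n.map (fun e => pathTransformRC R z (toPath e))).map Subtype.val := by
    rw [Measure.map_map measurable_subtype_coe hm]
    congr 1
    ext1 e
    exact (pathTransformRC_val R z (toPath e)).symm
  have h2 : n.map Subtype.val = (n.map toPath).map Subtype.val := by
    rw [Measure.map_map measurable_subtype_coe measurable_toPath]
    rfl
  rw [h1, h2, ← Measure.map_smul]
  refine ⟨fun h => ?_, fun h => by rw [h]⟩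
  ext S hS
  obtain ⟨S', hS', rfl⟩ := hS
  rw [← Measure.map_apply measurable_subtype_coe hS', h,
    Measure.map_apply measurable_subtype_coe hS']

/-! ### Scale invariance in terms of the mean occupation measure -/

theorem meanOccupation_ne_zero {n : Measure Excursion} [SFinite n] (hn : n ≠ 0) (hlife : ∀ᵐ e ∂n, 0 < lifetime e.1) :
    meanOccupation n ≠ 0 := by
  intro h0
  have h1 := lintegral_meanOccupation n (φ := 1) measurable_one
  rw [h0, lintegral_zero_measure] at h1
  have hm : Measurable fun e : Excursion =>
      pathIntegral (fun _ => (1 : ℝ≥0∞)) (toPath e) :=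
    (measurable_pathIntegral measurable_const).comp measurable_toPath
  have h2 := (lintegral_eq_zero_iff hm).1 h1.symm
  refine hn ?_
  rw [← ae_eq_bot]
  refine eventually_false_iff_eq_bot.1 ?_
  filter_upwards [h2, hlife] with e h3 h4
  obtain ⟨b, hb, hne⟩ := exists_ne_top h4
  obtain ⟨s, hs, hsb⟩ := exists_between hb
  exact pathIntegral_ne_zero measurable_const ⟨s, hne s hs hsb⟩ (fun _ _ => one_ne_zero) h3

section Invariance

variable {Ω : Type*} [MeasurableSpace Ω] {P : Measure Ω} [IsProbabilityMeasure P]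
  {Y : Ω → RCPath ℝ} {R : ℝ → ℝ} {n : Measure Excursion}

theorem lintegral_start_pathLaw (hY : IsLevyPath Y P) (hR : Continuous R) (hpos : ∀ x, 0 < R x)
    (x : ℝ) {φ : WithTop ℝ → ℝ≥0∞} (hφ : Measurable φ) :
    ∫⁻ w, φ (w.1 0) ∂pathLaw R Y P x = φ x := by
  have hm : Measurable fun w : RCPath (WithTop ℝ) => φ (w.1 0) := hφ.comp (measurable_eval_const 0)
  rw [lintegral_pathLaw hR.measurable hY.measurable x hm]
  simp [levyTimeChange_zero hY hR hpos]

variable [SFinite n] [SigmaFinite (meanOccupation n)]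

theorem lintegral_meanOccupation_of_map_eq (h : HasPathMarkov (pathLaw R Y P) n)
    (hY : IsLevyPath Y P) (hR : Continuous R) (hpos : ∀ x, 0 < R x)
    (hlife : ∀ᵐ e ∂n, 0 < lifetime e.1) {z : ℝ} {c : ℝ≥0∞} [SFinite (c • n.map toPath)]
    (hmap : n.map (fun e => pathTransformRC R z (toPath e)) = c • n.map toPath) {φ : ℝ → ℝ≥0∞}
    (hφ : Measurable φ) :
    ∫⁻ x, scalingRate R z (x : ℝ) * φ (z + x) ∂meanOccupation n =
      c * ∫⁻ x, φ x ∂meanOccupation n := by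
  have hφ' : Measurable fun y : WithTop ℝ => φ (y.untopD 0) := hφ.comp measurable_untopD
  have hF : Measurable fun w : RCPath (WithTop ℝ) => φ ((w.1 0).untopD 0) :=
    hφ'.comp (measurable_eval_const 0)
  have hgood := ae_goodClock_of_ae_exists h hY hR hpos hlife
    (ae_exists_clock_ne_top_of_map_eq hR hpos hlife hmap)
  have h1 := h.lintegral_shiftMeasure_pathTransformRC hY hR hpos hgood hF
  rw [hmap, lintegral_shiftMeasure_smul c hF, ← lintegral_pathIntegral _ hF,
    lintegral_map (measurable_pathIntegral hF) measurable_toPath,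
    h.lintegral_pathIntegral hY hR hpos hF] at h1
  simp only [lintegral_start_pathLaw hY hR hpos _ hφ'] at h1
  exact h1.symm

/-- The integral of `Ψ k` is `c` times that of the time integral of `f` after time `k`, which
vanishes as `k → ∞`. By Fatou `Ψ k` has lower limit `0` almost everywhere, while an instantaneous
explosion would bound it below by some `L ≠ 0`. -/
theorem ae_exists_clock_ne_top_of_lintegral_eq (h : HasPathMarkov (pathLaw R Y P) n)
    (hY : IsLevyPath Y P) (hR : Continuous R) (hpos : ∀ x, 0 < R x)
    (hlife : ∀ᵐ e ∂n, 0 < lifetime e.1) {z : ℝ} {c : ℝ≥0∞} (hc : c ≠ ∞)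
    (hocc : ∀ φ : ℝ → ℝ≥0∞, Measurable φ →
      ∫⁻ x, scalingRate R z (x : ℝ) * φ (z + x) ∂meanOccupation n =
        c * ∫⁻ x, φ x ∂meanOccupation n) {f : WithTop ℝ → ℝ≥0} (hf : Measurable f)
    (hf0 : f ⊤ = 0) (hfpos : ∀ y ≠ ⊤, f y ≠ 0)
    (hfin : ∫⁻ x : ℝ, f x ∂meanOccupation n ≠ ∞) :
    ∀ᵐ e ∂n, ∃ s, 0 < s ∧ pathClock (scalingRate R z) (toPath e) s ≠ ∞ := by
  have hmk := isMarkovKernel_pathLaw (P := P) hR.measurable hY.measurable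
  have hfm : Measurable fun y => (f y : ℝ≥0∞) := measurable_coe_nnreal_ennreal.comp hf
  have hft : ∀ t, Measurable fun w : RCPath (WithTop ℝ) => (f (w.1 t) : ℝ≥0∞) := fun t =>
    hfm.comp (measurable_eval_const t)
  have hUm : ∀ t, Measurable fun e : Excursion =>
      pathIntegral (fun w => (f (w.1 t) : ℝ≥0∞)) (toPath e) := fun t =>
    (measurable_pathIntegral (hft t)).comp measurable_toPath
  let Ψ : ℕ → Excursion → ℝ≥0∞ := fun k e => pathIntegral (fun v =>
    scalingRate R z (v.1 0) * f ((pathTransformRC R z v).1 k)) (toPath e)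
  have hΨm : ∀ k, Measurable (Ψ k) := by
    intro k
    have : Measurable fun v : RCPath (WithTop ℝ) =>
        scalingRate R z (v.1 0) * f ((pathTransformRC R z v).1 k) :=
      ((measurable_scalingRate hR.measurable z).comp (measurable_eval_const 0)).mul
        ((hft k).comp (measurable_pathTransformRC hR.measurable z))
    exact (measurable_pathIntegral this).comp measurable_toPath
  have habs : ∀ e : Excursion, Absorbed (toPath e) := fun e =>
    absorbed_of_forall_pos fun s t hs hst h => eq_top_of_le hs hst h
  have hΨ : ∀ k, ∫⁻ e, Ψ k e ∂n =
      c * ∫⁻ e, pathIntegral (fun w => (f (w.1 k) : ℝ≥0∞)) (toPath e) ∂n := by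
    intro k
    rw [h.lintegral_pathIntegral_pathTransformRC hY hR hpos z (hft k),
      hocc _ (hft k).lintegral_kernel, h.lintegral_pathIntegral hY hR hpos (hft k)]
  have hU0 : ∫⁻ e, pathIntegral (fun w => (f (w.1 0) : ℝ≥0∞)) (toPath e) ∂n ≠ ∞ := by
    rw [h.lintegral_pathIntegral hY hR hpos (hft 0)]
    simpa only [lintegral_start_pathLaw hY hR hpos _ hfm] using hfin
  -- For almost every excursion this is the tail after time `k` of a convergent integral; the full
  -- integral dominates.
  have hlim0 : Tendsto (fun k : ℕ => ∫⁻ e, pathIntegral (fun w => (f (w.1 k) : ℝ≥0∞))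
      (toPath e) ∂n) atTop (𝓝 0) := by
    have := tendsto_lintegral_of_dominated_convergence (μ := n) (f := fun _ => 0)
      (F := fun (k : ℕ) e => pathIntegral (fun w => (f (w.1 k) : ℝ≥0∞)) (toPath e))
      (fun e => pathIntegral (fun w => (f (w.1 0) : ℝ≥0∞)) (toPath e)) (fun k => hUm k)
      (fun k => Eventually.of_forall fun e => (habs e).pathIntegral_le hf0 k) hU0 ?_
    · simpa using this
    · filter_upwards [ae_lt_top (hUm 0) hU0] with e he
      set v : ℝ≥0 → ℝ≥0∞ := fun s => (f (e.1 s) : ℝ≥0∞) with hv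
      have h1 : ∀ k : ℕ, pathIntegral (fun w => (f (w.1 k) : ℝ≥0∞)) (toPath e) =
          timeMeasure.withDensity v (Ici (k : ℝ≥0)) := by
        intro k
        rw [(habs e).pathIntegral_eq hf0, withDensity_apply _ measurableSet_Ici,
          lintegral_Ici_timeMeasure]
        rfl
      simp only [h1]
      have h2 : (⋂ k : ℕ, Ici (k : ℝ≥0)) = ∅ := by
        ext s
        simp only [mem_iInter, mem_Ici, mem_empty_iff_false, iff_false, not_forall, not_le]
        exact exists_nat_gt s
      have h3 := tendsto_measure_iInter_atTop (μ := timeMeasure.withDensity v)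
        (s := fun k : ℕ => Ici (k : ℝ≥0)) (fun k => measurableSet_Ici.nullMeasurableSet)
        (fun k l hkl => Ici_subset_Ici.2 (by exact_mod_cast hkl)) ⟨0, by
          rw [← h1]
          simpa using he.ne⟩
      rwa [h2, measure_empty] at h3
  have hlim : Tendsto (fun k => ∫⁻ e, Ψ k e ∂n) atTop (𝓝 0) := by
    simp only [hΨ]
    simpa using ENNReal.Tendsto.const_mul hlim0 (Or.inr hc)
  have hliminf : ∫⁻ e, liminf (fun k => Ψ k e) atTop ∂n = 0 := by
    have := lintegral_liminf_le (μ := n) (u := atTop) hΨm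
    rw [hlim.liminf_eq] at this
    exact le_antisymm this (zero_le)
  rw [lintegral_eq_zero_iff (Measurable.liminf (f := Ψ) hΨm)] at hliminf
  filter_upwards [hliminf, hlife, h.ae_shift_goodClock hY hR hpos z] with e h1 h2 h3
  by_contra! hcon
  obtain ⟨b, hb, hne⟩ := exists_ne_top h2
  obtain ⟨L, hL, hLle⟩ := exists_le_pathIntegral_of_clock_eq_top (w := toPath e) hR.measurable hpos
    (fun s t hs hst h => eq_top_of_le hs hst h) hb hne h3 hcon hf hf0 hfpos
  have h4 : L ≤ liminf (fun k => Ψ k e) atTop :=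
    le_liminf_of_le (h := Eventually.of_forall fun k => hLle k)
  rw [h1] at h4
  exact hL (le_antisymm h4 (zero_le))

/-- Scale invariance of the mean occupation measure implies scale invariance of the excursion
measure. -/
theorem map_eq_of_lintegral_eq (h : HasPathMarkov (pathLaw R Y P) n)
    (hY : IsLevyPath Y P) (hR : Continuous R) (hpos : ∀ x, 0 < R x)
    (hlife : ∀ᵐ e ∂n, 0 < lifetime e.1) {z : ℝ} {c : ℝ≥0∞} (hc : c ≠ ∞)
    [SFinite (c • n.map toPath)]
    (hocc : ∀ φ : ℝ → ℝ≥0∞, Measurable φ →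
      ∫⁻ x, scalingRate R z (x : ℝ) * φ (z + x) ∂meanOccupation n =
        c * ∫⁻ x, φ x ∂meanOccupation n) {f : Bool → WithTop ℝ → ℝ≥0}
    (hf : ∀ b, Continuous (f b)) (hf0 : ∀ b, f b ⊤ = 0) (hle : f true ≤ f false)
    (hfpos : ∀ y ≠ ⊤, f false y ≠ 0) {G : ℝ≥0 × ℝ≥0 → WithTop ℝ} (hG : Measurable G)
    (hGf : ∀ y, G (f false y, f true y) = y)
    (hfin : ∫⁻ x : ℝ, f false x ∂meanOccupation n ≠ ∞) :
    n.map (fun e => pathTransformRC R z (toPath e)) = c • n.map toPath := by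
  have hmk := isMarkovKernel_pathLaw (P := P) hR.measurable hY.measurable
  have hm := measurable_pathTransformRC_toPath hR.measurable z
  have hgood := ae_goodClock_of_ae_exists h hY hR hpos hlife
    (ae_exists_clock_ne_top_of_lintegral_eq h hY hR hpos hlife hc hocc (hf false).measurable
      (hf0 false) hfpos hfin)
  have hset : MeasurableSet {w : RCPath (WithTop ℝ) | Absorbed w ∧ ∃ s, w.1 s ≠ ⊤} :=
    measurableSet_absorbed.inter measurableSet_exists_ne_top
  have hQ : ∀ F : RCPath (WithTop ℝ) → ℝ≥0∞, Measurable F →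
      ∫⁻ w, F w ∂shiftMeasure (n.map fun e => pathTransformRC R z (toPath e)) =
        c * ∫⁻ x, ∫⁻ w, F w ∂pathLaw R Y P x ∂meanOccupation n := fun F hF => by
    rw [h.lintegral_shiftMeasure_pathTransformRC hY hR hpos hgood hF, hocc _ hF.lintegral_kernel]
  refine eq_of_shiftMeasure_eq hf hf0 hle hfpos hG hGf ?_ ?_ ?_ ?_
  · rw [ae_map_iff hm.aemeasurable hset]
    filter_upwards [hgood, hlife] with e h1 h2
    obtain ⟨b, hb, hne⟩ := exists_ne_top h2
    obtain ⟨s, hs, hsb⟩ := exists_between hb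
    refine ⟨absorbed_of_forall_pos fun s t hs hst h => ?_,
      h1.exists_pathTransformRC_ne_top hR.measurable hpos ⟨s, hne s hs hsb⟩⟩
    exact h1.pathTransformRC_eq_top_of_le (fun s t hs hst h => eq_top_of_le hs hst h) hb hne hs hst h
  · refine Measure.ae_smul_measure ?_ c
    rw [ae_map_iff measurable_toPath.aemeasurable hset]
    filter_upwards [hlife] with e h2
    obtain ⟨b, hb, hne⟩ := exists_ne_top h2
    obtain ⟨s, hs, hsb⟩ := exists_between hb
    exact ⟨absorbed_of_forall_pos fun s t hs hst h => eq_top_of_le hs hst h, s, hne s hs hsb⟩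
  · refine Measure.ext_of_lintegral _ fun F hF => ?_
    rw [hQ F hF, lintegral_shiftMeasure_smul c hF, ← lintegral_pathIntegral _ hF,
      lintegral_map (measurable_pathIntegral hF) measurable_toPath,
      h.lintegral_pathIntegral hY hR hpos hF]
  · have hF := measurable_evalFun hf (0, false)
    have hfm : Measurable fun y => (f false y : ℝ≥0∞) :=
      measurable_coe_nnreal_ennreal.comp (hf false).measurable
    rw [hQ _ hF]
    refine ENNReal.mul_ne_top hc ?_
    simpa only [evalFun, lintegral_start_pathLaw hY hR hpos _ hfm] using hfin

end Invariance

/-! ### The invariant occupation measure -/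

section Lebesgue

variable {R : ℝ → ℝ} {θ : ℝ} {m : Measure ℝ}

/-- σ-finiteness yields proportionality to Lebesgue measure, a priori with a factor in `[0, ∞]`. The
factor is finite because some set of positive Lebesgue measure has finite `ρ`-measure. -/
theorem exists_eq_smul_volume {ρ : Measure ℝ} [SigmaFinite ρ] [ρ.IsAddLeftInvariant] :
    ∃ c : ℝ≥0, ρ = (c : ℝ≥0∞) • (volume : Measure ℝ) := by
  have h1 : ρ = (ρ (Icc 0 1) / volume (Icc (0 : ℝ) 1)) • (volume : Measure ℝ) :=
    measure_eq_sub_vadd ρ volume (by simp) (by simp)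
  have h2 : ∃ k, volume (spanningSets ρ k) ≠ 0 := by
    by_contra! hcon
    have := measure_iUnion_null hcon
    rw [iUnion_spanningSets] at this
    simp at this
  obtain ⟨k, hk⟩ := h2
  generalize ρ (Icc 0 1) / volume (Icc (0 : ℝ) 1) = a at h1
  have h3 := measure_spanningSets_lt_top ρ k
  have ha : a ≠ ∞ := by
    rintro rfl
    refine h3.ne ?_
    generalize spanningSets ρ k = S at hk
    rw [h1, Measure.smul_apply, smul_eq_mul, ENNReal.top_mul hk]
  exact ⟨a.toNNReal, by rwa [ENNReal.coe_toNNReal ha]⟩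

theorem exists_eq_withDensity_of_lintegral_eq [SigmaFinite m] (hm : m ≠ 0) (hR : Continuous R)
    (hpos : ∀ x, 0 < R x)
    (h : ∀ (z : ℝ) (φ : ℝ → ℝ≥0∞), Measurable φ →
      ∫⁻ x, scalingRate R z (x : ℝ) * φ (z + x) ∂m =
        ENNReal.ofReal (Real.exp (-θ * z)) * ∫⁻ x, φ x ∂m) :
    ∃ C : ℝ, 0 < C ∧
      m = volume.withDensity fun y => ENNReal.ofReal (C * (Real.exp (θ * y) / R y)) := by
  have hRm := hR.measurable
  -- This weight makes `m` translation invariant: `g(z, x) d(z + x) = e^{-θz} d(x)`.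
  set d : ℝ → ℝ≥0∞ := fun y => ENNReal.ofReal (Real.exp (-θ * y) * R y) with hd
  have hdm : Measurable d := by fun_prop
  have hd0 : ∀ y, d y ≠ 0 := fun y => by
    have := mul_pos (Real.exp_pos (-θ * y)) (hpos y)
    simpa [hd] using this
  have hdtop : ∀ y, d y ≠ ∞ := fun y => ENNReal.ofReal_ne_top
  set ρ := m.withDensity d with hρ
  have : SigmaFinite ρ := SigmaFinite.withDensity_ofReal _
  have : ρ.IsAddLeftInvariant := by
    refine ⟨fun z => Measure.ext_of_lintegral _ fun φ hφ => ?_⟩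
    have hφz : Measurable fun x => φ (z + x) := hφ.comp (measurable_const_add z)
    rw [lintegral_map hφ (measurable_const_add z), hρ,
      lintegral_withDensity_eq_lintegral_mul _ hdm hφz, lintegral_withDensity_eq_lintegral_mul _ hdm hφ]
    -- The factor `e^{θz}` in the test function cancels `e^{-θz}` on the right-hand side.
    have h1 := h z (fun y => ENNReal.ofReal (Real.exp (θ * z)) * (d y * φ y)) (by fun_prop)
    rw [lintegral_const_mul _ (by fun_prop), ← mul_assoc, ← ENNReal.ofReal_mul (Real.exp_pos _).le,
      ← Real.exp_add] at h1
    simp only [neg_mul, neg_add_cancel, Real.exp_zero, ENNReal.ofReal_one, one_mul] at h1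
    refine Eq.trans (lintegral_congr fun x => ?_) h1
    simp only [Pi.mul_apply, hd, scalingRate]
    have hRz := hpos (z + x)
    have hRx := hpos x
    rw [← mul_assoc, ← mul_assoc, ← ENNReal.ofReal_mul (by positivity),
      ← ENNReal.ofReal_mul (by positivity)]
    congr 2
    have : Real.exp (-θ * x) = Real.exp (θ * z) * Real.exp (-θ * (z + x)) := by
      rw [← Real.exp_add]
      ring_nf
    rw [this]
    field_simp
  obtain ⟨c, hc⟩ := exists_eq_smul_volume (ρ := ρ)
  have hm' : m = ρ.withDensity fun y => (d y)⁻¹ := by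
    rw [hρ, withDensity_inv_same hdm (Eventually.of_forall hd0) (Eventually.of_forall hdtop)]
  have hc0 : c ≠ 0 := by
    rintro rfl
    apply hm
    rw [hm', hc]
    simp
  refine ⟨c, by positivity, ?_⟩
  rw [hm', hc, withDensity_smul_measure, ← withDensity_smul' _ _ ENNReal.coe_ne_top]
  congr 1
  ext y
  simp only [Pi.smul_apply, hd]
  rw [ENNReal.ofReal_mul c.coe_nonneg, ENNReal.ofReal_coe_nnreal,
    ← ENNReal.ofReal_inv_of_pos (mul_pos (Real.exp_pos _) (hpos y)), smul_eq_mul, mul_inv,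
    ← Real.exp_neg, neg_mul, neg_neg, div_eq_mul_inv]

theorem lintegral_eq_of_eq_withDensity {C : ℝ} (hC : 0 < C) (hR : Continuous R)
    (hpos : ∀ x, 0 < R x)
    (hm : m = volume.withDensity fun y => ENNReal.ofReal (C * (Real.exp (θ * y) / R y))) (z : ℝ)
    {φ : ℝ → ℝ≥0∞} (hφ : Measurable φ) :
    ∫⁻ x, scalingRate R z (x : ℝ) * φ (z + x) ∂m =
      ENNReal.ofReal (Real.exp (-θ * z)) * ∫⁻ x, φ x ∂m := by
  have hRm := hR.measurable
  have hd : Measurable fun y => ENNReal.ofReal (C * (Real.exp (θ * y) / R y)) := by fun_prop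
  have h1 : Measurable fun x : ℝ => scalingRate R z (x : ℝ) * φ (z + x) := by
    have := (measurable_scalingRate hRm z).comp WithTop.measurable_coe
    exact this.mul (hφ.comp (measurable_const_add z))
  rw [hm, lintegral_withDensity_eq_lintegral_mul _ hd h1,
    lintegral_withDensity_eq_lintegral_mul _ hd hφ, ← lintegral_const_mul _ (hd.mul hφ)]
  refine Eq.trans (lintegral_congr fun x => ?_) (lintegral_add_left_eq_self _ z)
  simp only [Pi.mul_apply, scalingRate]
  have h2 := hpos x
  have h3 := hpos (z + x)
  rw [← mul_assoc, ← mul_assoc, ← ENNReal.ofReal_mul (by positivity),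
    ← ENNReal.ofReal_mul (by positivity)]
  congr 2
  have : Real.exp (θ * (z + x)) = Real.exp (θ * z) * Real.exp (θ * x) := by
    rw [← Real.exp_add]
    ring_nf
  rw [this, neg_mul, Real.exp_neg]
  field_simp

end Lebesgue

/-! ### Test functions -/

/-- The extension of a function on `ℝ` by `0` at `∞`. -/
def extendZero (b : ℝ → ℝ≥0) : WithTop ℝ → ℝ≥0
  | ⊤ => 0
  | (x : ℝ) => b x

theorem continuous_extendZero {b : ℝ → ℝ≥0} (hb : Continuous b) (hlim : Tendsto b atTop (𝓝 0)) :
    Continuous (extendZero b) := by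
  refine continuous_iff_continuousAt.2 fun y => ?_
  cases y with
  | coe x =>
    rw [← WithTop.isOpenEmbedding_some.continuousAt_iff]
    exact hb.continuousAt
  | top =>
    rw [ContinuousAt]
    change Tendsto _ _ (𝓝 0)
    refine tendsto_order.2 ⟨fun a ha => absurd ha (by simp), fun a ha => ?_⟩
    obtain ⟨N, hN⟩ := eventually_atTop.1 (hlim.eventually_lt_const ha)
    filter_upwards [Ioi_mem_nhds (WithTop.coe_lt_top N)] with y hy
    cases y with
    | top => exact ha
    | coe x => exact hN x (WithTop.coe_le_coe.1 (le_of_lt hy))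

/-- There is a pair of test functions that separates the points of `(-∞, ∞]` and is integrable with
respect to the invariant occupation measure. -/
theorem exists_test_functions {R : ℝ → ℝ} (hR : Continuous R) (hpos : ∀ x, 0 < R x) (θ C : ℝ) :
    ∃ (f : Bool → WithTop ℝ → ℝ≥0) (G : ℝ≥0 × ℝ≥0 → WithTop ℝ), (∀ b, Continuous (f b)) ∧
      (∀ b, f b ⊤ = 0) ∧ f true ≤ f false ∧ (∀ y ≠ ⊤, f false y ≠ 0) ∧ Measurable G ∧
      (∀ y, G (f false y, f true y) = y) ∧
      ∫⁻ x : ℝ, f false x ∂volume.withDensity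
        (fun y => ENNReal.ofReal (C * (Real.exp (θ * y) / R y))) ≠ ∞ := by
  classical
  have hRm := hR.measurable
  -- The factor `R x e^{-θx}` cancels the density of the occupation measure, leaving the integrable
  -- bound `|C| / (1 + x²)`; the minimum with `1` makes `β` vanish at `+∞`.
  set β : ℝ → ℝ := fun x => min 1 (R x * Real.exp (-θ * x)) / (1 + x ^ 2) with hβ
  -- The quotient `β / γ = 1 + e^x` determines `x`, and `γ ≤ β`.
  set γ : ℝ → ℝ := fun x => β x / (1 + Real.exp x) with hγ
  have hβpos : ∀ x, 0 < β x := fun x =>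
    div_pos (lt_min one_pos (mul_pos (hpos x) (Real.exp_pos _))) (by positivity)
  have hγpos : ∀ x, 0 < γ x := fun x => div_pos (hβpos x) (by positivity)
  have hγβ : ∀ x, γ x ≤ β x := fun x =>
    div_le_self (hβpos x).le (by linarith [Real.exp_pos x])
  have hβc : Continuous β :=
    Continuous.div (by fun_prop) (by fun_prop) fun x => by positivity
  have hγc : Continuous γ := hβc.div (by fun_prop) fun x => by positivity
  have hβlim : Tendsto β atTop (𝓝 0) := by
    refine squeeze_zero (fun x => (hβpos x).le) (g := fun x => (1 + x ^ 2)⁻¹) (fun x => ?_) ?_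
    · rw [hβ, ← one_div]
      simp only
      gcongr
      exact min_le_left _ _
    · exact tendsto_inv_atTop_zero.comp
        (tendsto_atTop_add_const_left _ _ (tendsto_pow_atTop two_ne_zero))
  have hγlim : Tendsto γ atTop (𝓝 0) := squeeze_zero (fun x => (hγpos x).le) hγβ hβlim
  have hnn : ∀ {b : ℝ → ℝ}, Tendsto b atTop (𝓝 0) →
      Tendsto (fun x => (b x).toNNReal) atTop (𝓝 0) := fun {b} hb => by
    have := (continuous_real_toNNReal.tendsto 0).comp hb
    rwa [Real.toNNReal_zero] at this
  let f : Bool → WithTop ℝ → ℝ≥0 := fun i =>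
    extendZero fun x => ((if i then γ else β) x).toNNReal
  -- Since `β > 0` on `ℝ`, the value `0` identifies the point `⊤`.
  let G : ℝ≥0 × ℝ≥0 → WithTop ℝ := fun p =>
    if p.1 = 0 then ⊤ else ((Real.log ((p.1 : ℝ) / p.2 - 1) : ℝ) : WithTop ℝ)
  refine ⟨f, G, ?_, fun b => rfl, ?_, ?_, ?_, ?_, ?_⟩
  · rintro (_ | _)
    · exact continuous_extendZero (continuous_real_toNNReal.comp hβc) (hnn hβlim)
    · exact continuous_extendZero (continuous_real_toNNReal.comp hγc) (hnn hγlim)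
  · intro y
    cases y with
    | top => exact le_rfl
    | coe x => exact Real.toNNReal_le_toNNReal (hγβ x)
  · intro y hy
    cases y with
    | top => exact absurd rfl hy
    | coe x => exact (Real.toNNReal_pos.2 (hβpos x)).ne'
  · refine Measurable.ite (measurable_fst (measurableSet_singleton 0)) measurable_const ?_
    exact WithTop.measurable_coe.comp (by fun_prop)
  · intro y
    cases y with
    | top => simp [G, f, extendZero]
    | coe x =>
      have h1 : f false (x : ℝ) = (β x).toNNReal := rfl
      have h2 : f true (x : ℝ) = (γ x).toNNReal := rfl
      have h3 : (β x).toNNReal ≠ 0 := (Real.toNNReal_pos.2 (hβpos x)).ne'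
      simp only [G, h1, h2, if_neg h3, Real.coe_toNNReal _ (hβpos x).le,
        Real.coe_toNNReal _ (hγpos x).le]
      have h4 : β x / γ x - 1 = Real.exp x := by
        have := (hβpos x).ne'
        have h5 : 1 + Real.exp x ≠ 0 := by positivity
        rw [hγ]
        field_simp
        ring
      rw [h4, Real.log_exp]
  · have hfm : Measurable fun x : ℝ => (f false (x : ℝ) : ℝ≥0∞) :=
      measurable_coe_nnreal_ennreal.comp (measurable_real_toNNReal.comp hβc.measurable)
    rw [lintegral_withDensity_eq_lintegral_mul _ (by fun_prop) hfm]
    have hint : Integrable (fun x : ℝ => |C| * (1 + x ^ 2)⁻¹) :=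
      integrable_inv_one_add_sq.const_mul _
    refine ne_top_of_le_ne_top hint.lintegral_lt_top.ne (lintegral_mono fun x => ?_)
    have h1 : (f false (x : ℝ) : ℝ≥0∞) = ENNReal.ofReal (β x) := rfl
    rw [Pi.mul_apply, h1, ← ENNReal.ofReal_mul' (hβpos x).le]
    refine ENNReal.ofReal_le_ofReal ?_
    have hRx := hpos x
    have h2 : β x ≤ R x * Real.exp (-θ * x) * (1 + x ^ 2)⁻¹ := by
      rw [← div_eq_mul_inv, hβ]
      simp only
      gcongr
      exact min_le_right _ _
    calc C * (Real.exp (θ * x) / R x) * β x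
        ≤ |C| * (Real.exp (θ * x) / R x) * (R x * Real.exp (-θ * x) * (1 + x ^ 2)⁻¹) := by
          have := hβpos x
          gcongr
          exact le_abs_self C
      _ = |C| * (1 + x ^ 2)⁻¹ := by
          rw [neg_mul, Real.exp_neg]
          have := Real.exp_pos (θ * x)
          field_simp

end TimeChangedLevy

end

/-! ### The equivalence of scale invariance and the occupation density -/

open TimeChangedLevy in
theorem proposition5p3 {Ω : Type*} [MeasurableSpace Ω] (P : Measure Ω) [IsProbabilityMeasure P]
    (ξ : ℝ≥0 → Ω → ℝ) (hξ : IsLevyProcess ξ P) (hξ_nonlattice : ¬ IsLattice ξ P)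
    (R : ℝ → ℝ) (hR_cont : Continuous R) (hR_pos : ∀ x, 0 < R x)
    (hR_bot : ∃ c : ℝ, 0 < c ∧ ∀ᶠ x in atBot, c ≤ 1 / R x)
    (hR_ratio : ∀ z : ℝ, ∃ c : ℝ, 0 < c ∧ ∀ᶠ x in atBot, c ≤ R x / R (z + x))
    (θ : ℝ) (hθ : 0 < θ)
    (n : Measure Excursion) (hn_sigma : SigmaFinite n) (hn_ne : n ≠ 0)
    (hn : IsExcursionMeasure R ξ P n) (hn_occ : SigmaFinite (meanOccupation n)) :
    (∀ z : ℝ, n.map (fun w => pathTransform R z w.1) =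
        ENNReal.ofReal (Real.exp (-θ * z)) • n.map Subtype.val) ↔
      ∃ C : ℝ, 0 < C ∧ meanOccupation n =
        volume.withDensity fun y => ENNReal.ofReal (C * (Real.exp (θ * y) / R y)) := by
  obtain ⟨Y, hY, hYξ⟩ := hξ.exists_isLevyPath
  have h : HasPathMarkov (pathLaw R Y P) n := fun s t hs ht Λ hΛ A hA =>
    hn.markov_pathLaw hR_cont.measurable hY.measurable hYξ hs ht hΛ hA
  simp only [map_toPath_eq_iff hR_cont.measurable]
  constructor
  · intro hmap
    exact exists_eq_withDensity_of_lintegral_eq (meanOccupation_ne_zero hn_ne hn.lifetime_pos)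
      hR_cont hR_pos fun z φ hφ =>
        lintegral_meanOccupation_of_map_eq h hY hR_cont hR_pos hn.lifetime_pos (hmap z) hφ
  · rintro ⟨C, hC, hm⟩ z
    obtain ⟨f, G, hf, hf0, hle, hfpos, hG, hGf, hfin⟩ := exists_test_functions hR_cont hR_pos θ C
    exact map_eq_of_lintegral_eq h hY hR_cont hR_pos hn.lifetime_pos ENNReal.ofReal_ne_top
      (fun φ hφ => lintegral_eq_of_eq_withDensity hC hR_cont hR_pos hm z hφ) hf hf0 hle hfpos hG
      hGf (hm ▸ hfin)
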